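/- Let $k$ be a function field of one variable over a finite field, of characteristic different from $2$, with adele ring $\mathbb A$ and idele norm $|\cdot|_{\mathbb A}$. Let $V$ be the space of binary quadratic forms $F_x(z_1,z_2)=x_0z_1^2+x_1z_1z_2+x_2z_2^2$, $x=(x_0,x_1,x_2)$, on which $G=GL(1)\times GL(2)$ acts by $F_{g\cdot x}(z_1,z_2)=tF_x(az_1+cz_2,\,bz_1+dz_2)$ for $g=\left(t,\begin{pmatrix}a&b\\c&d\end{pmatrix}\right)$. Let $\varrho:G\to GL(V)$ be this representation, $H=\operatorname{Im}\varrho$, and let $\chi$ be the character of $H$ induced by $g\mapsto t(ad-bc)$. Let $V_k''$ be the set of $x\in V_k$ with $x_1^2-4x_0x_2\neq0$ such that the splitting field of $F_x$ over $k$ has degree $2$ over $k$. Fix a Haar measure $dh$ on $H_{\mathbb A}$, and give $H_{\mathbb A}/H_k$ the measure $dh$ determined by $$\int_{H_{\mathbb A}}f(h)\,dh=\int_{H_{\mathbb A}/H_k}\sum_{\gamma\in H_k}f(h\gamma)\,dh .$$ For a Schwartz–Bruhat function $\Phi$ on $V_{\mathbb A}$ (locally constant with compact support) and $s\in\mathbb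 C$ put $$Z(\Phi,s)=\int_{H_{\mathbb A}/H_k}|\chi(h)|_{\mathbb A}^{s}\sum_{x\in V_k''}\Phi(h\cdot x)\,dh .$$ Then the integrand is well defined on $H_{\mathbb A}/H_k$: for every $h\in H_{\mathbb A}$ the sum converges absolutely, and both $|\chi(h)|_{\mathbb A}^{s}\sum_{x\in V_k''}\Phi(h\cdot x)$ and $|\chi(h)|_{\mathbb A}^{\operatorname{Re}s}\sum_{x\in V_k''}|\Phi(h\cdot x)|$ are invariant under $h\mapsto h\gamma$, $\gamma\in H_k$. The integral $Z(\Phi,s)$ converges absolutely and locally uniformly for $\operatorname{Re}(s)>3$: the function $|\chi(h)|_{\mathbb A}^{\operatorname{Re}s}\sum_{x\in V_k''}|\Phi(h\cdot x)|$ has finite integral over $H_{\mathbb A}/H_k$ for every such $s$, and for every compact set $C$ of such $s$ and every $\varepsilon>0$ there is a compact set $E\subset H_{\mathbb A}/H_k$ such that its integral over the complement of $E$ is less than $\varepsilon$ for all $s\in C$. In particular, $Z(\Phi,s)$ is a holomorphic function of $s$ in the region $\operatorname{Re}(s)>3$. -/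

import Mathlib

open scoped RestrictedProduct WithZero Matrix NNReal ENNReal Polynomial
open MeasureTheory

namespace BinaryQuadraticZeta

noncomputable section

section Places

variable (k : Type*) [Field k]

/-- The places of `k`, each represented by its normalized (i.e. surjective) discrete valuation
`k → ℤᵐ⁰`, `v x = exp (-ord_v x)`. All places of a function field over a finite field are
discrete and trivial on constants. -/
@[ext]
structure Place where
  /-- the normalized valuation -/
  val : Valuation k ℤᵐ⁰
  surj : Function.Surjective val

variable {k}

/-- The completion `k_v`. -/
abbrev Place.Kv (v : Place k) : Type _ := v.val.Completion

/-- The ring of integers `𝒪_v` of `k_v`. -/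
abbrev Place.Ov (v : Place k) : ValuationSubring v.Kv := Valued.v.valuationSubring

/-- `q_v`, the cardinality of the residue field of `𝒪_v`. -/
def Place.q (v : Place k) : ℕ := Nat.card (IsLocalRing.ResidueField v.Ov)

open Classical in
/-- The normalized absolute value on `k_v`: `|x|_v = q_v ^ (-ord_v x)` for `x ≠ 0`. -/
def Place.abs (v : Place k) (x : v.Kv) : ℝ :=
  if x = 0 then 0 else (v.q : ℝ) ^ WithZero.log (Valued.v x : ℤᵐ⁰)

/-- The embedding of `k` in `k_v`. -/
def Place.emb (v : Place k) : k →+* v.Kv :=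
  UniformSpace.Completion.coeRingHom.comp (WithVal.equiv v.val).symm.toRingHom

theorem Place.valued_emb (v : Place k) (x : k) : (Valued.v (v.emb x) : ℤᵐ⁰) = v.1 x :=
  Valued.valuedCompletion_apply _

variable (k) in
/-- The adele ring of `k` with the restricted product topology. -/
abbrev Adele : Type _ := Πʳ v : Place k, [v.Kv, v.Ov]

instance : Fact (∀ v : Place k, IsOpen (v.Ov : Set v.Kv)) :=
  ⟨fun _ ↦ Valued.isOpen_valuationSubring _⟩

/-- The idele norm `|a|_𝔸 = ∏_v |a_v|_v`. -/
def ideleNorm (a : (Adele k)ˣ) : ℝ := ∏ᶠ v : Place k, v.abs ((a : Adele k) v)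

end Places

section Diagonal

variable {Fq k : Type*} [Field Fq] [Field k]

theorem Place.ext_of_lt_one_iff {v w : Place k} (h : ∀ x, v.val x < 1 ↔ w.val x < 1) : v = w := by
  have h1 : ∀ x, v.val x = 1 ↔ w.val x = 1 :=
    fun x ↦ (Valuation.isEquiv_iff_val_eq_one.1 (Valuation.isEquiv_iff_val_lt_one.2 (h _)))
  obtain ⟨p, hp⟩ := v.surj (WithZero.exp (-1))
  obtain ⟨r, hr⟩ := w.surj (WithZero.exp (-1))
  have key : ∀ x : k, x ≠ 0 → w.val x = w.val p ^ (-WithZero.log (v.val x)) := by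
    intro x hx
    have hvx : v.val x ≠ 0 := by simpa using hx
    have hp0 : w.val p ≠ 0 := by
      rintro h0
      have : p = 0 := by simpa using h0
      exact WithZero.exp_ne_zero (by rw [← hp, this, map_zero])
    have h2 : v.val (x * p ^ (WithZero.log (v.val x))) = 1 := by
      rw [map_mul, map_zpow₀, hp, ← WithZero.exp_zsmul]
      conv_lhs => rw [← WithZero.exp_log hvx]
      rw [WithZero.log_exp, ← WithZero.exp_add]; simp
    have h3 := (h1 _).1 h2
    rw [map_mul, map_zpow₀] at h3
    rw [zpow_neg]
    exact eq_inv_of_mul_eq_one_left h3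
  have hr0 : r ≠ 0 := by rintro rfl; exact WithZero.exp_ne_zero (by rw [← hr, map_zero])
  have hp0 : p ≠ 0 := by rintro rfl; exact WithZero.exp_ne_zero (by rw [← hp, map_zero])
  have hwp : w.val p ≠ 0 := by simpa using hp0
  have e1 := key r hr0
  have hlt : w.val p < 1 := (h p).1 (by rw [hp, ← WithZero.exp_zero, WithZero.exp_lt_exp]; norm_num)
  have hp1 : w.val p = WithZero.exp (-1) := by
    rw [hr, ← WithZero.exp_log hwp, ← WithZero.exp_zsmul, WithZero.exp_inj] at e1
    have : WithZero.log (w.val p) < 0 := by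
      rw [← WithZero.exp_log hwp, ← WithZero.exp_zero, WithZero.exp_lt_exp] at hlt
      exact hlt
    have hd : WithZero.log (w.val p) ∣ 1 := ⟨WithZero.log (v.val r), by simp at e1; linarith⟩
    rw [← WithZero.exp_log hwp, WithZero.exp_inj]
    rcases Int.isUnit_iff.1 (isUnit_of_dvd_one hd) with h | h <;> omega
  apply Place.ext
  ext x
  by_cases hx : x = 0
  · simp [hx]
  · have hvx : v.val x ≠ 0 := by simpa using hx
    rw [key x hx, hp1, ← WithZero.exp_zsmul]
    conv_lhs => rw [← WithZero.exp_log hvx]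
    simp

/-- The real absolute value `2 ^ (-ord_v x)` attached to a place (auxiliary normalization). -/
def Place.absTwo (v : Place k) : AbsoluteValue k ℝ where
  toFun x := (WithZeroMulInt.toNNReal (e := 2) (by norm_num) (v.val x) : ℝ)
  map_mul' x y := by simp
  nonneg' x := NNReal.coe_nonneg _
  eq_zero' x := by simp
  add_le' x y := by
    have hm := (WithZeroMulInt.toNNReal_strictMono (e := 2) (by norm_num)).monotone
    have h := hm (v.val.map_add x y)
    rw [hm.map_max] at h
    rw [← NNReal.coe_add, NNReal.coe_le_coe]
    exact h.trans (max_le (le_add_of_nonneg_right (zero_le)) (le_add_of_nonneg_left (zero_le)))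

theorem Place.absTwo_lt_one (v : Place k) (x : k) : v.absTwo x < 1 ↔ v.val x < 1 := by
  have := WithZeroMulInt.toNNReal_lt_one_iff (e := 2) (m := v.val x) (by norm_num)
  rw [← this, ← NNReal.coe_lt_coe]; rfl

theorem Place.one_lt_absTwo (v : Place k) (x : k) : 1 < v.absTwo x ↔ 1 < v.val x := by
  have := (WithZeroMulInt.toNNReal_strictMono (e := 2) (by norm_num)).lt_iff_lt
    (a := 1) (b := v.val x)
  rw [← this, map_one, ← NNReal.coe_lt_coe]; rfl

variable (Fq) in
/-- An element of a function field has finitely many poles. -/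
theorem Place.finite_poles [Finite Fq] [Algebra (RatFunc Fq) k] [FunctionField Fq k] (x : k) :
    {v : Place k | 1 < v.val x}.Finite := by
  classical
  let : Algebra Fq k := ((algebraMap (RatFunc Fq) k).comp (algebraMap Fq (RatFunc Fq))).toAlgebra
  have : IsScalarTower Fq (RatFunc Fq) k := IsScalarTower.of_algebraMap_eq' rfl
  by_cases hx : IsAlgebraic Fq x
  · convert Set.finite_empty
    ext v
    simp only [Set.mem_ofPred_eq, Set.mem_empty_iff_false, iff_false, not_lt]
    let : Algebra Fq v.val.integer :=
      ((algebraMap Fq k).codRestrict v.val.integer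
        (fun a ↦ FiniteField.valuation_algebraMap_le_one v.val a)).toAlgebra
    have : IsScalarTower Fq v.val.integer k := IsScalarTower.of_algebraMap_eq' rfl
    exact (Valuation.integer.integers v.val).mem_of_integral (hx.isIntegral.tower_top)
  · have hfd := FunctionField.finiteDimensional_of_adjoin_transcendental (F := Fq) (K := k) hx
    by_contra hinf
    have hinf : {v : Place k | 1 < v.val x}.Infinite := hinf
    obtain ⟨t, hts, htc⟩ := hinf.exists_subset_card_eq
      (Module.finrank (IntermediateField.adjoin Fq {x}) k + 1)
    have hpi := AbsoluteValue.exists_one_lt_lt_one_pi_of_not_isEquiv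
      (v := fun v : t ↦ v.1.absTwo)
      (fun v ↦ ⟨x, by rintro rfl; simpa using hts v.2, ((v.1.one_lt_absTwo x).2 (hts v.2)).ne'⟩)
      (fun v w hvw h ↦ hvw (Subtype.ext (Place.ext_of_lt_one_iff fun y ↦ by
        have := AbsoluteValue.isEquiv_iff_lt_one_iff.1 h y
        rwa [Place.absTwo_lt_one, Place.absTwo_lt_one] at this)))
    simp only [Place.one_lt_absTwo, Place.absTwo_lt_one] at hpi
    choose z hz1 hz2 using hpi
    -- `e i` is a unit at the place `i` and vanishes at the others
    let e : t → k := fun i ↦ z i / (1 + z i)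
    have he1 : ∀ i : t, i.1.val (e i) = 1 := by
      intro i
      have h0 : i.1.val (1 + z i) = i.1.val (z i) :=
        Valuation.map_add_eq_of_lt_right _ (by rw [map_one]; exact hz1 i)
      have : i.1.val (z i) ≠ 0 := (zero_lt_one.trans (hz1 i)).ne'
      simp [e, h0, this]
    have he2 : ∀ i j : t, j ≠ i → j.1.val (e i) < 1 := by
      intro i j hij
      have h0 : j.1.val (1 + z i) = 1 := by
        rw [Valuation.map_add_eq_of_lt_left _ (by rw [map_one]; exact hz2 i j hij), map_one]
      simpa [e, h0] using hz2 i j hij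
    have hcomp : ∀ (i j : t) (f : IntermediateField.adjoin Fq {x}),
        i.1.val (f : k) ≤ 1 → j.1.val (f : k) ≤ 1 := by
      intro i j f hf
      let φ := RatFunc.algEquivOfTranscendental x hx
      let ψ : RatFunc Fq →+* k := (algebraMap (IntermediateField.adjoin Fq {x}) k).comp
        (φ : RatFunc Fq →+* IntermediateField.adjoin Fq {x})
      have hψX : ψ RatFunc.X = x := RatFunc.algEquivOfTranscendental_X x hx
      have hq : ∀ i : t, (i.1.val.comap ψ).IsEquiv (RatFunc.inftyValuation Fq) := fun i ↦
        RatFunc.valuation_isEquiv_inftyValuation_of_one_lt_valuation_X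
          (by rw [Valuation.comap_apply, hψX]; exact hts i.2)
      have hij := (hq i).trans (hq j).symm
      have := (Valuation.isEquiv_iff_val_le_one.1 hij (x := φ.symm f))
      have hf' : ψ (φ.symm f) = (f : k) := by
        change ((φ (φ.symm f) : IntermediateField.adjoin Fq {x}) : k) = f
        rw [AlgEquiv.apply_symm_apply]
      rw [Valuation.comap_apply, Valuation.comap_apply, hf'] at this
      exact this.1 hf
    have hli : LinearIndependent (IntermediateField.adjoin Fq {x}) e := by
      rw [Fintype.linearIndependent_iff]
      intro g hg i
      by_contra hgi
      obtain ⟨m, -, hm⟩ := Finset.exists_max_image Finset.univ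
        (fun j ↦ i.1.val (g j : k)) ⟨i, Finset.mem_univ i⟩
      have hgm : (g m : k) ≠ 0 := by
        intro h0
        have := hm i (Finset.mem_univ i)
        rw [h0, map_zero, nonpos_iff_eq_zero, map_eq_zero] at this
        exact hgi (Subtype.ext this)
      have hle : ∀ j, m.1.val (g j : k) ≤ m.1.val (g m : k) := by
        intro j
        have hpos : ∀ l : t, 0 < l.1.val (g m : k) := fun l ↦ by
          rw [zero_lt_iff]; simpa using hgm
        have := hcomp i m (g j / g m) (by
          push_cast
          rw [map_div₀]
          exact (div_le_one₀ (hpos i)).2 (hm j (Finset.mem_univ j)))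
        push_cast at this
        rw [map_div₀] at this
        exact (div_le_one₀ (hpos m)).1 this
      have hgm' : m.1.val (g m : k) ≠ 0 := by simpa using hgm
      have hlt : m.1.val (∑ j ∈ Finset.univ.erase m, (g j • e j)) < m.1.val (g m : k) := by
        refine Valuation.map_sum_lt _ hgm' fun j hj ↦ ?_
        rw [Algebra.smul_def, map_mul]
        calc _ ≤ m.1.val (g m : k) * m.1.val (e j) := by gcongr; exact hle j
          _ < m.1.val (g m : k) * 1 :=
            mul_lt_mul_of_pos_left (he2 j m (Finset.ne_of_mem_erase hj).symm)
              (zero_lt_iff.2 hgm')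
          _ = _ := mul_one _
      rw [← Finset.add_sum_erase _ _ (Finset.mem_univ m)] at hg
      have h1 := eq_neg_of_add_eq_zero_right hg
      rw [h1, Valuation.map_neg, Algebra.smul_def, map_mul, he1, mul_one] at hlt
      exact lt_irrefl _ hlt
    have := hli.fintype_card_le_finrank
    rw [Fintype.card_coe, htc] at this
    omega

variable (Fq k) in
/-- The diagonal embedding of the function field `k` in its adele ring. -/
def diag [Finite Fq] [Algebra (RatFunc Fq) k] [FunctionField Fq k] : k →+* Adele k where
  toFun x := ⟨fun v ↦ v.emb x, by
    refine (Place.finite_poles Fq x).subset fun v hv ↦ ?_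
    rw [Set.mem_ofPred_eq, ← Place.valued_emb]
    exact not_le.1 hv⟩
  map_one' := Subtype.ext <| funext fun v ↦ map_one v.emb
  map_mul' x y := Subtype.ext <| funext fun v ↦ map_mul v.emb x y
  map_zero' := Subtype.ext <| funext fun v ↦ map_zero v.emb
  map_add' x y := Subtype.ext <| funext fun v ↦ map_add v.emb x y

end Diagonal

section Group

variable (R : Type*) [CommRing R]

/-- The `R`-points of `G = GL(1) × GL(2)`. -/
abbrev G : Type _ := Rˣ × GL (Fin 2) R

variable {R}

/-- The binary quadratic form `F_x(z₁, z₂) = x₀ z₁² + x₁ z₁ z₂ + x₂ z₂²`. -/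
def form (x : Fin 3 → R) (z₁ z₂ : R) : R := x 0 * z₁ ^ 2 + x 1 * z₁ * z₂ + x 2 * z₂ ^ 2

/-- The matrix of `x ↦ g · x` for `g = (t, (a b; c d))`, where
`F_{g·x}(z₁, z₂) = t F_x(a z₁ + c z₂, b z₁ + d z₂)`. -/
def rhoMatrix (g : G R) : Matrix (Fin 3) (Fin 3) R :=
  let t : R := g.1
  let a := g.2.1 0 0
  let b := g.2.1 0 1
  let c := g.2.1 1 0
  let d := g.2.1 1 1
  t • !![a ^ 2, a * b, b ^ 2;
         2 * a * c, a * d + b * c, 2 * b * d;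
         c ^ 2, c * d, d ^ 2]

theorem form_rhoMatrix (g : G R) (x : Fin 3 → R) (z₁ z₂ : R) :
    form (rhoMatrix g *ᵥ x) z₁ z₂ =
      g.1 * form x (g.2.1 0 0 * z₁ + g.2.1 1 0 * z₂) (g.2.1 0 1 * z₁ + g.2.1 1 1 * z₂) := by
  simp [form, rhoMatrix, Matrix.mulVec, dotProduct, Fin.sum_univ_three]
  ring

variable (R) in
/-- The representation `ϱ : G → GL(V)` on `R`-points, `V` being three-dimensional affine space. -/
def rho : G R →* GL (Fin 3) R :=
  MonoidHom.toHomUnits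
    { toFun := rhoMatrix
      map_one' := by
        ext i j
        fin_cases i <;> fin_cases j <;> simp [rhoMatrix]
      map_mul' := by
        intro g h
        ext i j
        fin_cases i <;> fin_cases j <;>
          simp [rhoMatrix, Matrix.mul_apply, Fin.sum_univ_three, Fin.sum_univ_two] <;> ring }

variable (R) in
/-- The `R`-points of `H = Im ϱ ≅ G / T_ϱ`, as a subgroup of `GL(V)`. As `T_ϱ ≅ GL(1)`, by
Hilbert 90 they are the image of the `R`-points of `G` when `R` is a field or an adele ring. -/
abbrev H : Subgroup (GL (Fin 3) R) := (rho R).range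

variable (R) in
/-- The character `χ(t, g) = t det g` of `G`. -/
def chiG : G R →* Rˣ :=
  (MonoidHom.fst _ _) * (Matrix.GeneralLinearGroup.det.comp (MonoidHom.snd _ _))

theorem chiG_eq_one_of_rho_eq_one (g : G R) (hg : rho R g = 1) : chiG R g = 1 := by
  have h : rhoMatrix g = 1 := congrArg Units.val hg
  have h00 := congrFun (congrFun h 0) 0
  have h11 := congrFun (congrFun h 1) 1
  have h10 := congrFun (congrFun h 1) 0
  simp [rhoMatrix] at h00 h11 h10
  apply Units.ext
  simp [chiG, Matrix.det_fin_two]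
  linear_combination h11 + 2 * (g.1 : R) * g.2.1 0 1 * g.2.1 1 0 * h00 -
    (g.1 : R) ^ 2 * g.2.1 0 0 * g.2.1 0 1 * h10

variable (R) in
/-- The character `χ` of `H` induced by that of `G`. -/
def chi : H R →* Rˣ :=
  (QuotientGroup.lift (rho R).ker (chiG R) fun g hg ↦ chiG_eq_one_of_rho_eq_one g hg).comp
    (QuotientGroup.quotientKerEquivRange (rho R)).symm.toMonoidHom

theorem chi_rho (g : G R) : chi R ⟨rho R g, g, rfl⟩ = chiG R g := by
  have : (QuotientGroup.quotientKerEquivRange (rho R)).symm ⟨rho R g, g, rfl⟩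
      = QuotientGroup.mk g := by
    rw [MulEquiv.symm_apply_eq]; rfl
  change QuotientGroup.lift _ (chiG R) (fun g hg ↦ chiG_eq_one_of_rho_eq_one g hg)
    ((QuotientGroup.quotientKerEquivRange (rho R)).symm _) = _
  exact congrArg _ this

/-- The discriminant `P(x) = x₁² - 4 x₀ x₂` of `F_x`. -/
def disc (x : Fin 3 → R) : R := x 1 ^ 2 - 4 * x 0 * x 2

end Group

section QuotientMeasure

variable {𝒢 : Type*} [Group 𝒢] [MeasurableSpace 𝒢]

/-- `ν` is the measure on `𝒢 ⧸ Γ` determined by the measure `μ` on `𝒢` through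
`∫_𝒢 f(g) dg = ∫_{𝒢/Γ} ∑_{γ ∈ Γ} f(gγ) dg`. The inner sum depends only on the coset of `g`, so it is
evaluated at a representative. -/
def IsQuotientMeasure (Γ : Subgroup 𝒢) (μ : Measure 𝒢) (ν : Measure (𝒢 ⧸ Γ)) : Prop :=
  ∀ f : 𝒢 → ℝ≥0∞, Measurable f →
    ∫⁻ g, f g ∂μ = ∫⁻ x : 𝒢 ⧸ Γ, ∑' γ : Γ, f (x.out * γ) ∂ν

end QuotientMeasure

section Zeta

variable (k : Type*) [Field k]

/-- `V_k''`: the nonsingular forms over `k` whose splitting field has degree two over `k`. The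
splitting field of the binary form `F_x` is that of the polynomial `F_x(X, 1)`. -/
def Vpp : Set (Fin 3 → k) :=
  {x | disc x ≠ 0 ∧ Module.finrank k (Polynomial.SplittingField
    (Polynomial.C (x 0) * Polynomial.X ^ 2 + Polynomial.C (x 1) * Polynomial.X +
      Polynomial.C (x 2))) = 2}

/-- The adelic group `H_𝔸`, with the topology induced by `GL(V)_𝔸`. -/
abbrev HA : Type _ := H (Adele k)

instance : MeasurableSpace (HA k) := borel _

instance : BorelSpace (HA k) := ⟨rfl⟩

variable {k}

/-- Schwartz-Bruhat functions on `V_𝔸`: locally constant with compact support (there are no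
archimedean places). -/
def IsSchwartzBruhat (Φ : (Fin 3 → Adele k) → ℂ) : Prop :=
  IsLocallyConstant Φ ∧ HasCompactSupport Φ

variable (Fq : Type*) [Field Fq] [Finite Fq] [Algebra (RatFunc Fq) k] [FunctionField Fq k]

variable (k) in
/-- The group `H_k`, embedded diagonally in `H_𝔸`. -/
def Hk : Subgroup (HA k) :=
  ((H k).map (Matrix.GeneralLinearGroup.map (diag Fq k))).subgroupOf (H (Adele k))

/-- `h · x ∈ V_𝔸` for `h ∈ H_𝔸` and `x ∈ V_k`. -/
def act (h : HA k) (x : Fin 3 → k) : Fin 3 → Adele k :=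
  (h : GL (Fin 3) (Adele k)).1 *ᵥ fun i ↦ diag Fq k (x i)

/-- `|χ(h)|_𝔸 ^ s ∑_{x ∈ V_k''} Φ(h · x)`. -/
def zetaIntegrand (Φ : (Fin 3 → Adele k) → ℂ) (s : ℂ) (h : HA k) : ℂ :=
  (ideleNorm (chi (Adele k) h) : ℂ) ^ s * ∑' x : Vpp k, Φ (act Fq h x)

/-- `| |χ(h)|_𝔸 ^ s | ∑_{x ∈ V_k''} |Φ(h · x)|`, as an extended nonnegative real. -/
def absZetaIntegrand (Φ : (Fin 3 → Adele k) → ℂ) (s : ℂ) (h : HA k) : ℝ≥0∞ :=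
  ‖(ideleNorm (chi (Adele k) h) : ℂ) ^ s‖ₑ * ∑' x : Vpp k, ‖Φ (act Fq h x)‖ₑ

/-- The global zeta function `Z(Φ, s)`, an integral over `H_𝔸 / H_k`. The integrand is invariant
under right translation by `H_k`, so it is evaluated at a representative of each coset. -/
def globalZeta (ν : Measure (HA k ⧸ Hk k Fq)) (Φ : (Fin 3 → Adele k) → ℂ) (s : ℂ) : ℂ :=
  ∫ y : HA k ⧸ Hk k Fq, zetaIntegrand Fq Φ s y.out ∂ν

end Zeta

end

end BinaryQuadraticZeta

open BinaryQuadraticZeta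

namespace BinaryQuadraticZeta

noncomputable section

/-! ### Approximation of local elements by elements of `k` -/

section LocalFields

variable {k : Type*} [Field k]

/-! Let K = H_𝔸 ∩ GL(3, 𝒪), a compact open subgroup, and Γ = H_k. The integral is bounded by a
series over the double cosets K \ H_𝔸 / Γ, and everything rests on good representatives for them.

Reduction theory for GL(2) (`exists_reduction`) makes each h equivalent to a lower triangular
`siegelElement l a c` with |a| ≥ c₀. Since the idele classes modulo units and powers of a fixed
idele ϖ with |ϖ| < 1 are finite in number, and 𝔸 / (k + a𝒪) has bounded order when |a| ≥ c₀, it is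
enough to let l and a run through powers of ϖ times a finite set and c through boundedly many values
(`exists_double_coset_representatives`). On such a double coset |χ| is constant, equal to |l|.

The function Φ is bounded and supported in a lattice (d𝒪)³, which K preserves, so the inner sum is
bounded by a number of lattice points. In characteristic not 2, V_k'' consists of the forms with
nonsquare discriminant; hence x₀ ≠ 0. The element multiplies x₀ by la, so by the product formula
there are no points unless |la| ≤ |d|. If there are some, counting one coordinate after the other
gives a bound of order |la|⁻¹ · |l|⁻¹ · |la⁻¹|⁻¹ = |l|⁻³ (`exists_ncard_latticePoints_le`). The
lower bound for |a| is what keeps the last two factors from being dominated by the point 0.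

The image of K h in H_𝔸 / Γ has measure at most μ(K), because the modular character is trivial on
the representatives (`modularCharacter_siegelElement`, `measure_cosetImage_le`). With σ = Re s the
integral is therefore dominated by the sum of |l|^(σ - 3) over c₀ ≤ |a|, |l||a| ≤ D, which converges
for σ > 3 (`summable_double_coset_weights`). Finite unions of images of K h are compact, so tails of
the series control tails of the integral (`lintegral_compl_le`). Uniformity in s comes from x^σ ≤
x^α + x^β for α ≤ σ ≤ β, and holomorphy from differentiation under the integral sign.

The arithmetic of k is built up from its places. Partial fractions over Fq(X) give 𝔸 = k + b𝒪 for
some idele b; the pigeonhole principle turns this into Riemann's inequality; and the product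
formula, the finiteness of classes and the reduction theory follow from the latter by comparing
norms. -/

theorem Place.valued_surjective (v : Place k) (n : ℤ) :
    ∃ r : k, r ≠ 0 ∧ (Valued.v (v.emb r) : ℤᵐ⁰) = WithZero.exp n := by
  obtain ⟨r, hr⟩ := v.surj (WithZero.exp n)
  refine ⟨r, ?_, by rw [Place.valued_emb, hr]⟩
  rintro rfl
  exact WithZero.exp_ne_zero (by rw [← hr, map_zero])

theorem Place.isOpen_closedBall (v : Place k) (a : v.Kv) (n : ℤ) :
    IsOpen {y : v.Kv | Valued.v (a - y) ≤ WithZero.exp n} := by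
  obtain ⟨r, hr0, hr⟩ := v.valued_surjective n
  have hc : Continuous fun y : v.Kv ↦ (a - y) / v.emb r := by fun_prop
  convert (Valued.isOpen_valuationSubring v.Kv).preimage hc using 1
  ext y
  simp only [Set.mem_ofPred_eq, Set.mem_preimage, SetLike.mem_coe, Valuation.mem_valuationSubring_iff,
    map_div₀, hr]
  rw [div_le_one₀ WithZero.exp_pos]

theorem Place.exists_sub_emb_le (v : Place k) (a : v.Kv) (n : ℤ) :
    ∃ r : k, Valued.v (a - v.emb r) ≤ WithZero.exp n := by
  obtain ⟨x, hx⟩ := UniformSpace.Completion.denseRange_coe.exists_mem_open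
    (v.isOpen_closedBall a n) ⟨a, by simp⟩
  exact ⟨WithVal.equiv v.val x, hx⟩

/-- Simultaneous approximation of finitely many local elements by an element of `k`. -/
theorem exists_forall_sub_emb_le_one {T : Set (Place k)} (hT : T.Finite) (a : ∀ v : Place k, v.Kv) :
    ∃ r : k, ∀ v ∈ T, Valued.v (a v - v.emb r) ≤ (1 : ℤᵐ⁰) := by
  have := hT.to_subtype
  choose z hz using fun v : Place k ↦ v.exists_sub_emb_le (a v) 0
  have hd := AbsoluteValue.denseRange_algebraMap_pi (v := fun v : T ↦ v.1.absTwo)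
    (fun v ↦ by
      obtain ⟨r, hr0, hr⟩ := v.1.valued_surjective 1
      refine ⟨r, hr0, ne_of_gt ?_⟩
      rw [Place.one_lt_absTwo, ← Place.valued_emb, hr, ← WithZero.exp_zero, WithZero.exp_lt_exp]
      norm_num)
    (fun v w hvw h ↦ hvw (Subtype.ext (Place.ext_of_lt_one_iff fun y ↦ by
        have := AbsoluteValue.isEquiv_iff_lt_one_iff.1 h y
        rwa [Place.absTwo_lt_one, Place.absTwo_lt_one] at this)))
  have := Fintype.ofFinite T
  obtain ⟨r, hr⟩ := Metric.denseRange_iff.1 hd (fun v ↦ WithAbs.toAbs _ (z v.1)) 1 one_pos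
  refine ⟨r, fun v hv ↦ ?_⟩
  have h1 := (dist_pi_lt_iff one_pos).1 hr ⟨v, hv⟩
  rw [dist_eq_norm] at h1
  have h2 : v.absTwo (z v - r) < 1 := h1
  rw [Place.absTwo_lt_one] at h2
  have h3 : a v - v.emb r = (a v - v.emb (z v)) + v.emb (z v - r) := by rw [map_sub]; ring
  rw [h3]
  refine (Valuation.map_add _ _ _).trans (max_le (hz v) ?_)
  rw [Place.valued_emb]; exact h2.le

end LocalFields

/-! ### Polynomials and rational functions at a place -/

section Polynomials

variable {Fq k : Type*} [Field Fq] [Finite Fq] [Field k]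

theorem Place.val_finite (v : Place k) (f : Fq →+* k) {c : Fq} (hc : c ≠ 0) : v.val (f c) = 1 := by
  let : Algebra Fq k := f.toAlgebra
  exact FiniteField.valuation_algebraMap_eq_one v.val c hc

theorem Place.val_finite_le (v : Place k) (f : Fq →+* k) (c : Fq) : v.val (f c) ≤ 1 := by
  let : Algebra Fq k := f.toAlgebra
  exact FiniteField.valuation_algebraMap_le_one v.val c

theorem Place.val_polynomial_le (v : Place k) (f : Fq[X] →+* k) (hX : v.val (f Polynomial.X) ≤ 1)
    (P : Fq[X]) : v.val (f P) ≤ 1 := by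
  induction P using Polynomial.induction_on' with
  | add p q hp hq => rw [map_add]; exact (v.val.map_add _ _).trans (max_le hp hq)
  | monomial n c =>
    rw [← Polynomial.C_mul_X_pow_eq_monomial, map_mul, map_mul, map_pow, map_pow]
    exact mul_le_one' (v.val_finite_le (f.comp Polynomial.C) c) (pow_le_one' hX n)

theorem Place.val_polynomial_sub_lt (v : Place k) (f : Fq[X] →+* k)
    (hX : v.val (f Polynomial.X) < 1) (P : Fq[X]) :
    v.val (f P - f (Polynomial.C (P.coeff 0))) < 1 := by
  have h : P - Polynomial.C (P.coeff 0) = Polynomial.X * P.divX :=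
    sub_eq_of_eq_add (Polynomial.X_mul_divX_add P).symm
  rw [← map_sub, h, map_mul, map_mul]
  exact mul_lt_one_of_lt_of_le hX (v.val_polynomial_le f hX.le _)

/-- The residue field of `Fq(X)` at a place dividing `X` is `Fq`. -/
theorem Place.exists_val_sub_constant_lt (v : Place k) (ψ : RatFunc Fq →+* k)
    (hX : v.val (ψ RatFunc.X) < 1) (f : RatFunc Fq) (hf : v.val (ψ f) ≤ 1) :
    ∃ c : Fq, v.val (ψ f - ψ (RatFunc.C c)) < 1 := by
  let φ : Fq[X] →+* k := ψ.comp (algebraMap Fq[X] (RatFunc Fq))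
  have hφX : v.val (φ Polynomial.X) < 1 := by simpa [φ] using hX
  have hC : ∀ c : Fq, φ (Polynomial.C c) = ψ (RatFunc.C c) := fun c ↦ by
    simp [φ, RatFunc.algebraMap_C]
  have hfe : ψ f = φ f.num / φ f.denom := by
    conv_lhs => rw [← RatFunc.num_div_denom f]
    rw [map_div₀]; rfl
  have hd0 : φ f.denom ≠ 0 := by
    simpa [φ] using f.denom_ne_zero
  -- A polynomial with nonzero constant term is congruent at `v` to a nonzero constant, hence a
  -- unit.
  have key : ∀ P : Fq[X], P.coeff 0 ≠ 0 → v.val (φ P) = 1 := by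
    intro P hP
    have h1 := v.val_polynomial_sub_lt φ hφX P
    have h2 := v.val_finite (φ.comp Polynomial.C) hP
    have h3 : φ P = φ (Polynomial.C (P.coeff 0)) + (φ P - φ (Polynomial.C (P.coeff 0))) := by ring
    rw [h3, Valuation.map_add_eq_of_lt_left _ (by rw [show v.val (φ _) = 1 from h2]; exact h1)]
    exact h2
  -- In lowest terms, a denominator vanishing at 0 leaves a numerator which does not, and `f` would
  -- have a pole at `v`.
  have hQ : f.denom.coeff 0 ≠ 0 := by
    intro h0
    have hP : f.num.coeff 0 ≠ 0 := by
      intro h1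
      have := (RatFunc.isCoprime_num_denom f).isUnit_of_dvd' (Polynomial.X_dvd_iff.2 h1)
        (Polynomial.X_dvd_iff.2 h0)
      exact Polynomial.not_isUnit_X this
    have h2 : v.val (φ f.denom) < 1 := by
      have := v.val_polynomial_sub_lt φ hφX f.denom
      simpa [h0] using this
    rw [hfe, map_div₀, key _ hP] at hf
    have h3 : (0 : ℤᵐ⁰) < v.val (φ f.denom) := by rw [zero_lt_iff]; simpa using hd0
    rw [div_le_one₀ h3] at hf
    exact absurd h2 (not_lt.2 hf)
  refine ⟨f.num.coeff 0 / f.denom.coeff 0, ?_⟩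
  have hcQ : φ (Polynomial.C (f.denom.coeff 0)) ≠ 0 := by
    intro h
    have := v.val_finite (φ.comp Polynomial.C) hQ
    rw [RingHom.comp_apply, h, map_zero] at this
    exact zero_ne_one this
  rw [map_div₀ RatFunc.C, map_div₀, ← hC, ← hC, hfe, div_sub_div _ _ hd0 hcQ, map_div₀, map_mul,
    key _ hQ, show v.val (φ (Polynomial.C (f.denom.coeff 0))) = 1 from
      v.val_finite (φ.comp Polynomial.C) hQ, one_mul, div_one, ← map_mul, ← map_mul, ← map_sub]
  have := v.val_polynomial_sub_lt φ hφX (f.num * Polynomial.C (f.denom.coeff 0) -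
    f.denom * Polynomial.C (f.num.coeff 0))
  have h0 : (f.num * Polynomial.C (f.denom.coeff 0) -
    f.denom * Polynomial.C (f.num.coeff 0)).coeff 0 = 0 := by
    simp; ring
  rwa [h0, map_zero, map_zero, sub_zero] at this

end Polynomials

/-! ### Finiteness of residue fields and of the set of places of bounded norm -/

section FunctionFields

variable {Fq k : Type*} [Field Fq] [Finite Fq] [Field k]

/-- The valuation ring of `v` contains every finite subfield and is integrally closed. -/
theorem Place.val_le_one_of_isIntegral (v : Place k) (f : Fq →+* k) {x : k}
    (hx : f.IsIntegralElem x) : v.val x ≤ 1 := by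
  let : Algebra Fq k := f.toAlgebra
  let : Algebra Fq v.val.integer :=
    ((algebraMap Fq k).codRestrict v.val.integer
      (fun a ↦ FiniteField.valuation_algebraMap_le_one v.val a)).toAlgebra
  have : IsScalarTower Fq v.val.integer k := IsScalarTower.of_algebraMap_eq' rfl
  have hx : IsIntegral Fq x := hx
  exact (Valuation.integer.integers v.val).mem_of_integral hx.tower_top

theorem Place.val_eq_one_of_isIntegral (v : Place k) (f : Fq →+* k) {x : k} (h0 : x ≠ 0)
    (hx : f.IsIntegralElem x) : v.val x = 1 := by
  refine le_antisymm (v.val_le_one_of_isIntegral f hx) ?_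
  let : Algebra Fq k := f.toAlgebra
  have hx' : f.IsIntegralElem x⁻¹ := by
    have hx : IsAlgebraic Fq x := IsIntegral.isAlgebraic hx
    exact hx.inv.isIntegral
  have h := v.val_le_one_of_isIntegral f hx'
  rw [map_inv₀] at h
  exact (inv_le_one₀ (by rw [zero_lt_iff]; simpa using h0)).1 h

/-- A function field is a finite extension of the subfield generated by any element that is a
non-unit at some place. -/
theorem Place.exists_finite_ratFunc [Algebra (RatFunc Fq) k] [FunctionField Fq k] (v : Place k)
    {x : k} (hx0 : x ≠ 0) (hx : v.val x < 1) :
    ∃ ψ : RatFunc Fq →+* k, ψ RatFunc.X = x ∧ ψ.Finite := by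
  let : Algebra Fq k := ((algebraMap (RatFunc Fq) k).comp (algebraMap Fq (RatFunc Fq))).toAlgebra
  have : IsScalarTower Fq (RatFunc Fq) k := IsScalarTower.of_algebraMap_eq' rfl
  have ht : Transcendental Fq x := fun h ↦
    hx.ne (v.val_eq_one_of_isIntegral (algebraMap Fq k) hx0 h.isIntegral)
  have hfd := FunctionField.finiteDimensional_of_adjoin_transcendental (F := Fq) (K := k) ht
  let φ := RatFunc.algEquivOfTranscendental x ht
  refine ⟨(algebraMap (IntermediateField.adjoin Fq {x}) k).comp
    (φ : RatFunc Fq →+* IntermediateField.adjoin Fq {x}),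
    RatFunc.algEquivOfTranscendental_X x ht, RingHom.Finite.comp ?_ ?_⟩
  · rw [RingHom.finite_algebraMap]; exact hfd
  · exact RingHom.Finite.of_surjective _ φ.surjective

theorem Place.isUnit_iff (v : Place k) (a : v.Ov) : IsUnit a ↔ Valued.v (a : v.Kv) = (1 : ℤᵐ⁰) :=
  ((Valuation.valuationSubring.integers _).isUnit_iff_valuation_eq_one)

theorem Place.residue_eq_zero_iff (v : Place k) (a : v.Ov) :
    IsLocalRing.residue v.Ov a = 0 ↔ Valued.v (a : v.Kv) < (1 : ℤᵐ⁰) := by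
  rw [IsLocalRing.residue_eq_zero_iff, IsLocalRing.mem_maximalIdeal, mem_nonunits_iff,
    v.isUnit_iff]
  exact ⟨fun h ↦ lt_of_le_of_ne a.2 h, fun h ↦ h.ne⟩

variable (Fq) in
-- For a uniformizer x at v, the residue field of Fq(x) at v is Fq. Lifts to k of residues
-- independent over Fq are independent over Fq(x), so the residue degree is at most [k : Fq(x)].
theorem Place.finite_residueField [Algebra (RatFunc Fq) k] [FunctionField Fq k] (v : Place k) :
    Finite (IsLocalRing.ResidueField v.Ov) := by
  obtain ⟨x, hx0, hx⟩ := v.valued_surjective (-1)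
  have hx1 : v.val x < 1 := by
    rw [← Place.valued_emb, hx, ← WithZero.exp_zero, WithZero.exp_lt_exp]; norm_num
  obtain ⟨ψ, hψX, hψ⟩ := Place.exists_finite_ratFunc (Fq := Fq) v hx0 hx1
  let : Algebra (RatFunc Fq) k := ψ.toAlgebra
  have : Module.Finite (RatFunc Fq) k := hψ
  let c : Fq →+* k := ψ.comp RatFunc.C
  let f : Fq →+* v.Ov := (v.emb.comp c).codRestrict _ fun a ↦ by
    rw [Valuation.mem_valuationSubring_iff]
    change Valued.v (v.emb (c a)) ≤ _
    rw [Place.valued_emb]; exact v.val_finite_le c a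
  let : Algebra Fq (IsLocalRing.ResidueField v.Ov) := ((IsLocalRing.residue v.Ov).comp f).toAlgebra
  have hrank : Module.rank Fq (IsLocalRing.ResidueField v.Ov) ≤ (Module.finrank (RatFunc Fq) k : ℕ) := by
    refine rank_le fun s hs ↦ ?_
    have hlift : ∀ i : s, ∃ y : k, ∃ h : v.emb y ∈ v.Ov, IsLocalRing.residue v.Ov ⟨v.emb y, h⟩ = i := by
      intro i
      obtain ⟨a, ha⟩ := IsLocalRing.residue_surjective i.1
      obtain ⟨y, hy⟩ := v.exists_sub_emb_le a (-1)
      have hy1 : Valued.v ((a : v.Kv) - v.emb y) < (1 : ℤᵐ⁰) := by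
        refine hy.trans_lt ?_
        rw [← WithZero.exp_zero, WithZero.exp_lt_exp]; norm_num
      have hmem : v.emb y ∈ v.Ov := by
        have : v.emb y = a - (a - v.emb y) := by ring
        rw [this]; exact sub_mem a.2 hy1.le
      refine ⟨y, hmem, ?_⟩
      rw [← ha, eq_comm, ← sub_eq_zero, ← map_sub, v.residue_eq_zero_iff]
      exact hy1
    choose e he1 he2 using hlift
    have hli : LinearIndependent (RatFunc Fq) e := by
      rw [Fintype.linearIndependent_iff]
      intro g hg i
      by_contra hgi
      -- Dividing the relation by its largest coefficient makes all coefficients integral at `v` and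
      -- one of them 1; it then reduces to a nontrivial relation over `Fq`.
      obtain ⟨m, -, hm⟩ := Finset.exists_max_image Finset.univ
        (fun j ↦ v.val (ψ (g j))) ⟨i, Finset.mem_univ i⟩
      have hgm : ψ (g m) ≠ 0 := by
        intro h0
        have := hm i (Finset.mem_univ i)
        rw [h0, map_zero, nonpos_iff_eq_zero, map_eq_zero, map_eq_zero] at this
        exact hgi this
      have hpos : 0 < v.val (ψ (g m)) := by rw [zero_lt_iff]; simpa using hgm
      have hle : ∀ j, v.val (ψ (g j / g m)) ≤ 1 := fun j ↦ by
        rw [map_div₀, map_div₀]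
        exact (div_le_one₀ hpos).2 (hm j (Finset.mem_univ j))
      choose d hd using fun j ↦ v.exists_val_sub_constant_lt ψ (by rw [hψX]; exact hx1) _ (hle j)
      have hev : ∀ j, v.val (e j) ≤ 1 := fun j ↦ by rw [← Place.valued_emb]; exact he1 j
      have hsum : v.val (∑ j, c (d j) * e j) < 1 := by
        have h0 : ∑ j, ψ (g j / g m) * e j = 0 := by
          have : ∑ j, ψ (g j / g m) * e j = (ψ (g m))⁻¹ * ∑ j, g j • e j := by
            rw [Finset.mul_sum]
            refine Finset.sum_congr rfl fun j _ ↦ ?_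
            rw [map_div₀, Algebra.smul_def]
            change _ = _ * (ψ (g j) * _)
            field_simp
          rw [this, hg, mul_zero]
        rw [← sub_zero (∑ j, _), ← h0, ← Finset.sum_sub_distrib]
        refine Valuation.map_sum_lt _ one_ne_zero fun j _ ↦ ?_
        rw [← sub_mul, map_mul, Valuation.map_sub_swap]
        exact mul_lt_one_of_lt_of_le (hd j) (hev j)
      have hres : ∑ j, d j • (j : IsLocalRing.ResidueField v.Ov) = 0 := by
        have hE : ∑ j, d j • (j : IsLocalRing.ResidueField v.Ov) =
            IsLocalRing.residue v.Ov (∑ j, f (d j) * ⟨v.emb (e j), he1 j⟩) := by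
          rw [map_sum]
          refine Finset.sum_congr rfl fun j _ ↦ ?_
          rw [Algebra.smul_def, map_mul, he2]; rfl
        rw [hE, v.residue_eq_zero_iff]
        have : ((∑ j, f (d j) * ⟨v.emb (e j), he1 j⟩ : v.Ov) : v.Kv) = v.emb (∑ j, c (d j) * e j) := by
          rw [map_sum]
          push_cast
          refine Finset.sum_congr rfl fun j _ ↦ ?_
          rw [map_mul]; rfl
        rw [this, Place.valued_emb]
        exact hsum
      have hdm := Fintype.linearIndependent_iff.1 hs d hres m
      have := hd m
      rw [div_self (by rintro h; rw [h, map_zero] at hgm; exact hgm rfl), hdm] at this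
      simp at this
    have := hli.fintype_card_le_finrank
    simpa using this
  have : Module.Finite Fq (IsLocalRing.ResidueField v.Ov) :=
    Module.rank_lt_aleph0_iff.1 (hrank.trans_lt (Cardinal.natCast_lt_aleph0))
  exact Module.finite_of_finite Fq

variable (Fq) in
theorem Place.one_lt_q [Algebra (RatFunc Fq) k] [FunctionField Fq k] (v : Place k) : 1 < v.q := by
  have := Place.finite_residueField Fq v
  exact Finite.one_lt_card

variable (Fq) in
theorem Place.finite_zeros [Algebra (RatFunc Fq) k] [FunctionField Fq k] {x : k} (hx : x ≠ 0) :
    {v : Place k | v.val x < 1}.Finite := by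
  refine (Place.finite_poles Fq x⁻¹).subset fun v hv ↦ ?_
  rw [Set.mem_ofPred_eq, map_inv₀]
  exact (one_lt_inv₀ (by rw [zero_lt_iff]; simpa using hx)).2 hv

variable (Fq k) in
-- At a place with q_v = n the image x of X either has a pole or satisfies xⁿ ≡ x in the residue
-- field; for each n this allows only the poles of x and the zeros of the nonzero element xⁿ - x.
theorem Place.finite_q_le [Algebra (RatFunc Fq) k] [FunctionField Fq k] (B : ℕ) :
    {v : Place k | v.q ≤ B}.Finite := by
  let x : k := algebraMap (RatFunc Fq) k RatFunc.X
  have hne : ∀ n : ℕ, 1 < n → x ^ n - x ≠ 0 := by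
    intro n hn h
    have h1 : algebraMap (RatFunc Fq) k (algebraMap Fq[X] _ (Polynomial.X ^ n - Polynomial.X)) = 0 := by
      simpa [x] using h
    rw [map_eq_zero, ← map_zero (algebraMap Fq[X] (RatFunc Fq)),
      (RatFunc.algebraMap_injective Fq).eq_iff] at h1
    exact FiniteField.X_pow_card_sub_X_ne_zero Fq hn h1
  refine ((Place.finite_poles Fq x).union (Set.Finite.biUnion (Set.finite_Icc 2 B)
    (t := fun n ↦ {v | v.val (x ^ n - x) < 1}) fun n hn ↦
      Place.finite_zeros Fq (hne n (by have := hn.1; omega)))).subset fun v hv ↦ ?_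
  have h1 := v.one_lt_q Fq
  by_cases hp : 1 < v.val x
  · exact Or.inl hp
  · refine Or.inr (Set.mem_biUnion (x := v.q) ⟨h1, hv⟩ ?_)
    have hmem : v.emb x ∈ v.Ov := by
      rw [Valuation.mem_valuationSubring_iff, Place.valued_emb]; exact not_lt.1 hp
    have := Place.finite_residueField Fq v
    have := Fintype.ofFinite (IsLocalRing.ResidueField v.Ov)
    have hpow := FiniteField.pow_card (IsLocalRing.residue v.Ov ⟨v.emb x, hmem⟩)
    rw [← Nat.card_eq_fintype_card, ← sub_eq_zero, ← map_pow, ← map_sub, v.residue_eq_zero_iff] at hpow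
    rw [Set.mem_ofPred_eq, ← Place.valued_emb, map_sub, map_pow]
    exact hpow

end FunctionFields

/-! ### Existence of a place and finiteness of the field of constants -/

section Constants

open scoped IntermediateField.algebraAdjoinAdjoin

variable {Fq k : Type*} [Field Fq] [Field k]

/-- If `k` is finite separable over `Fq(z)`, then `z` has a zero, and the minimal polynomial over
`Fq(z)` of an element of `k` without poles has coefficients in `Fq[z]`. -/
theorem exists_place_lt_one_and_minpoly_coeff_mem [Algebra Fq k] {z : k} (hz : Transcendental Fq z)
    {E : IntermediateField Fq k} (hE : E = IntermediateField.adjoin Fq {z})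
    [FiniteDimensional E k] [Algebra.IsSeparable E k] :
    (∃ v : Place k, v.val z < 1) ∧ ∀ x : k, (∀ v : Place k, v.val x ≤ 1) →
      ∀ i, ((minpoly E x).coeff i : k) ∈ Algebra.adjoin Fq {z} := by
  subst hE
  let A := Algebra.adjoin Fq {z}
  let C := integralClosure A k
  have hPIR : IsPrincipalIdealRing A := IsPrincipalIdealRing.of_surjective
    (Polynomial.algEquivOfTranscendental Fq z hz : Fq[X] →+* A)
    (Polynomial.algEquivOfTranscendental Fq z hz).surjective
  have : IsDedekindDomain C :=
    integralClosure.isDedekindDomain A (IntermediateField.adjoin Fq {z}) k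
  have : IsFractionRing C k :=
    integralClosure.isFractionRing_of_finite_extension (IntermediateField.adjoin Fq {z}) k
  have hz0 : z ≠ 0 := fun h ↦ hz (h ▸ isAlgebraic_zero)
  let zA : A := ⟨z, Algebra.self_mem_adjoin_singleton Fq z⟩
  constructor
  -- If z were a unit of the integral closure `C` of Fq[z], then z⁻¹ would be integral over Fq[z],
  -- hence a polynomial in z, against transcendence. A maximal ideal of `C` containing z then gives
  -- the place.
  · have hunit : ¬ IsUnit (algebraMap A C zA) := by
      rintro ⟨u, hu⟩
      have hint : IsIntegral A (z⁻¹ : k) := by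
        have h1 : ((u⁻¹ : Cˣ) : C) * algebraMap A C zA = 1 := by rw [← hu, Units.inv_mul]
        have h2 : (((u⁻¹ : Cˣ) : C) : k) * z = 1 := congrArg (Subtype.val) h1
        rw [← eq_inv_of_mul_eq_one_left h2]
        exact ((u⁻¹ : Cˣ) : C).2
      have hint' : IsIntegral A ((IntermediateField.AdjoinSimple.gen Fq z)⁻¹) := by
        refine (isIntegral_algHom_iff (IsScalarTower.toAlgHom A (IntermediateField.adjoin Fq {z}) k)
          (algebraMap (IntermediateField.adjoin Fq {z}) k).injective).1 ?_
        simpa using hint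
      obtain ⟨y, hy⟩ := IsIntegrallyClosed.isIntegral_iff.1 hint'
      have hy' : (y : k) = z⁻¹ := by
        have := congrArg (Subtype.val) hy
        rw [IntermediateField.coe_inv, IntermediateField.AdjoinSimple.coe_gen] at this
        exact this
      obtain ⟨P, hP⟩ := (Algebra.adjoin_singleton_eq_range_aeval Fq z ▸ y.2 :
        (y : k) ∈ (Polynomial.aeval (R := Fq) z).range)
      refine hz ⟨Polynomial.X * P - 1, fun h0 ↦ ?_, ?_⟩
      · have := congrArg (fun p : Fq[X] ↦ p.coeff 0) h0
        simp at this
      · have hP' : Polynomial.aeval z P = z⁻¹ := by rw [← hy']; exact hP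
        simp [hP', hz0]
    obtain ⟨p, hp, hzp⟩ := exists_max_ideal_of_mem_nonunits (mem_nonunits_iff.2 hunit)
    have hp0 : p ≠ ⊥ := by
      rintro rfl
      rw [Ideal.mem_bot] at hzp
      exact hz0 (congrArg Subtype.val hzp)
    let P : IsDedekindDomain.HeightOneSpectrum C := ⟨p, hp.isPrime, hp0⟩
    refine ⟨⟨P.valuation k, P.valuation_surjective k⟩, ?_⟩
    exact (P.valuation_lt_one_iff_mem (algebraMap A C zA)).2 hzp
  -- An element integral at all primes of the Dedekind domain `C` lies in `C`, and its minimal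
  -- polynomial over the fraction field of Fq[z] has coefficients in the integrally closed ring
  -- Fq[z].
  · intro x hx i
    obtain ⟨y, hy⟩ := IsDedekindDomain.HeightOneSpectrum.mem_integers_of_valuation_le_one (R := C) k x
      (fun P ↦ hx ⟨P.valuation k, P.valuation_surjective k⟩)
    have hint : IsIntegral A x := by rw [← hy]; exact y.2
    rw [minpoly.isIntegrallyClosed_eq_field_fractions' (IntermediateField.adjoin Fq {z}) hint,
      Polynomial.coeff_map]
    exact ((minpoly A x).coeff i).2

/-- Over the perfect field `Fq` there is a separating transcendence basis. It is nonempty because of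
`X`, and any one of its elements is already a transcendence basis, hence all of it. -/
theorem exists_transcendental_isSeparable [Finite Fq] [Algebra Fq k] [Algebra (RatFunc Fq) k] [FunctionField Fq k]
    [IsScalarTower Fq (RatFunc Fq) k] :
    ∃ y : k, Transcendental Fq y ∧ Algebra.IsSeparable (IntermediateField.adjoin Fq {y}) k := by
  have : Algebra.EssFiniteType Fq[X] (RatFunc Fq) := .of_isLocalization _ (nonZeroDivisors Fq[X])
  have : Algebra.EssFiniteType Fq (RatFunc Fq) := .comp Fq Fq[X] _
  have : Algebra.EssFiniteType Fq k := .comp Fq (RatFunc Fq) k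
  obtain ⟨s, hs, hsep⟩ := exists_isTranscendenceBasis_and_isSeparable_of_perfectField Fq k
  have hX : Transcendental Fq (algebraMap (RatFunc Fq) k RatFunc.X) :=
    (transcendental_algebraMap_iff (algebraMap (RatFunc Fq) k).injective).2 RatFunc.transcendental_X
  have hne : s.Nonempty := by
    rw [Finset.nonempty_iff_ne_empty]
    rintro rfl
    have := hs.2 {algebraMap (RatFunc Fq) k RatFunc.X}
      (algebraicIndependent_unique_type_iff.2 hX) (by simp)
    simp at this
  obtain ⟨y, hy⟩ := hne
  have hyt : Transcendental Fq y := hs.1.transcendental ⟨y, hy⟩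
  have hfd := FunctionField.finiteDimensional_of_adjoin_transcendental (F := Fq) (K := k) hyt
  have hyb : IsTranscendenceBasis Fq (fun _ : Unit ↦ y) := by
    have hind : AlgebraicIndependent Fq (fun _ : Unit ↦ y) :=
      algebraicIndependent_unique_type_iff.2 hyt
    rw [hind.isTranscendenceBasis_iff_isAlgebraic, Set.range_const]
    exact .trans _ (IntermediateField.adjoin Fq {y}) _
  have hsy := hyb.2 (s : Set k) hs.1 (by simpa using hy)
  refine ⟨y, hyt, ?_⟩
  rwa [← hsy, Set.range_const] at hsep

variable (Fq) in
-- The minimal polynomial of an element without poles has coefficients in Fq[y] ∩ Fq[y⁻¹] = Fq, so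
-- the element is algebraic over Fq. Differences of distinct algebraic elements are units at every
-- place, hence these elements inject into one residue field, which is finite.
theorem finite_constants [Finite Fq] [Algebra (RatFunc Fq) k] [FunctionField Fq k] :
    Nonempty (Place k) ∧ {x : k | ∀ v : Place k, v.val x ≤ 1}.Finite := by
  let : Algebra Fq k := ((algebraMap (RatFunc Fq) k).comp (algebraMap Fq (RatFunc Fq))).toAlgebra
  have : IsScalarTower Fq (RatFunc Fq) k := IsScalarTower.of_algebraMap_eq' rfl
  obtain ⟨y, hyt, hsep⟩ := exists_transcendental_isSeparable (Fq := Fq) (k := k)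
  have hfd := FunctionField.finiteDimensional_of_adjoin_transcendental (F := Fq) (K := k) hyt
  obtain ⟨⟨v, hv⟩, h1⟩ := exists_place_lt_one_and_minpoly_coeff_mem hyt rfl
  have hyt' : Transcendental Fq y⁻¹ := fun h ↦ hyt (by simpa using h.inv)
  have hE : IntermediateField.adjoin Fq {y} = IntermediateField.adjoin Fq {y⁻¹} := by
    apply le_antisymm <;> rw [IntermediateField.adjoin_simple_le_iff]
    · rw [← inv_inv y]
      exact inv_mem (by simpa using IntermediateField.mem_adjoin_simple_self Fq y⁻¹)
    · exact inv_mem (IntermediateField.mem_adjoin_simple_self Fq y)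
  obtain ⟨-, h2⟩ := exists_place_lt_one_and_minpoly_coeff_mem hyt' hE
  refine ⟨⟨v⟩, ?_⟩
  have halg : ∀ x : k, (∀ v : Place k, v.val x ≤ 1) → IsIntegral Fq x := by
    intro x hx
    have hcoeff : ∀ i, ∃ c : Fq, ((minpoly (IntermediateField.adjoin Fq {y}) x).coeff i : k) =
        algebraMap Fq k c := by
      intro i
      have hP := h1 x hx i
      have hQ := h2 x hx i
      rw [Algebra.adjoin_singleton_eq_range_aeval] at hP hQ
      obtain ⟨P, hP⟩ := hP
      obtain ⟨Q, hQ⟩ := hQ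
      have hP : Polynomial.aeval y P = ((minpoly (IntermediateField.adjoin Fq {y}) x).coeff i : k) := hP
      have hQ : Polynomial.aeval y⁻¹ Q = ((minpoly (IntermediateField.adjoin Fq {y}) x).coeff i : k) := hQ
      -- Clearing denominators in P(y) = Q(y⁻¹); since the reverse of `Q` has degree at most deg Q,
      -- comparing degrees makes `P` constant.
      have h0 : Polynomial.aeval y (Polynomial.X ^ Q.natDegree * P - Q.reverse) = 0 := by
        have hy0 : y ≠ 0 := fun h ↦ hyt (h ▸ isAlgebraic_zero)
        let : Invertible y⁻¹ := invertibleOfNonzero (inv_ne_zero hy0)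
        have := Polynomial.eval₂_reverse_mul_pow (algebraMap Fq k) y⁻¹ Q
        rw [invOf_eq_inv, inv_inv] at this
        rw [← Polynomial.aeval_def, ← Polynomial.aeval_def, hQ, ← hP] at this
        rw [map_sub, map_mul, map_pow, Polynomial.aeval_X, ← this]
        have h1 : y ^ Q.natDegree * y⁻¹ ^ Q.natDegree = 1 := by
          rw [← mul_pow, mul_inv_cancel₀ hy0, one_pow]
        linear_combination Polynomial.aeval y Q.reverse * h1
      have h3 : Polynomial.X ^ Q.natDegree * P - Q.reverse = 0 := by
        by_contra hne; exact hyt ⟨_, hne, h0⟩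
      have h4 : P.natDegree = 0 := by
        by_cases hP0 : P = 0
        · simp [hP0]
        have h5 := congrArg Polynomial.natDegree (sub_eq_zero.1 h3)
        rw [Polynomial.natDegree_mul (by simp) hP0, Polynomial.natDegree_X_pow] at h5
        have := Polynomial.reverse_natDegree_le Q
        omega
      refine ⟨P.coeff 0, ?_⟩
      rw [← hP, Polynomial.eq_C_of_natDegree_eq_zero h4]
      simp
    choose c hc using hcoeff
    have hm := minpoly.monic (Algebra.IsIntegral.isIntegral (R := IntermediateField.adjoin Fq {y}) x)
    have hl : minpoly (IntermediateField.adjoin Fq {y}) x ∈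
        Polynomial.lifts (algebraMap Fq (IntermediateField.adjoin Fq {y})) := by
      rw [Polynomial.lifts_iff_coeff_lifts]
      exact fun i ↦ ⟨c i, Subtype.ext (hc i).symm⟩
    obtain ⟨p, hp, -, hpm⟩ := Polynomial.lifts_and_natDegree_eq_and_monic hl hm
    refine ⟨p, hpm, ?_⟩
    have := minpoly.aeval (IntermediateField.adjoin Fq {y}) x
    rw [← hp, Polynomial.aeval_map_algebraMap] at this
    exact this
  have := Place.finite_residueField Fq v
  have hmem : ∀ x : {x : k | ∀ v : Place k, v.val x ≤ 1}, v.emb x ∈ v.Ov := fun x ↦ by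
    rw [Valuation.mem_valuationSubring_iff, Place.valued_emb]; exact x.2 v
  refine Set.finite_coe_iff.1 (Finite.of_injective (fun x ↦ IsLocalRing.residue v.Ov ⟨v.emb x, hmem x⟩)
    fun x y hxy ↦ ?_)
  rw [← sub_eq_zero, ← map_sub, v.residue_eq_zero_iff] at hxy
  have hlt : v.val ((x : k) - y) < 1 := by
    rw [← Place.valued_emb, map_sub]; exact hxy
  by_contra hne
  refine hlt.ne (v.val_eq_one_of_isIntegral (algebraMap Fq k)
    (sub_ne_zero.2 fun h ↦ hne (Subtype.ext h)) ?_)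
  exact (halg x x.2).sub (halg y y.2)

end Constants

/-! ### Partial fractions -/

section PartialFractions

variable {Fq k : Type*} [Field Fq] [Field k]

/-- Splitting off gcd(D, M) lowers the degree of D until what is left is coprime to M; n bounds the
degree for the induction. -/
theorem exists_dvd_pow_mul_isCoprime (M : Fq[X]) (n : ℕ) :
    ∀ D : Fq[X], D ≠ 0 → D.natDegree ≤ n →
      ∃ D₁ D₂ : Fq[X], D = D₁ * D₂ ∧ (∃ m, D₁ ∣ M ^ m) ∧ IsCoprime D₂ M := by
  classical
  induction n with
  | zero =>
    intro D hD hd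
    refine ⟨1, D, (one_mul D).symm, ⟨0, by simp⟩, ?_⟩
    have : IsUnit D := Polynomial.isUnit_iff_degree_eq_zero.2
      (by rw [Polynomial.degree_eq_natDegree hD]; simpa using hd)
    obtain ⟨u, hu⟩ := this
    exact ⟨↑u⁻¹, 0, by rw [← hu]; simp⟩
  | succ n ih =>
    intro D hD hd
    by_cases hc : IsCoprime D M
    · exact ⟨1, D, (one_mul D).symm, ⟨0, by simp⟩, hc⟩
    · obtain ⟨D', hD'⟩ := EuclideanDomain.gcd_dvd_left D M
      have hg : ¬ IsUnit (EuclideanDomain.gcd D M) := fun h ↦ hc (EuclideanDomain.gcd_isUnit_iff.1 h)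
      have hg0 : EuclideanDomain.gcd D M ≠ 0 := fun h ↦ hD (by rw [hD', h, zero_mul])
      have hD'0 : D' ≠ 0 := fun h ↦ hD (by rw [hD', h, mul_zero])
      have hdeg : 0 < (EuclideanDomain.gcd D M).natDegree := by
        rw [Nat.pos_iff_ne_zero]
        intro h
        exact hg (Polynomial.isUnit_iff_degree_eq_zero.2
          (by rw [Polynomial.degree_eq_natDegree hg0, h]; rfl))
      obtain ⟨D₁, D₂, h1, ⟨m, h2⟩, h3⟩ := ih D' hD'0 (by
        have := Polynomial.natDegree_mul hg0 hD'0
        rw [← hD'] at this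
        omega)
      refine ⟨EuclideanDomain.gcd D M * D₁, D₂, by rw [mul_assoc, ← h1, ← hD'], ⟨m + 1, ?_⟩, h3⟩
      rw [pow_succ']
      exact mul_dvd_mul (EuclideanDomain.gcd_dvd_right D M) h2

/-- A place where X has a pole restricts to the degree valuation of Fq(X), up to equivalence. -/
theorem Place.val_div_le_one_of_degree_lt (v : Place k) [Finite Fq] (ψ : RatFunc Fq →+* k)
    (hv : 1 < v.val (ψ RatFunc.X)) {P Q : Fq[X]} (h : P.degree < Q.degree) :
    v.val (ψ (algebraMap Fq[X] (RatFunc Fq) P / algebraMap Fq[X] (RatFunc Fq) Q)) ≤ 1 := by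
  classical
  have hq : (v.val.comap ψ).IsEquiv (RatFunc.inftyValuation Fq) :=
    RatFunc.valuation_isEquiv_inftyValuation_of_one_lt_valuation_X
      (by rw [Valuation.comap_apply]; exact hv)
  by_cases hP : P = 0
  · simp [hP]
  have hQ : Q ≠ 0 := by rintro rfl; simp at h
  have := (Valuation.isEquiv_iff_val_le_one.1 hq (x := algebraMap Fq[X] (RatFunc Fq) P / algebraMap Fq[X] (RatFunc Fq) Q)).2 (by
    rw [map_div₀, RatFunc.inftyValuation_apply, RatFunc.inftyValuation_apply,
      RatFunc.inftyValuation.polynomial _ hP, RatFunc.inftyValuation.polynomial _ hQ,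
      div_le_one₀ WithZero.exp_pos, WithZero.exp_le_exp]
    exact_mod_cast (Polynomial.natDegree_lt_natDegree hP h).le)
  exact this

/-- Partial fractions: a rational function is the sum of one which is integral at infinity and at the
places dividing `M`, and one which is integral at all other places. -/
theorem exists_partial_fraction [Finite Fq] (ψ : RatFunc Fq →+* k) (M : Fq[X]) (f : RatFunc Fq) :
    ∃ g : RatFunc Fq,
      (∀ v : Place k, 1 < v.val (ψ RatFunc.X) ∨ v.val (ψ (algebraMap Fq[X] _ M)) < 1 →
        v.val (ψ (f - g)) ≤ 1) ∧
      ∀ v : Place k, v.val (ψ RatFunc.X) ≤ 1 → v.val (ψ (algebraMap Fq[X] _ M)) = 1 →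
        v.val (ψ g) ≤ 1 := by
  obtain ⟨D₁, D₂, hD, ⟨m, hm⟩, hco⟩ := exists_dvd_pow_mul_isCoprime M _ f.denom f.denom_ne_zero le_rfl
  have hco' : IsCoprime D₁ D₂ := ((hco.symm.pow_left (m := m)).of_isCoprime_of_dvd_left hm)
  obtain ⟨u, w, huw⟩ := hco'
  have hD0 : D₁ * D₂ ≠ 0 := hD ▸ f.denom_ne_zero
  have hD1 : algebraMap Fq[X] (RatFunc Fq) D₁ ≠ 0 := by
    simpa using left_ne_zero_of_mul hD0
  have hD2 : algebraMap Fq[X] (RatFunc Fq) D₂ ≠ 0 := by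
    simpa using right_ne_zero_of_mul hD0
  let A := algebraMap Fq[X] (RatFunc Fq)
  let B := f.num * u
  let φ : Fq[X] →+* k := ψ.comp A
  have hφX : φ Polynomial.X = ψ RatFunc.X := by simp [φ, A]
  -- From u D₁ + w D₂ = 1 one gets f = num·w / D₁ + num·u / D₂. The polynomial part of the second
  -- fraction is moved into `g`, so that the remainder is also integral at infinity.
  have hfg : f - (A (f.num * w) / A D₁ + A (B / D₂)) = A (B % D₂) / A D₂ := by
    have h1 : A B = A D₂ * A (B / D₂) + A (B % D₂) := by
      rw [← map_mul, ← map_add, EuclideanDomain.div_add_mod]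
    have h2 : A u * A D₁ + A w * A D₂ = 1 := by rw [← map_mul, ← map_mul, ← map_add, huw, map_one]
    have h3 : f = A f.num / (A D₁ * A D₂) := by
      conv_lhs => rw [← RatFunc.num_div_denom f, hD, map_mul]
    have h4 : A B = A f.num * A u := map_mul _ _ _
    rw [sub_eq_iff_eq_add]
    conv_lhs => rw [h3]
    rw [map_mul]
    have hD1 : A D₁ ≠ 0 := hD1
    have hD2 : A D₂ ≠ 0 := hD2
    field_simp
    linear_combination (-A f.num) * h2 - A D₁ * h4 + A D₁ * h1
  refine ⟨A (f.num * w) / A D₁ + A (B / D₂), fun v hv ↦ ?_, fun v hv hM ↦ ?_⟩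
  · rw [hfg]
    by_cases hX : 1 < v.val (ψ RatFunc.X)
    · exact v.val_div_le_one_of_degree_lt ψ hX (EuclideanDomain.mod_lt _ (right_ne_zero_of_mul hD0))
    · have hv := hv.resolve_left hX
      have hle := v.val_polynomial_le φ (by rw [hφX]; exact not_lt.1 hX)
      have h1 : v.val (φ D₂) = 1 := by
        refine le_antisymm (hle _) (not_lt.1 fun hlt ↦ ?_)
        obtain ⟨a, b, hab⟩ := hco
        have : v.val (φ (a * D₂ + b * M)) < 1 := by
          rw [map_add, map_mul, map_mul]
          refine (v.val.map_add _ _).trans_lt (max_lt ?_ ?_)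
          · rw [map_mul, mul_comm]; exact mul_lt_one_of_lt_of_le hlt (hle _)
          · rw [map_mul, mul_comm]; exact mul_lt_one_of_lt_of_le hv (hle _)
        rw [hab, map_one, map_one] at this
        exact lt_irrefl _ this
      rw [map_div₀, map_div₀, show v.val (ψ (A D₂)) = 1 from h1, div_one]
      exact hle _
  · have hle := v.val_polynomial_le φ (by rw [hφX]; exact hv)
    have h1 : v.val (φ D₁) = 1 := by
      obtain ⟨c, hc⟩ := hm
      have h2 : v.val (φ (M ^ m)) = 1 := by
        rw [map_pow, map_pow, show v.val (φ M) = 1 from hM, one_pow]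
      rw [hc, map_mul, map_mul] at h2
      refine le_antisymm (hle _) (h2 ▸ ?_)
      exact mul_le_of_le_one_right' (hle _)
    rw [map_add, map_div₀]
    refine (v.val.map_add _ _).trans (max_le ?_ (hle _))
    rw [map_div₀, show v.val (ψ (A D₁)) = 1 from h1, div_one]
    exact hle _

/-- A place is nontrivial on polynomials. -/
theorem Place.exists_polynomial_ne_one (v : Place k) (ψ : RatFunc Fq →+* k) (hψ : ψ.Finite) :
    ∃ P : Fq[X], P ≠ 0 ∧ v.val (ψ (algebraMap Fq[X] _ P)) ≠ 1 := by
  by_contra! h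
  have hle : ∀ f : RatFunc Fq, v.val (ψ f) ≤ 1 := by
    intro f
    by_cases hf : f = 0
    · simp [hf]
    · rw [← RatFunc.num_div_denom f, map_div₀, map_div₀, h _ (by simpa using hf), h _ f.denom_ne_zero,
        div_one]
  -- All of `k` is integral over Fq(X), which lies in the ring of integers of `v`; so `v` would take
  -- no value above 1.
  let : Algebra (RatFunc Fq) k := ψ.toAlgebra
  have : Module.Finite (RatFunc Fq) k := hψ
  let : Algebra (RatFunc Fq) v.val.integer := (ψ.codRestrict v.val.integer hle).toAlgebra
  have : IsScalarTower (RatFunc Fq) v.val.integer k := IsScalarTower.of_algebraMap_eq' rfl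
  obtain ⟨x, hx⟩ := v.surj (WithZero.exp 1)
  have h1 : v.val x ≤ 1 := (Valuation.integer.integers v.val).mem_of_integral
    ((Algebra.IsIntegral.isIntegral (R := RatFunc Fq) x).tower_top)
  rw [hx, ← WithZero.exp_zero, WithZero.exp_le_exp] at h1
  norm_num at h1

end PartialFractions

/-! ### Ideles, their lattices, and the covering of the adeles modulo `k` -/

section Adeles

variable {k : Type*} [Field k]

/-- The units of a commutative ring. -/
abbrev ringUnits (R : Type*) [CommRing R] : Type _ := Rˣ

instance (R : Type*) [CommRing R] : CommGroup (ringUnits R) := Units.instCommGroupUnits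

variable (k) in
/-- The idele group of `k`. -/
abbrev Idele : Type _ := ringUnits (Adele k)

/-- The idele with prescribed nonzero components, almost all of them units. -/
def ideleMk (f : ∀ v : Place k, v.Kv) (h0 : ∀ v, f v ≠ 0)
    (h1 : {v : Place k | (Valued.v (f v) : ℤᵐ⁰) ≠ 1}.Finite) : Idele k where
  val := ⟨f, by
    refine h1.subset fun v hv h ↦ hv ?_
    exact h.le⟩
  inv := ⟨fun v ↦ (f v)⁻¹, by
    refine h1.subset fun v hv h ↦ hv ?_
    change Valued.v (f v)⁻¹ ≤ (1 : ℤᵐ⁰)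
    rw [map_inv₀, h, inv_one]⟩
  val_inv := Subtype.ext <| funext fun v ↦ mul_inv_cancel₀ (h0 v)
  inv_val := Subtype.ext <| funext fun v ↦ inv_mul_cancel₀ (h0 v)

theorem ideleMk_apply (f : ∀ v : Place k, v.Kv) (h0 h1) (v : Place k) :
    (ideleMk f h0 h1 : Adele k) v = f v := rfl

theorem idele_mul_inv_apply (a : Idele k) (v : Place k) :
    (a : Adele k) v * ((a⁻¹ : Idele k) : Adele k) v = 1 :=
  congrArg (fun x : Adele k ↦ x v) a.mul_inv

theorem idele_ne_zero (a : Idele k) (v : Place k) : (a : Adele k) v ≠ 0 :=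
  left_ne_zero_of_mul_eq_one (idele_mul_inv_apply a v)

theorem idele_inv_apply (a : Idele k) (v : Place k) :
    ((a⁻¹ : Idele k) : Adele k) v = ((a : Adele k) v)⁻¹ :=
  eq_inv_of_mul_eq_one_right (idele_mul_inv_apply a v)

theorem valued_idele_ne_zero (a : Idele k) (v : Place k) :
    (Valued.v ((a : Adele k) v) : ℤᵐ⁰) ≠ 0 := by simpa using idele_ne_zero a v

theorem finite_not_integral (a : Adele k) : {v : Place k | ¬ (Valued.v (a v) : ℤᵐ⁰) ≤ 1}.Finite :=
  a.2

theorem idele_finite_ne_one (a : Idele k) :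
    {v : Place k | (Valued.v ((a : Adele k) v) : ℤᵐ⁰) ≠ 1}.Finite := by
  refine ((finite_not_integral (a : Adele k)).union
    (finite_not_integral ((a⁻¹ : Idele k) : Adele k))).subset fun v hv ↦ ?_
  by_contra h
  simp only [Set.mem_union, Set.mem_ofPred_eq, not_or, not_not, idele_inv_apply, map_inv₀] at h
  refine hv (le_antisymm h.1 ?_)
  exact (inv_le_one₀ (zero_lt_iff.2 (valued_idele_ne_zero a v))).1 h.2

/-- The lattice `a 𝒪` in the adele ring, `a` being an idele. -/
def ideleLattice (a : Idele k) : AddSubgroup (Adele k) where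
  carrier := {x | ∀ v : Place k, (Valued.v (x v) : ℤᵐ⁰) ≤ Valued.v ((a : Adele k) v)}
  add_mem' hx hy v := (Valuation.map_add _ _ _).trans (max_le (hx v) (hy v))
  zero_mem' v := by simp
  neg_mem' {x} hx v := by
    have : (-x) v = -(x v) := rfl
    rw [this, Valuation.map_neg]; exact hx v

theorem mem_ideleLattice {a : Idele k} {x : Adele k} :
    x ∈ ideleLattice a ↔ ∀ v : Place k, (Valued.v (x v) : ℤᵐ⁰) ≤ Valued.v ((a : Adele k) v) :=
  Iff.rfl

variable (Fq : Type*) [Field Fq] [Finite Fq] [Algebra (RatFunc Fq) k] [FunctionField Fq k]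

variable (k) in
/-- The quotient of the adele ring by `k` is covered by a lattice. -/
theorem exists_forall_sub_diag_mem :
    ∃ b : Idele k, ∀ α : Adele k, ∃ r : k, α - diag Fq k r ∈ ideleLattice b := by
  classical
  let e := Module.finBasis (RatFunc Fq) k
  let ψ := algebraMap (RatFunc Fq) k
  have hψ : ψ.Finite := (RingHom.finite_algebraMap).2 inferInstance
  -- The component of `b` at `v` dominates 1 and the basis `e`; it is 1 at almost all places, as
  -- required of an idele.
  have hb : ∀ v : Place k, ∃ c : k, c ≠ 0 ∧ 1 ≤ v.val c ∧ (∀ i, v.val (e i) ≤ v.val c) ∧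
      ((∀ i, v.val (e i) ≤ 1) → c = 1) := by
    intro v
    by_cases h : ∀ i, v.val (e i) ≤ 1
    · exact ⟨1, one_ne_zero, by simp, by simpa using h, fun _ ↦ rfl⟩
    · push Not at h
      obtain ⟨i, hi⟩ := h
      obtain ⟨m, -, hm⟩ := Finset.exists_max_image Finset.univ
        (fun j ↦ v.val (e j)) ⟨i, Finset.mem_univ i⟩
      have h1 : 1 < v.val (e m) := hi.trans_le (hm i (Finset.mem_univ i))
      refine ⟨e m, e.ne_zero m, h1.le, fun j ↦ hm j (Finset.mem_univ j), fun h ↦ ?_⟩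
      exact absurd (h m) (not_le.2 h1)
  choose c hc0 hc1 hce hcu using hb
  have hfin : {v : Place k | (Valued.v (v.emb (c v)) : ℤᵐ⁰) ≠ 1}.Finite := by
    refine (Set.finite_iUnion fun i ↦ Place.finite_poles Fq (e i)).subset fun v hv ↦ ?_
    by_contra h
    simp only [Set.mem_iUnion, Set.mem_ofPred_eq, not_exists, not_lt] at h
    exact hv (by rw [hcu v h, map_one, map_one])
  refine ⟨ideleMk (fun v ↦ v.emb (c v)) (fun v ↦ by simpa using hc0 v) hfin, fun α ↦ ?_⟩
  choose P hP0 hP1 using fun v : Place k ↦ v.exists_polynomial_ne_one ψ hψ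
  have hT := finite_not_integral α
  -- Each place where `α` is not integral is thus a pole of X or a zero of `M`.
  let M : Fq[X] := ∏ v ∈ hT.toFinset, P v
  have hM0 : M ≠ 0 := Finset.prod_ne_zero_iff.2 fun v _ ↦ hP0 v
  have hψM : ψ (algebraMap Fq[X] _ M) ≠ 0 := by simpa using hM0
  have hle : ∀ (v : Place k), v.val (ψ RatFunc.X) ≤ 1 → ∀ Q : Fq[X],
      v.val (ψ (algebraMap Fq[X] _ Q)) ≤ 1 := fun v hv ↦
    v.val_polynomial_le (ψ.comp (algebraMap Fq[X] _)) (by simpa using hv)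
  have hT' : ({v : Place k | 1 < v.val (ψ RatFunc.X)} ∪
      {v : Place k | v.val (ψ (algebraMap Fq[X] _ M)) < 1}).Finite :=
    (Place.finite_poles Fq _).union (Place.finite_zeros Fq hψM)
  -- `r₀` takes care of the poles of X and the zeros of `M` but may have poles elsewhere. Replacing
  -- its coordinates by the parts `g` of their partial fractions changes it integrally at the former
  -- places and makes the coordinates integral at the others.
  obtain ⟨r₀, hr₀⟩ := exists_forall_sub_emb_le_one hT' α
  choose g hg1 hg2 using fun i ↦ exists_partial_fraction ψ M (e.repr r₀ i)
  refine ⟨∑ i, ψ (g i) * e i, fun v ↦ ?_⟩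
  have hr₀e : r₀ = ∑ i, ψ (e.repr r₀ i) * e i := by
    conv_lhs => rw [← e.sum_repr r₀]
    simp [Algebra.smul_def, ψ]
  rw [ideleMk_apply, Place.valued_emb]
  have hsub : (α - diag Fq k (∑ i, ψ (g i) * e i)) v = α v - v.emb (∑ i, ψ (g i) * e i) := rfl
  rw [hsub]
  by_cases hv : 1 < v.val (ψ RatFunc.X) ∨ v.val (ψ (algebraMap Fq[X] _ M)) < 1
  · have h1 : α v - v.emb (∑ i, ψ (g i) * e i) =
        (α v - v.emb r₀) + v.emb (∑ i, ψ (e.repr r₀ i - g i) * e i) := by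
      have h2 : ∑ i, ψ (e.repr r₀ i - g i) * e i = r₀ - ∑ i, ψ (g i) * e i := by
        simp only [map_sub ψ, sub_mul, Finset.sum_sub_distrib, ← hr₀e]
      rw [h2, map_sub]
      ring
    rw [h1]
    refine (Valuation.map_add _ _ _).trans (max_le ((hr₀ v hv).trans (hc1 v)) ?_)
    rw [Place.valued_emb]
    refine Valuation.map_sum_le _ fun i _ ↦ ?_
    rw [map_mul]
    exact (mul_le_of_le_one_left' (hg1 i v hv)).trans (hce v i)
  · push Not at hv
    have hM1 : v.val (ψ (algebraMap Fq[X] _ M)) = 1 := le_antisymm (hle v hv.1 M) hv.2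
    have hα : (Valued.v (α v) : ℤᵐ⁰) ≤ 1 := by
      by_contra hα
      have hlt : v.val (ψ (algebraMap Fq[X] _ (P v))) < 1 := lt_of_le_of_ne (hle v hv.1 _) (hP1 v)
      have hdvd : P v ∣ M := Finset.dvd_prod_of_mem P (by simpa using hα)
      obtain ⟨Q, hQ⟩ := hdvd
      rw [hQ, map_mul, map_mul, map_mul] at hM1
      exact (mul_lt_one_of_lt_of_le hlt (hle v hv.1 Q)).ne hM1
    refine (Valuation.map_sub _ _ _).trans (max_le (hα.trans (hc1 v)) ?_)
    rw [Place.valued_emb]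
    refine Valuation.map_sum_le _ fun i _ ↦ ?_
    rw [map_mul]
    exact (mul_le_of_le_one_left' (hg2 i v hv.1 hM1)).trans (hce v i)

end Adeles

/-! ### The idele norm -/

section IdeleNorm

variable {k : Type*} [Field k]

theorem Place.abs_of_ne_zero (v : Place k) {x : v.Kv} (hx : x ≠ 0) :
    v.abs x = (v.q : ℝ) ^ WithZero.log (Valued.v x : ℤᵐ⁰) := if_neg hx

theorem Place.abs_eq_one (v : Place k) {x : v.Kv} (hx : (Valued.v x : ℤᵐ⁰) = 1) : v.abs x = 1 := by
  have h0 : x ≠ 0 := by rintro rfl; simp at hx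
  rw [v.abs_of_ne_zero h0, hx, WithZero.log_one, zpow_zero]

theorem Place.abs_congr (v : Place k) {x y : v.Kv} (h : (Valued.v x : ℤᵐ⁰) = Valued.v y) :
    v.abs x = v.abs y := by
  by_cases hx : x = 0
  · have hy : y = 0 := by rw [hx, map_zero] at h; simpa using h.symm
    rw [hx, hy]
  · have hy : y ≠ 0 := by rintro rfl; rw [map_zero] at h; exact hx (by simpa using h)
    rw [v.abs_of_ne_zero hx, v.abs_of_ne_zero hy, h]

theorem ideleNorm_mulSupport (a : Idele k) :
    (Function.mulSupport fun v : Place k ↦ v.abs ((a : Adele k) v)).Finite :=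
  (idele_finite_ne_one a).subset fun v hv h ↦ hv (v.abs_eq_one h)

theorem ideleNorm_congr {a b : Idele k}
    (h : ∀ v : Place k, (Valued.v ((a : Adele k) v) : ℤᵐ⁰) = Valued.v ((b : Adele k) v)) :
    ideleNorm a = ideleNorm b :=
  finprod_congr fun v ↦ v.abs_congr (h v)

open Classical in
/-- The idele with component `x` at `v` and `1` elsewhere. -/
def localIdele (v : Place k) (x : v.Kvˣ) : Idele k :=
  ideleMk (Pi.mulSingle v (x : v.Kv)) (fun w ↦ by
    by_cases h : w = v
    · subst h; simp
    · simp [h]) ((Set.finite_singleton v).subset fun w hw ↦ by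
      by_contra h
      exact hw (by rw [Pi.mulSingle_eq_of_ne h, map_one]))

theorem localIdele_self (v : Place k) (x : v.Kvˣ) : (localIdele v x : Adele k) v = x := by
  simp [localIdele, ideleMk_apply]

theorem localIdele_of_ne {v w : Place k} (h : w ≠ v) (x : v.Kvˣ) : (localIdele v x : Adele k) w = 1 := by
  simp [localIdele, ideleMk_apply, h]

theorem ideleNorm_localIdele (v : Place k) (x : v.Kvˣ) : ideleNorm (localIdele v x) = v.abs x := by
  rw [ideleNorm, finprod_eq_single _ v, localIdele_self]
  intro w hw
  rw [localIdele_of_ne hw]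
  exact w.abs_eq_one (map_one _)

variable (Fq : Type*) [Field Fq] [Finite Fq] [Algebra (RatFunc Fq) k] [FunctionField Fq k]

theorem Place.abs_mul (Fq : Type*) [Field Fq] [Finite Fq] [Algebra (RatFunc Fq) k]
    [FunctionField Fq k] (v : Place k) (x y : v.Kv) : v.abs (x * y) = v.abs x * v.abs y := by
  by_cases hx : x = 0
  · simp [hx, Place.abs]
  by_cases hy : y = 0
  · simp [hy, Place.abs]
  have hq : (v.q : ℝ) ≠ 0 := by
    have := v.one_lt_q Fq
    exact_mod_cast (by omega : v.q ≠ 0)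
  rw [v.abs_of_ne_zero hx, v.abs_of_ne_zero hy, v.abs_of_ne_zero (mul_ne_zero hx hy), map_mul,
    WithZero.log_mul (by simpa using hx) (by simpa using hy), zpow_add₀ hq]

theorem Place.abs_pos (Fq : Type*) [Field Fq] [Finite Fq] [Algebra (RatFunc Fq) k]
    [FunctionField Fq k] (v : Place k) {x : v.Kv} (hx : x ≠ 0) : 0 < v.abs x := by
  have := v.one_lt_q Fq
  rw [v.abs_of_ne_zero hx]
  have : (0 : ℝ) < v.q := by exact_mod_cast (by omega : 0 < v.q)
  positivity

theorem ideleNorm_mul (Fq : Type*) [Field Fq] [Finite Fq] [Algebra (RatFunc Fq) k]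
    [FunctionField Fq k] (a b : Idele k) : ideleNorm (a * b) = ideleNorm a * ideleNorm b := by
  rw [ideleNorm, ideleNorm, ideleNorm,
    ← finprod_mul_distrib (ideleNorm_mulSupport a) (ideleNorm_mulSupport b)]
  exact finprod_congr fun v ↦ v.abs_mul Fq _ _

theorem ideleNorm_one : ideleNorm (1 : Idele k) = 1 :=
  finprod_eq_one_of_forall_eq_one fun v ↦ v.abs_eq_one (map_one _)

theorem ideleNorm_pos (Fq : Type*) [Field Fq] [Finite Fq] [Algebra (RatFunc Fq) k]
    [FunctionField Fq k] (a : Idele k) : 0 < ideleNorm a :=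
  finprod_induction (fun x : ℝ ↦ 0 < x) one_pos (fun _ _ ↦ mul_pos)
    fun v ↦ v.abs_pos Fq (idele_ne_zero a v)

/-- The idele norm as a homomorphism. -/
def ideleNormHom : Idele k →* ℝ where
  toFun := ideleNorm
  map_one' := ideleNorm_one
  map_mul' := ideleNorm_mul Fq

theorem ideleNorm_inv (Fq : Type*) [Field Fq] [Finite Fq] [Algebra (RatFunc Fq) k]
    [FunctionField Fq k] (a : Idele k) : ideleNorm a⁻¹ = (ideleNorm a)⁻¹ := by
  refine eq_inv_of_mul_eq_one_left ?_
  rw [← ideleNorm_mul Fq, inv_mul_cancel, ideleNorm_one]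

theorem ideleNorm_pow (Fq : Type*) [Field Fq] [Finite Fq] [Algebra (RatFunc Fq) k]
    [FunctionField Fq k] (a : Idele k) (n : ℕ) : ideleNorm (a ^ n) = ideleNorm a ^ n :=
  map_pow (ideleNormHom Fq) a n

theorem ideleNorm_zpow (Fq : Type*) [Field Fq] [Finite Fq] [Algebra (RatFunc Fq) k]
    [FunctionField Fq k] (a : Idele k) (n : ℤ) : ideleNorm (a ^ n) = ideleNorm a ^ n := by
  cases n with
  | ofNat n => simpa using ideleNorm_pow Fq a n
  | negSucc n => rw [zpow_negSucc, zpow_negSucc, ideleNorm_inv Fq, ideleNorm_pow Fq]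

theorem ideleLattice_le {a b : Idele k} : ideleLattice a ≤ ideleLattice b ↔
    ∀ v : Place k, (Valued.v ((a : Adele k) v) : ℤᵐ⁰) ≤ Valued.v ((b : Adele k) v) :=
  ⟨fun h ↦ h (x := (a : Adele k)) fun _ ↦ le_rfl, fun h _ hx v ↦ (hx v).trans (h v)⟩

theorem mul_mem_ideleLattice_mul {a b : Idele k} {x : Adele k} :
    (a : Adele k) * x ∈ ideleLattice (a * b) ↔ x ∈ ideleLattice b := by
  refine forall_congr' fun v ↦ ?_
  have h1 : ((a : Adele k) * x) v = (a : Adele k) v * x v := rfl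
  have h2 : ((a * b : Idele k) : Adele k) v = (a : Adele k) v * (b : Adele k) v := rfl
  rw [h1, h2, map_mul, map_mul]
  exact mul_le_mul_iff_right₀ (zero_lt_iff.2 (valued_idele_ne_zero a v))

open Classical in
theorem exists_ideleLattice_le_le (a b : Idele k) :
    ∃ e : Idele k, ideleLattice e ≤ ideleLattice a ∧ ideleLattice e ≤ ideleLattice b := by
  let f : ∀ v : Place k, v.Kv := fun v ↦
    if (Valued.v ((a : Adele k) v) : ℤᵐ⁰) ≤ Valued.v ((b : Adele k) v) then (a : Adele k) v
    else (b : Adele k) v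
  refine ⟨ideleMk f (fun v ↦ ?_) (((idele_finite_ne_one a).union (idele_finite_ne_one b)).subset
    fun v hv ↦ ?_), ideleLattice_le.2 fun v ↦ ?_, ideleLattice_le.2 fun v ↦ ?_⟩
  · dsimp only [f]; split_ifs <;> apply idele_ne_zero
  · dsimp only [f] at hv
    rw [Set.mem_ofPred_eq] at hv
    split_ifs at hv
    · exact Or.inl hv
    · exact Or.inr hv
  · rw [ideleMk_apply]; dsimp only [f]; split_ifs with h
    · exact le_rfl
    · exact (not_le.1 h).le
  · rw [ideleMk_apply]; dsimp only [f]; split_ifs with h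
    · exact h
    · exact le_rfl

end IdeleNorm

/-! ### The index of idele lattices -/

section Index

variable {k : Type*} [Field k]

instance Place.isDiscreteValuationRing (v : Place k) : IsDiscreteValuationRing v.Ov := by
  have : IsCyclic (ℤᵐ⁰)ˣ := (isCyclic_of_surjective (WithZero.unitsWithZeroEquiv (α := Multiplicative ℤ)).symm
    (MulEquiv.surjective _))
  have : Nontrivial (MonoidWithZeroHom.valueGroup (.ofClass (Valued.v : Valuation v.Kv ℤᵐ⁰))) := by
    obtain ⟨r, hr0, hr⟩ := v.valued_surjective 1
    refine (Subgroup.nontrivial_iff_exists_ne_one _).2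
      ⟨Units.mk0 (WithZero.exp 1) WithZero.exp_ne_zero, ?_, ?_⟩
    · exact MonoidWithZeroHom.mem_valueGroup _ ⟨v.emb r, hr⟩
    · intro h
      have := congrArg Units.val h
      simp at this
  exact Valuation.valuationSubring_isDiscreteValuationRing _

theorem Place.mem_span_singleton (v : Place k) {x y : v.Ov} (hx : (x : v.Kv) ≠ 0) :
    y ∈ Ideal.span {x} ↔ (Valued.v (y : v.Kv) : ℤᵐ⁰) ≤ Valued.v (x : v.Kv) := by
  rw [Ideal.mem_span_singleton]
  constructor
  · rintro ⟨z, rfl⟩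
    have : ((x * z : v.Ov) : v.Kv) = x * z := rfl
    rw [this, map_mul]
    exact mul_le_of_le_one_right' z.2
  · intro h
    have h0 : (0 : ℤᵐ⁰) < Valued.v (x : v.Kv) := by rw [zero_lt_iff]; simpa using hx
    refine ⟨⟨(y : v.Kv) / x, ?_⟩, Subtype.ext ?_⟩
    · rw [Valuation.mem_valuationSubring_iff, map_div₀]
      exact (div_le_one₀ h0).2 h
    · change (y : v.Kv) = x * (y / x)
      field_simp

/-- The ideal generated by `x` is the n-th power of the maximal ideal, n being the order of `x`, and
each step of the filtration by these powers contributes a factor q_v. -/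
theorem Place.card_quotient_span (v : Place k) (x : v.Ov) (hx : (x : v.Kv) ≠ 0) :
    ∃ n : ℕ, WithZero.log (Valued.v (x : v.Kv) : ℤᵐ⁰) = -(n : ℤ) ∧
      Nat.card (v.Ov ⧸ Ideal.span {x}) = v.q ^ n := by
  have hvx : (Valued.v (x : v.Kv) : ℤᵐ⁰) ≠ 0 := by simpa using hx
  have hle : WithZero.log (Valued.v (x : v.Kv) : ℤᵐ⁰) ≤ 0 := by
    have h1 : (Valued.v (x : v.Kv) : ℤᵐ⁰) ≤ 1 := x.2
    rwa [← WithZero.exp_log hvx, ← WithZero.exp_zero, WithZero.exp_le_exp] at h1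
  obtain ⟨n, hn⟩ := Int.exists_eq_neg_ofNat hle
  refine ⟨n, hn, ?_⟩
  obtain ⟨r, hr0, hr⟩ := v.valued_surjective (-1)
  let π : v.Ov := ⟨v.emb r, by
    rw [Valuation.mem_valuationSubring_iff, hr, ← WithZero.exp_zero, WithZero.exp_le_exp]; norm_num⟩
  have hπ0 : (π : v.Kv) ≠ 0 := by simpa [π] using hr0
  have hmax : IsLocalRing.maximalIdeal v.Ov = Ideal.span {π} := by
    ext y
    rw [v.mem_span_singleton hπ0, ← IsLocalRing.residue_eq_zero_iff, v.residue_eq_zero_iff]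
    change _ ↔ _ ≤ Valued.v (v.emb r)
    rw [hr]
    by_cases hy : (y : v.Kv) = 0
    · simp [hy]
    · have hvy : (Valued.v (y : v.Kv) : ℤᵐ⁰) ≠ 0 := by simpa using hy
      rw [← WithZero.exp_log hvy, ← WithZero.exp_zero, WithZero.exp_lt_exp, WithZero.exp_le_exp]
      omega
  have hspan : Ideal.span {x} = IsLocalRing.maximalIdeal v.Ov ^ n := by
    rw [hmax, Ideal.span_singleton_pow]
    have hπn : ((π ^ n : v.Ov) : v.Kv) ≠ 0 := by
      change (π : v.Kv) ^ n ≠ 0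
      exact pow_ne_zero _ hπ0
    ext y
    rw [v.mem_span_singleton hπn, v.mem_span_singleton hx]
    have : (Valued.v ((π ^ n : v.Ov) : v.Kv) : ℤᵐ⁰) = Valued.v (x : v.Kv) := by
      change Valued.v ((v.emb r) ^ n) = _
      rw [map_pow, hr, ← WithZero.exp_log hvx, hn, ← WithZero.exp_nsmul]
      simp
    rw [this]
  have hne : IsLocalRing.maximalIdeal v.Ov ≠ ⊥ := IsDiscreteValuationRing.not_a_field _
  have := cardQuot_pow_of_prime (P := IsLocalRing.maximalIdeal v.Ov) hne (i := n)
  rw [hspan]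
  exact this

variable (Fq : Type*) [Field Fq] [Finite Fq] [Algebra (RatFunc Fq) k] [FunctionField Fq k]

/-- The map y ↦ y_v / a_v identifies a𝒪 / e𝒪 with 𝒪_v modulo e_v / a_v. -/
theorem relIndex_of_eq_off (Fq : Type*) [Field Fq] [Finite Fq] [Algebra (RatFunc Fq) k]
    [FunctionField Fq k] {a e : Idele k} (v : Place k)
    (hv : (Valued.v ((e : Adele k) v) : ℤᵐ⁰) ≤ Valued.v ((a : Adele k) v))
    (h : ∀ w ≠ v, (Valued.v ((e : Adele k) w) : ℤᵐ⁰) = Valued.v ((a : Adele k) w)) :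
    ((ideleLattice e).relIndex (ideleLattice a) : ℝ) * v.abs ((e : Adele k) v) =
      v.abs ((a : Adele k) v) := by
  classical
  have ha0 := idele_ne_zero a v
  have hva : (0 : ℤᵐ⁰) < Valued.v ((a : Adele k) v) := zero_lt_iff.2 (valued_idele_ne_zero a v)
  let x : v.Ov := ⟨(e : Adele k) v / (a : Adele k) v, by
    rw [Valuation.mem_valuationSubring_iff, map_div₀]; exact (div_le_one₀ hva).2 hv⟩
  have hx : (x : v.Kv) ≠ 0 := div_ne_zero (idele_ne_zero e v) ha0
  let f : ideleLattice a →+ v.Ov ⧸ Ideal.span {x} :=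
    { toFun := fun y ↦ Ideal.Quotient.mk _ ⟨(y : Adele k) v / (a : Adele k) v, by
        rw [Valuation.mem_valuationSubring_iff, map_div₀]; exact (div_le_one₀ hva).2 (y.2 v)⟩
      map_zero' := by
        rw [← map_zero (Ideal.Quotient.mk _)]
        refine congrArg _ (Subtype.ext ?_)
        exact zero_div _
      map_add' := fun y z ↦ by
        rw [← map_add]
        refine congrArg _ (Subtype.ext ?_)
        exact add_div _ _ _ }
  have hker : f.ker = (ideleLattice e).addSubgroupOf (ideleLattice a) := by
    ext y
    rw [AddMonoidHom.mem_ker, AddSubgroup.mem_addSubgroupOf]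
    change Ideal.Quotient.mk _ _ = 0 ↔ _
    rw [Ideal.Quotient.eq_zero_iff_mem, v.mem_span_singleton hx]
    change Valued.v ((y : Adele k) v / (a : Adele k) v) ≤ Valued.v ((e : Adele k) v / (a : Adele k) v) ↔ _
    rw [map_div₀, map_div₀, div_le_div_iff_of_pos_right hva]
    constructor
    · intro hy w
      by_cases hw : w = v
      · subst hw; exact hy
      · rw [h w hw]; exact y.2 w
    · intro hy; exact hy v
  have hsurj : Function.Surjective f := by
    intro z
    obtain ⟨z, rfl⟩ := Ideal.Quotient.mk_surjective z
    let y : Adele k := ⟨Pi.single v ((z : v.Kv) * (a : Adele k) v), by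
      refine (Set.finite_singleton v).subset fun w hw ↦ ?_
      by_contra hne
      refine hw ?_
      change Valued.v (Pi.single v ((z : v.Kv) * (a : Adele k) v) w) ≤ (1 : ℤᵐ⁰)
      rw [Pi.single_eq_of_ne hne, map_zero]
      exact zero_le⟩
    have hyv : y v = (z : v.Kv) * (a : Adele k) v := Pi.single_eq_same (M := fun v : Place k ↦ v.Kv) v _
    have hy : y ∈ ideleLattice a := by
      intro w
      by_cases hw : w = v
      · subst hw
        rw [hyv, map_mul]
        exact mul_le_of_le_one_left' z.2
      · have : y w = 0 := Pi.single_eq_of_ne (M := fun v : Place k ↦ v.Kv) hw _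
        rw [this, map_zero]; exact zero_le
    refine ⟨⟨y, hy⟩, congrArg (Ideal.Quotient.mk (Ideal.span {x})) (Subtype.ext ?_)⟩
    change y v / (a : Adele k) v = z
    rw [hyv]; field_simp
  have hidx : (ideleLattice e).relIndex (ideleLattice a) = Nat.card (v.Ov ⧸ Ideal.span {x}) := by
    rw [AddSubgroup.relIndex, ← hker, AddSubgroup.index_ker,
      AddMonoidHom.range_eq_top.2 hsurj]
    exact Nat.card_congr AddSubgroup.topEquiv.toEquiv
  obtain ⟨n, hn, hcard⟩ := v.card_quotient_span x hx
  have hq : (v.q : ℝ) ≠ 0 := by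
    have := v.one_lt_q Fq
    exact_mod_cast (by omega : v.q ≠ 0)
  have h1 : (e : Adele k) v = x * (a : Adele k) v := by
    change _ = (e : Adele k) v / (a : Adele k) v * (a : Adele k) v
    field_simp
  rw [hidx, hcard, h1, v.abs_mul Fq, v.abs_of_ne_zero hx, hn]
  push_cast
  rw [zpow_neg, zpow_natCast, ← mul_assoc, mul_inv_cancel₀ (pow_ne_zero _ hq), one_mul]

open Classical in
theorem relIndex_mul_ideleNorm_of_subset (Fq : Type*) [Field Fq] [Finite Fq] [Algebra (RatFunc Fq) k]
    [FunctionField Fq k] (S : Finset (Place k)) :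
    ∀ a e : Idele k, ideleLattice e ≤ ideleLattice a →
      (∀ w ∉ S, (Valued.v ((e : Adele k) w) : ℤᵐ⁰) = Valued.v ((a : Adele k) w)) →
      ((ideleLattice e).relIndex (ideleLattice a) : ℝ) * ideleNorm e = ideleNorm a := by
  induction S using Finset.induction_on with
  | empty =>
    intro a e hle h
    have h1 : ideleLattice a ≤ ideleLattice e :=
      ideleLattice_le.2 fun v ↦ (h v (Finset.notMem_empty v)).ge
    rw [le_antisymm hle h1, AddSubgroup.relIndex_self, Nat.cast_one, one_mul]
    exact ideleNorm_congr fun v ↦ h v (Finset.notMem_empty v)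
  | insert v S hvS ih =>
    intro a e hle h
    have hle' := ideleLattice_le.1 hle
    -- `c` agrees with `e` at `v` and with `a` elsewhere, so that e𝒪 ⊆ c𝒪 ⊆ a𝒪 changes one place at
    -- a time.
    let c : Idele k := a * localIdele v (Units.mk0 ((e : Adele k) v / (a : Adele k) v)
      (div_ne_zero (idele_ne_zero e v) (idele_ne_zero a v)))
    have hcv : (c : Adele k) v = (e : Adele k) v := by
      change (a : Adele k) v * (localIdele v _ : Adele k) v = _
      rw [localIdele_self]
      have := idele_ne_zero a v
      change (a : Adele k) v * ((e : Adele k) v / (a : Adele k) v) = _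
      field_simp
    have hcw : ∀ w ≠ v, (c : Adele k) w = (a : Adele k) w := by
      intro w hw
      change (a : Adele k) w * (localIdele v _ : Adele k) w = _
      rw [localIdele_of_ne hw, mul_one]
    have hec : ideleLattice e ≤ ideleLattice c := ideleLattice_le.2 fun w ↦ by
      by_cases hw : w = v
      · subst hw; rw [hcv]
      · rw [hcw w hw]; exact hle' w
    have hca : ideleLattice c ≤ ideleLattice a := ideleLattice_le.2 fun w ↦ by
      by_cases hw : w = v
      · subst hw; rw [hcv]; exact hle' w
      · rw [hcw w hw]
    have h1 := ih c e hec fun w hw ↦ by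
      by_cases hwv : w = v
      · subst hwv; rw [hcv]
      · rw [hcw w hwv]; exact h w (by simp [hwv, hw])
    have h2 := relIndex_of_eq_off Fq (a := a) (e := c) v (by rw [hcv]; exact hle' v)
      fun w hw ↦ by rw [hcw w hw]
    have h3 : ideleNorm c * v.abs ((a : Adele k) v) = ideleNorm a * v.abs ((e : Adele k) v) := by
      rw [ideleNorm_mul Fq, ideleNorm_localIdele, mul_assoc, ← v.abs_mul Fq]
      congr 2
      have := idele_ne_zero a v
      change ((e : Adele k) v / (a : Adele k) v) * (a : Adele k) v = _
      field_simp
    rw [hcv] at h2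
    have hne := (v.abs_pos Fq (idele_ne_zero e v)).ne'
    rw [← AddSubgroup.relIndex_mul_relIndex _ _ _ hec hca]
    push_cast
    apply mul_right_cancel₀ hne
    rw [← h3, ← h2, ← h1]
    ring

/-- The index of one idele lattice in another is the quotient of the norms. -/
theorem relIndex_mul_ideleNorm (Fq : Type*) [Field Fq] [Finite Fq] [Algebra (RatFunc Fq) k]
    [FunctionField Fq k] {a e : Idele k} (h : ideleLattice e ≤ ideleLattice a) :
    ((ideleLattice e).relIndex (ideleLattice a) : ℝ) * ideleNorm e = ideleNorm a := by
  refine relIndex_mul_ideleNorm_of_subset Fq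
    ((idele_finite_ne_one a).union (idele_finite_ne_one e)).toFinset a e h fun w hw ↦ ?_
  simp only [Set.Finite.mem_toFinset, Set.mem_union, Set.mem_ofPred_eq, not_or, not_not] at hw
  rw [hw.1, hw.2]

theorem relIndex_ne_zero (Fq : Type*) [Field Fq] [Finite Fq] [Algebra (RatFunc Fq) k]
    [FunctionField Fq k] {a e : Idele k} (h : ideleLattice e ≤ ideleLattice a) :
    (ideleLattice e).relIndex (ideleLattice a) ≠ 0 := by
  intro h0
  have := relIndex_mul_ideleNorm Fq h
  rw [h0, Nat.cast_zero, zero_mul] at this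
  exact (ideleNorm_pos Fq a).ne this

theorem ideleNorm_le_of_le (Fq : Type*) [Field Fq] [Finite Fq] [Algebra (RatFunc Fq) k]
    [FunctionField Fq k] {a e : Idele k} (h : ideleLattice e ≤ ideleLattice a) :
    ideleNorm e ≤ ideleNorm a := by
  rw [← relIndex_mul_ideleNorm Fq h]
  have h1 : (1 : ℝ) ≤ (ideleLattice e).relIndex (ideleLattice a) := by
    exact_mod_cast Nat.one_le_iff_ne_zero.2 (relIndex_ne_zero Fq h)
  nlinarith [ideleNorm_pos Fq e]

end Index

/-! ### Global sections, Riemann's inequality and the product formula -/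

section RiemannInequality

variable {k : Type*} [Field k]
variable (Fq : Type*) [Field Fq] [Finite Fq] [Algebra (RatFunc Fq) k] [FunctionField Fq k]

/-- The elements of `k` lying in the lattice `a 𝒪`. -/
def globalSections (a : Idele k) : AddSubgroup k :=
  (ideleLattice a).comap (diag Fq k : k →+ Adele k)

theorem mem_globalSections {a : Idele k} {r : k} :
    r ∈ globalSections Fq a ↔ diag Fq k r ∈ ideleLattice a := Iff.rfl

/-- The principal idele attached to an element of `kˣ`. -/
def principalIdele : kˣ →* Idele k := Units.map (diag Fq k : k →* Adele k)

theorem coe_principalIdele (r : kˣ) : (principalIdele Fq r : Adele k) = diag Fq k (r : k) := rfl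

/-- Up to finite index the sections lie in a sublattice contained in 𝒪, whose rational elements have
no poles and are therefore finite in number. -/
instance finite_globalSections (a : Idele k) : Finite (globalSections Fq a) := by
  obtain ⟨e, hea, he1⟩ := exists_ideleLattice_le_le a 1
  have hfin : (globalSections Fq e : Set k).Finite := by
    refine (finite_constants Fq (k := k)).2.subset fun x hx v ↦ ?_
    have h1 := he1 hx v
    change Valued.v (v.emb x) ≤ Valued.v (1 : v.Kv) at h1
    rwa [Place.valued_emb, map_one] at h1
  have hle : globalSections Fq e ≤ globalSections Fq a := fun x hx ↦ hea hx
  have hindex : (globalSections Fq e).relIndex (globalSections Fq a) ≠ 0 := by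
    intro h0
    have h1 := (ideleLattice e).relIndex_comap (diag Fq k : k →+ Adele k) (globalSections Fq a)
    have h2 : (ideleLattice e).relIndex ((globalSections Fq a).map (diag Fq k : k →+ Adele k)) ≠ 0 := by
      intro h
      refine relIndex_ne_zero Fq hea (AddSubgroup.relIndex_eq_zero_of_le_right ?_ h)
      rintro _ ⟨x, hx, rfl⟩
      exact hx
    exact h2 (h1.symm.trans h0)
  have : Finite ((globalSections Fq e).addSubgroupOf (globalSections Fq a)) := by
    have := hfin.to_subtype
    exact Finite.of_injective (fun x ↦ (⟨x.1.1, x.2⟩ : (globalSections Fq e : Set k)))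
      fun x y h ↦ Subtype.ext (Subtype.ext (congrArg (fun z ↦ z.1) h))
  have : Finite (globalSections Fq a ⧸ (globalSections Fq e).addSubgroupOf (globalSections Fq a)) :=
    @AddSubgroup.finite_quotient_of_finiteIndex _ _ _ ⟨hindex⟩
  exact Finite.of_addSubgroup_quotient ((globalSections Fq e).addSubgroupOf (globalSections Fq a))

/-- Riemann's inequality. -/
theorem ideleNorm_le_card_mul {b : Idele k}
    (hb : ∀ α : Adele k, ∃ r : k, α - diag Fq k r ∈ ideleLattice b) (a : Idele k) :
    ideleNorm a ≤ Nat.card (globalSections Fq a) * ideleNorm b := by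
  classical
  obtain ⟨e, hea, heb⟩ := exists_ideleLattice_le_le a b
  choose r hr using hb
  let Ea := (ideleLattice e).addSubgroupOf (ideleLattice a)
  let Eb := (ideleLattice e).addSubgroupOf (ideleLattice b)
  have : Finite (ideleLattice a ⧸ Ea) :=
    @AddSubgroup.finite_quotient_of_finiteIndex _ _ _ ⟨relIndex_ne_zero Fq hea⟩
  have : Finite (ideleLattice b ⧸ Eb) :=
    @AddSubgroup.finite_quotient_of_finiteIndex _ _ _ ⟨relIndex_ne_zero Fq heb⟩
  let rep : ideleLattice a ⧸ Ea → Adele k := fun y ↦ (y.out : Adele k)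
  let m : ideleLattice a ⧸ Ea → ideleLattice b := fun y ↦ ⟨rep y - diag Fq k (r (rep y)), hr _⟩
  let f : ideleLattice a ⧸ Ea → ideleLattice b ⧸ Eb := fun y ↦ QuotientAddGroup.mk (m y)
  have hf : ∀ y z, f y = f z → (m y : Adele k) - m z ∈ ideleLattice e := by
    intro y z h
    have h1 := QuotientAddGroup.eq.1 h.symm
    have h2 : ((-m z + m y : ideleLattice b) : Adele k) ∈ ideleLattice e := h1
    have h3 : ((-m z + m y : ideleLattice b) : Adele k) = m y - m z := by push_cast; ring
    rwa [h3] at h2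
  -- Elements of a𝒪 / e𝒪 with the same image in b𝒪 / e𝒪 have rational parts differing by a global
  -- section of `a`; a base point in each fibre of `f` turns this into an injection into the
  -- product.
  let base : ideleLattice a ⧸ Ea → ideleLattice a ⧸ Ea := fun y ↦ (⟨y, rfl⟩ : ∃ z, f z = f y).choose
  have hbase : ∀ y, f (base y) = f y := fun y ↦ (⟨y, rfl⟩ : ∃ z, f z = f y).choose_spec
  have hbase' : ∀ y z, f y = f z → base y = base z := by
    intro y z h
    simp only [base, h]
  have hmem : ∀ y, r (rep y) - r (rep (base y)) ∈ globalSections Fq a := by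
    intro y
    rw [mem_globalSections, map_sub]
    have h1 : diag Fq k (r (rep y)) - diag Fq k (r (rep (base y))) =
        (rep y - rep (base y)) - ((m y : Adele k) - m (base y)) := by
      simp only [m]; ring
    rw [h1]
    exact sub_mem (sub_mem y.out.2 (base y).out.2) (hea (hf _ _ (hbase y).symm))
  let F : ideleLattice a ⧸ Ea → (ideleLattice b ⧸ Eb) × globalSections Fq a :=
    fun y ↦ (f y, ⟨_, hmem y⟩)
  have hF : Function.Injective F := by
    intro y z h
    have h1 : f y = f z := congrArg Prod.fst h
    have h2 : r (rep y) - r (rep (base y)) = r (rep z) - r (rep (base z)) :=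
      congrArg (fun p ↦ (p.2 : k)) h
    rw [hbase' y z h1, sub_left_inj] at h2
    have h3 := hf y z h1
    have h4 : (m y : Adele k) - m z = rep y - rep z := by simp only [m, h2]; ring
    rw [h4] at h3
    rw [← QuotientAddGroup.out_eq' y, ← QuotientAddGroup.out_eq' z, eq_comm, QuotientAddGroup.eq]
    change ((-z.out + y.out : ideleLattice a) : Adele k) ∈ ideleLattice e
    have h5 : ((-z.out + y.out : ideleLattice a) : Adele k) = rep y - rep z := by
      push_cast; simp only [rep]; ring
    rwa [h5]
  have hcard := Nat.card_le_card_of_injective F hF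
  rw [Nat.card_prod] at hcard
  have ha := relIndex_mul_ideleNorm Fq hea
  have hb := relIndex_mul_ideleNorm Fq heb
  have hcard' : ((ideleLattice e).relIndex (ideleLattice a) : ℝ) ≤
      (ideleLattice e).relIndex (ideleLattice b) * Nat.card (globalSections Fq a) := by
    exact_mod_cast hcard
  rw [← ha, ← hb]
  have := ideleNorm_pos Fq e
  nlinarith

theorem card_globalSections_principalIdele_mul (r : kˣ) (a : Idele k) :
    Nat.card (globalSections Fq (principalIdele Fq r * a)) = Nat.card (globalSections Fq a) := by
  refine Nat.card_congr ⟨fun x ↦ ⟨(r⁻¹ : kˣ) * x.1, ?_⟩, fun x ↦ ⟨r * x.1, ?_⟩, fun x ↦ ?_, fun x ↦ ?_⟩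
  · have h := x.2
    rw [mem_globalSections] at h ⊢
    rw [← mul_mem_ideleLattice_mul (a := principalIdele Fq r), coe_principalIdele, ← map_mul,
      Units.mul_inv_cancel_left]
    exact h
  · have h := x.2
    rw [mem_globalSections] at h ⊢
    rw [map_mul, ← coe_principalIdele, mul_mem_ideleLattice_mul]
    exact h
  · exact Subtype.ext (by simp)
  · exact Subtype.ext (by simp)

/-- The product formula. -/
theorem ideleNorm_principalIdele (r : kˣ) : ideleNorm (principalIdele Fq r) = 1 := by
  obtain ⟨b, hb⟩ := exists_forall_sub_diag_mem k Fq
  have key : ∀ r : kˣ, ideleNorm (principalIdele Fq r) ≤ 1 := by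
    intro r
    by_contra hr
    push Not at hr
    -- Multiplication by rⁿ preserves the number of sections, which would contradict Riemann's
    -- inequality if the norms of the powers were unbounded.
    obtain ⟨n, hn⟩ := pow_unbounded_of_one_lt
      (Nat.card (globalSections Fq (1 : Idele k)) * ideleNorm b) hr
    have h1 := ideleNorm_le_card_mul Fq hb (principalIdele Fq (r ^ n) * 1)
    rw [card_globalSections_principalIdele_mul, mul_one, map_pow, ideleNorm_pow Fq] at h1
    linarith
  refine le_antisymm (key r) ?_
  have h1 := key r⁻¹
  rw [map_inv, ideleNorm_inv Fq] at h1
  exact (inv_le_one₀ (ideleNorm_pos Fq _)).1 h1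

/-- The lattice of the principal idele of `r`, of norm 1 by the product formula, is contained in a𝒪.
-/
theorem one_le_ideleNorm_of_mem {a : Idele k} {r : k} (hr : r ≠ 0)
    (h : r ∈ globalSections Fq a) : 1 ≤ ideleNorm a := by
  rw [← ideleNorm_principalIdele Fq (Units.mk0 r hr)]
  exact ideleNorm_le_of_le Fq (ideleLattice_le.2 h)

theorem globalSections_eq_bot {a : Idele k} (h : ideleNorm a < 1) : globalSections Fq a = ⊥ := by
  rw [eq_bot_iff]
  intro r hr
  by_contra h0
  exact absurd (one_le_ideleNorm_of_mem Fq h0 hr) (not_le.2 h)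

theorem exists_mem_globalSections_ne_zero {b : Idele k}
    (hb : ∀ α : Adele k, ∃ r : k, α - diag Fq k r ∈ ideleLattice b) {a : Idele k}
    (h : ideleNorm b < ideleNorm a) : ∃ r ∈ globalSections Fq a, r ≠ 0 := by
  by_contra! hall
  have h1 := ideleNorm_le_card_mul Fq hb a
  have h2 : globalSections Fq a = ⊥ := eq_bot_iff.2 hall
  rw [h2] at h1
  simp at h1
  linarith

/-- By Riemann's inequality a b⁻¹ has a nonzero section r. Multiplying 𝔸 = k + b𝒪 by r gives 𝔸 = k +
rb𝒪, and rb𝒪 ⊆ a𝒪. -/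
theorem exists_sub_diag_mem_of_lt {b : Idele k}
    (hb : ∀ α : Adele k, ∃ r : k, α - diag Fq k r ∈ ideleLattice b) {a : Idele k}
    (h : ideleNorm b ^ 2 < ideleNorm a) (α : Adele k) :
    ∃ r : k, α - diag Fq k r ∈ ideleLattice a := by
  have hbp := ideleNorm_pos Fq b
  obtain ⟨r, hr, hr0⟩ := exists_mem_globalSections_ne_zero Fq hb (a := a * b⁻¹) (by
    rw [ideleNorm_mul Fq, ideleNorm_inv Fq, ← div_eq_mul_inv, lt_div_iff₀ hbp]
    nlinarith)
  let u := principalIdele Fq (Units.mk0 r hr0)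
  obtain ⟨s, hs⟩ := hb ((u⁻¹ : Idele k) * α)
  refine ⟨r * s, ?_⟩
  have hle : ideleLattice (u * b) ≤ ideleLattice a := by
    have h1 : a = b * (a * b⁻¹) := by rw [mul_left_comm, mul_inv_cancel, mul_one]
    rw [mul_comm u b]
    conv_rhs => rw [h1]
    exact ideleLattice_le.2 (mul_mem_ideleLattice_mul.2 hr)
  apply hle
  have : α - diag Fq k (r * s) = u * ((u⁻¹ : Idele k) * α - diag Fq k s) := by
    rw [mul_sub, Units.mul_inv_cancel_left, map_mul]; rfl
  rw [this, mul_mem_ideleLattice_mul]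
  exact hs

end RiemannInequality

/-! ### Bounds for sections and cosets, and finiteness of idele classes -/

section ClassGroup

variable {k : Type*} [Field k]
variable (Fq : Type*) [Field Fq] [Finite Fq] [Algebra (RatFunc Fq) k] [FunctionField Fq k]

theorem valued_ideleMul (a b : Idele k) (v : Place k) :
    (Valued.v (((a * b : Idele k) : Adele k) v) : ℤᵐ⁰) =
      Valued.v ((a : Adele k) v) * Valued.v ((b : Adele k) v) :=
  map_mul _ _ _

theorem valued_ideleInv (a : Idele k) (v : Place k) :
    (Valued.v (((a⁻¹ : Idele k) : Adele k) v) : ℤᵐ⁰) = (Valued.v ((a : Adele k) v))⁻¹ := by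
  rw [idele_inv_apply, map_inv₀]

theorem ideleLattice_mul_le_mul {a b : Idele k} (c : Idele k) :
    ideleLattice (c * a) ≤ ideleLattice (c * b) ↔ ideleLattice a ≤ ideleLattice b := by
  rw [ideleLattice_le, ideleLattice_le]
  refine forall_congr' fun v ↦ ?_
  rw [valued_ideleMul, valued_ideleMul]
  exact mul_le_mul_iff_right₀ (zero_lt_iff.2 (valued_idele_ne_zero c v))

theorem ideleLattice_mul_congr {a b : Idele k} (c : Idele k)
    (h : ideleLattice a = ideleLattice b) : ideleLattice (c * a) = ideleLattice (c * b) :=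
  le_antisymm ((ideleLattice_mul_le_mul c).2 h.le) ((ideleLattice_mul_le_mul c).2 h.ge)

variable (k) in
/-- There is an integral idele of norm less than one. -/
theorem exists_uniformizer_idele (Fq : Type*) [Field Fq] [Finite Fq] [Algebra (RatFunc Fq) k]
    [FunctionField Fq k] :
    ∃ ϖ : Idele k, ideleNorm ϖ < 1 ∧ ideleLattice ϖ ≤ ideleLattice 1 := by
  obtain ⟨v⟩ := (finite_constants Fq (k := k)).1
  obtain ⟨r, hr0, hr⟩ := v.valued_surjective (-1)
  have hr0' : v.emb r ≠ 0 := by simpa using hr0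
  refine ⟨localIdele v (Units.mk0 (v.emb r) hr0'), ?_, ideleLattice_le.2 fun w ↦ ?_⟩
  · rw [ideleNorm_localIdele, Units.val_mk0, v.abs_of_ne_zero hr0', hr, WithZero.log_exp, zpow_neg,
      zpow_one]
    exact inv_lt_one_of_one_lt₀ (by exact_mod_cast v.one_lt_q Fq)
  · by_cases hw : w = v
    · subst hw
      rw [localIdele_self, Units.val_mk0, hr]
      change _ ≤ Valued.v (1 : w.Kv)
      rw [map_one, ← WithZero.exp_zero, WithZero.exp_le_exp]; norm_num
    · rw [localIdele_of_ne hw]; exact le_rfl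

theorem ideleLattice_mul_pow_le (a : Idele k) {ϖ : Idele k} (hϖ : ideleLattice ϖ ≤ ideleLattice 1)
    (n : ℕ) : ideleLattice (a * ϖ ^ n) ≤ ideleLattice a := by
  induction n with
  | zero => rw [pow_zero, mul_one]
  | succ n ih =>
    refine le_trans ?_ ih
    rw [pow_succ, ← mul_assoc]
    conv_rhs => rw [← mul_one (a * ϖ ^ n)]
    exact (ideleLattice_mul_le_mul _).2 hϖ

/-- The sections of `a` inject into a𝒪 / e𝒪. -/
theorem card_globalSections_le_relIndex {a e : Idele k} (h : ideleLattice e ≤ ideleLattice a)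
    (he : globalSections Fq e = ⊥) :
    Nat.card (globalSections Fq a) ≤ (ideleLattice e).relIndex (ideleLattice a) := by
  have h1 := (ideleLattice e).relIndex_comap (diag Fq k : k →+ Adele k) (globalSections Fq a)
  change (globalSections Fq e).relIndex _ = _ at h1
  rw [he, AddSubgroup.relIndex_bot_left] at h1
  rw [h1]
  refine AddSubgroup.relIndex_le_of_le_right ?_ (relIndex_ne_zero Fq h)
  rintro _ ⟨x, hx, rfl⟩
  exact hx

variable (k) in
/-- The number of global sections is bounded in terms of the norm. -/
theorem exists_card_globalSections_le :
    ∃ C : ℝ, 0 < C ∧ ∀ a : Idele k, (Nat.card (globalSections Fq a) : ℝ) ≤ C * max 1 (ideleNorm a) := by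
  obtain ⟨ϖ, hϖ1, hϖ⟩ := exists_uniformizer_idele k Fq
  have hϖ0 := ideleNorm_pos Fq ϖ
  have hq : 1 < (ideleNorm ϖ)⁻¹ := (one_lt_inv₀ hϖ0).2 hϖ1
  refine ⟨(ideleNorm ϖ)⁻¹, by positivity, fun a ↦ ?_⟩
  by_cases ha : ideleNorm a < 1
  · rw [globalSections_eq_bot Fq ha, max_eq_left ha.le]
    simpa using hq.le
  · push Not at ha
    -- The first power of `ϖ` bringing the norm below 1 kills all sections, so their number is at
    -- most the index, |ϖ|⁻¹ raised to n + 1.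
    obtain ⟨n, hn1, hn2⟩ := exists_nat_pow_near ha hq
    have hle := ideleLattice_mul_pow_le a hϖ (n + 1)
    have hpos : 0 < ideleNorm ϖ ^ (n + 1) := by positivity
    have hnorm : ideleNorm (a * ϖ ^ (n + 1)) = ideleNorm a * ideleNorm ϖ ^ (n + 1) := by
      rw [ideleNorm_mul Fq, ideleNorm_pow Fq]
    have hbot : globalSections Fq (a * ϖ ^ (n + 1)) = ⊥ := by
      refine globalSections_eq_bot Fq ?_
      rw [hnorm]
      rw [inv_pow, ← one_div] at hn2
      exact (lt_div_iff₀ hpos).1 hn2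
    have h1 : (Nat.card (globalSections Fq a) : ℝ) ≤
        (ideleLattice (a * ϖ ^ (n + 1))).relIndex (ideleLattice a) := by
      exact_mod_cast card_globalSections_le_relIndex Fq hle hbot
    have h2 := relIndex_mul_ideleNorm Fq hle
    rw [hnorm] at h2
    have h3 : ((ideleLattice (a * ϖ ^ (n + 1))).relIndex (ideleLattice a) : ℝ) =
        (ideleNorm ϖ)⁻¹ ^ (n + 1) := by
      have ha0 := (ideleNorm_pos Fq a).ne'
      rw [inv_pow]
      refine eq_inv_of_mul_eq_one_left ?_
      apply mul_left_cancel₀ ha0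
      linarith
    rw [max_eq_right ha]
    refine h1.trans ?_
    rw [h3, pow_succ']
    exact mul_le_mul_of_nonneg_left hn1 (by positivity)

/-- The lattice `k + a 𝒪`. -/
def diagLattice (a : Idele k) : AddSubgroup (Adele k) :=
  (diag Fq k : k →+ Adele k).range ⊔ ideleLattice a

theorem mem_diagLattice {a : Idele k} {x : Adele k} :
    x ∈ diagLattice Fq a ↔ ∃ r : k, x - diag Fq k r ∈ ideleLattice a := by
  rw [diagLattice, AddSubgroup.mem_sup]
  constructor
  · rintro ⟨_, ⟨r, rfl⟩, z, hz, rfl⟩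
    exact ⟨r, by simpa using hz⟩
  · rintro ⟨r, hr⟩
    exact ⟨_, ⟨r, rfl⟩, _, hr, by simp⟩

variable (k) in
-- If |a| is large, then k + a𝒪 = 𝔸. Otherwise a is divided by the least power of ϖ giving an idele
-- c with this property; the index is then at most [c𝒪 : a𝒪] = |c| / |a|, and |c| is bounded.
theorem exists_index_diagLattice_le :
    ∃ C : ℝ, 0 < C ∧ ∀ a : Idele k, (diagLattice Fq a).index ≠ 0 ∧
      ((diagLattice Fq a).index : ℝ) ≤ max 1 (C / ideleNorm a) := by
  obtain ⟨b, hb⟩ := exists_forall_sub_diag_mem k Fq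
  obtain ⟨ϖ, hϖ1, hϖ⟩ := exists_uniformizer_idele k Fq
  have hϖ0 := ideleNorm_pos Fq ϖ
  have hb0 := ideleNorm_pos Fq b
  have hq : 1 < (ideleNorm ϖ)⁻¹ := (one_lt_inv₀ hϖ0).2 hϖ1
  refine ⟨(ideleNorm ϖ)⁻¹ * ideleNorm b ^ 2, by positivity, fun a ↦ ?_⟩
  have ha0 := ideleNorm_pos Fq a
  have htop : ∀ c : Idele k, ideleNorm b ^ 2 < ideleNorm c → diagLattice Fq c = ⊤ := by
    intro c hc
    rw [eq_top_iff]
    intro x _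
    exact (mem_diagLattice Fq).2 (exists_sub_diag_mem_of_lt Fq hb hc x)
  by_cases hlt : ideleNorm b ^ 2 < ideleNorm a
  · rw [htop a hlt]
    simp
  · push Not at hlt
    obtain ⟨n, hn1, hn2⟩ := exists_nat_pow_near ((one_le_div ha0).2 hlt) hq
    let c := a * (ϖ ^ (n + 1))⁻¹
    have hac : a = c * ϖ ^ (n + 1) := by simp [c]
    have hle : ideleLattice a ≤ ideleLattice c := by
      conv_lhs => rw [hac]
      exact ideleLattice_mul_pow_le c hϖ (n + 1)
    have hnorm : ideleNorm c = ideleNorm a * (ideleNorm ϖ)⁻¹ ^ (n + 1) := by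
      rw [ideleNorm_mul Fq, ideleNorm_inv Fq, ideleNorm_pow Fq, inv_pow]
    have hctop : diagLattice Fq c = ⊤ := by
      refine htop c ?_
      rw [hnorm]
      have := (div_lt_iff₀ ha0).1 hn2
      linarith
    have hsup : ideleLattice c ⊔ diagLattice Fq a = ⊤ := by
      rw [eq_top_iff, ← hctop]
      exact sup_le (le_sup_left.trans le_sup_right) le_sup_left
    have h1 : (diagLattice Fq a).index = (diagLattice Fq a).relIndex (ideleLattice c) := by
      rw [← AddSubgroup.relIndex_top_right, ← hsup, AddSubgroup.relIndex_sup_right]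
    have hne := relIndex_ne_zero Fq hle
    have h2 : (diagLattice Fq a).relIndex (ideleLattice c) ≤
        (ideleLattice a).relIndex (ideleLattice c) :=
      AddSubgroup.relIndex_le_of_le_left le_sup_right hne
    have h3 := relIndex_mul_ideleNorm Fq hle
    have h4 : ((ideleLattice a).relIndex (ideleLattice c) : ℝ) = (ideleNorm ϖ)⁻¹ ^ (n + 1) := by
      apply mul_right_cancel₀ ha0.ne'
      rw [h3, hnorm, mul_comm]
    refine ⟨?_, ?_⟩
    · rw [h1]
      intro h0
      exact hne (by
        have : (diagLattice Fq a).relIndex (ideleLattice c) ∣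
            (ideleLattice a).relIndex (ideleLattice c) :=
          AddSubgroup.relIndex_dvd_of_le_left (ideleLattice c) le_sup_right
        rw [h0] at this
        exact zero_dvd_iff.1 this)
    · refine le_trans ?_ (le_max_right _ _)
      calc ((diagLattice Fq a).index : ℝ) ≤ (ideleLattice a).relIndex (ideleLattice c) := by
            rw [h1]; exact_mod_cast h2
        _ = (ideleNorm ϖ)⁻¹ ^ (n + 1) := h4
        _ ≤ _ := by
          rw [pow_succ', mul_div_assoc]
          exact mul_le_mul_of_nonneg_left hn1 (by positivity)

/-- There are finitely many lattices containing `𝒪` and of bounded norm. -/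
theorem exists_finset_ideleLattice_eq (Fq : Type*) [Field Fq] [Finite Fq] [Algebra (RatFunc Fq) k]
    [FunctionField Fq k] (B : ℝ) : ∃ E : Set (Idele k), E.Finite ∧
    ∀ a : Idele k, ideleLattice 1 ≤ ideleLattice a → ideleNorm a ≤ B →
      ∃ e ∈ E, ideleLattice a = ideleLattice e := by
  classical
  -- When a𝒪 ⊇ 𝒪 every local factor of |a| is at least 1, hence at most `N`. This restricts both the
  -- places where `a` is not a unit and the exponents there.
  obtain ⟨N, hN⟩ := exists_nat_ge B
  let S := (Place.finite_q_le Fq k N).toFinset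
  choose t ht0 ht using fun v : Place k ↦ v.valued_surjective 1
  let e : (Place k →₀ ℕ) → Idele k := fun n ↦ ideleMk (fun v ↦ v.emb (t v) ^ n v)
    (fun v ↦ pow_ne_zero _ (by simpa using ht0 v)) (n.support.finite_toSet.subset fun v hv ↦ by
      by_contra h
      simp only [Finset.mem_coe, Finsupp.mem_support_iff, not_not] at h
      exact hv (by rw [h, pow_zero, map_one]))
  have hev : ∀ n v, (Valued.v ((e n : Adele k) v) : ℤᵐ⁰) = WithZero.exp (n v : ℤ) := by
    intro n v
    change Valued.v (v.emb (t v) ^ n v) = _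
    rw [map_pow, ht, ← WithZero.exp_nsmul]; simp
  refine ⟨e '' Set.Iic (∑ v ∈ S, Finsupp.single v N), (Set.finite_Iic _).image e, fun a ha hB ↦ ?_⟩
  have hva : ∀ v : Place k, ∃ n : ℕ, (Valued.v ((a : Adele k) v) : ℤᵐ⁰) = WithZero.exp (n : ℤ) := by
    intro v
    have h1 := ideleLattice_le.1 ha v
    change Valued.v (1 : v.Kv) ≤ _ at h1
    rw [map_one, ← WithZero.exp_log (valued_idele_ne_zero a v), ← WithZero.exp_zero,
      WithZero.exp_le_exp] at h1
    obtain ⟨n, hn⟩ := Int.eq_ofNat_of_zero_le h1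
    exact ⟨n, by rw [← hn, WithZero.exp_log (valued_idele_ne_zero a v)]⟩
  choose n hn using hva
  have hbound : ∀ v : Place k, v.q ^ n v ≤ N := by
    intro v
    have h1 : ideleLattice (localIdele v (Units.mk0 _ (idele_ne_zero a v))) ≤ ideleLattice a :=
      ideleLattice_le.2 fun w ↦ by
        by_cases hw : w = v
        · subst hw; rw [localIdele_self, Units.val_mk0]
        · rw [localIdele_of_ne hw]; exact ideleLattice_le.1 ha w
    have h2 := ideleNorm_le_of_le Fq h1
    rw [ideleNorm_localIdele, Units.val_mk0, v.abs_of_ne_zero (idele_ne_zero a v), hn,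
      WithZero.log_exp, zpow_natCast] at h2
    exact_mod_cast (h2.trans hB).trans hN
  have hnN : ∀ v, n v ≤ N := fun v ↦
    (Nat.lt_pow_self (v.one_lt_q Fq)).le.trans (hbound v)
  have hsupp : ∀ v, n v ≠ 0 → v ∈ S := by
    intro v hv
    simp only [S, Set.Finite.mem_toFinset, Set.mem_ofPred_eq]
    exact (Nat.le_self_pow hv _).trans (hbound v)
  refine ⟨e (Finsupp.onFinset S n hsupp), ⟨_, ?_, rfl⟩, ?_⟩
  · intro v
    rw [Finsupp.onFinset_apply, Finsupp.finsetSum_apply]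
    by_cases hv : v ∈ S
    · rw [Finset.sum_eq_single v (fun w _ hw ↦ by simp [hw]) (fun h ↦ absurd hv h)]
      simpa using hnN v
    · have : n v = 0 := by_contra fun h ↦ hv (hsupp v h)
      simp [this]
  · have h1 : ∀ v, (Valued.v ((a : Adele k) v) : ℤᵐ⁰) =
        Valued.v ((e (Finsupp.onFinset S n hsupp) : Adele k) v) := fun v ↦ by
      rw [hev, hn, Finsupp.onFinset_apply]
    exact le_antisymm (ideleLattice_le.2 fun v ↦ (h1 v).le) (ideleLattice_le.2 fun v ↦ (h1 v).ge)

/-- Finiteness of the class group of degree zero, in terms of representatives for all idele classes. -/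
theorem exists_class_representatives {ϖ : Idele k} (hϖ1 : ideleNorm ϖ < 1) :
    ∃ E : Set (Idele k), E.Finite ∧ ∀ a : Idele k, ∃ r : kˣ, ∃ m : ℤ, ∃ e ∈ E,
      ideleLattice a = ideleLattice (principalIdele Fq r * (ϖ ^ m * e)) := by
  obtain ⟨b, hb⟩ := exists_forall_sub_diag_mem k Fq
  have hϖ0 := ideleNorm_pos Fq ϖ
  have hb0 := ideleNorm_pos Fq b
  have hq : 1 < (ideleNorm ϖ)⁻¹ := (one_lt_inv₀ hϖ0).2 hϖ1
  obtain ⟨E, hE, hE'⟩ := exists_finset_ideleLattice_eq Fq (k := k) ((ideleNorm ϖ)⁻¹ * ideleNorm b)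
  refine ⟨E, hE, fun a ↦ ?_⟩
  have ha0 := ideleNorm_pos Fq a
  -- `m` is such that |b| < |a ϖ^m| ≤ |ϖ|⁻¹ |b|. The left inequality produces a section r, so that
  -- r⁻¹ a ϖ^m 𝒪 contains 𝒪; the right one bounds the norm.
  obtain ⟨m, hm1, hm2⟩ := exists_mem_Ioc_zpow (div_pos ha0 hb0) hq
  have hnorm : ideleNorm (a * ϖ ^ m) = ideleNorm a * ideleNorm ϖ ^ m := by
    rw [ideleNorm_mul Fq, ideleNorm_zpow Fq]
  have hϖm : 0 < ideleNorm ϖ ^ m := zpow_pos hϖ0 m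
  obtain ⟨r, hr, hr0⟩ := exists_mem_globalSections_ne_zero Fq hb (a := a * ϖ ^ m) (by
    rw [hnorm]
    rw [inv_zpow, lt_div_iff₀ hb0, inv_mul_lt_iff₀ hϖm] at hm1
    linarith)
  let u := principalIdele Fq (Units.mk0 r hr0)
  obtain ⟨e, heE, he⟩ := hE' (u⁻¹ * (a * ϖ ^ m)) (by
    rw [← ideleLattice_mul_le_mul u, mul_inv_cancel_left, mul_one]
    exact ideleLattice_le.2 hr) (by
    rw [ideleNorm_mul Fq, ideleNorm_inv Fq, ideleNorm_principalIdele, inv_one, one_mul, hnorm]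
    rw [inv_zpow, zpow_add_one₀ hϖ0.ne', mul_inv, div_le_iff₀ hb0] at hm2
    calc ideleNorm a * ideleNorm ϖ ^ m
        ≤ ((ideleNorm ϖ ^ m)⁻¹ * (ideleNorm ϖ)⁻¹ * ideleNorm b) * ideleNorm ϖ ^ m :=
          mul_le_mul_of_nonneg_right hm2 hϖm.le
      _ = _ := by field_simp)
  refine ⟨Units.mk0 r hr0, -m, e, heE, ?_⟩
  have h1 := ideleLattice_mul_congr (u * ϖ ^ (-m)) he
  have h2 : u * ϖ ^ (-m) * (u⁻¹ * (a * ϖ ^ m)) = a := by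
    rw [zpow_neg, mul_comm a, mul_assoc, mul_left_comm _ u⁻¹, inv_mul_cancel_left,
      mul_inv_cancel_left]
  rw [h2, mul_assoc] at h1
  exact h1

end ClassGroup

/-! ### Lower triangular matrices -/

section LowerTriangular

variable {R : Type*} [CommRing R]

/-- The lower triangular matrix `(a 0; c d)`. -/
def lowerGL (a d : ringUnits R) (c : R) : GL (Fin 2) R where
  val := !![(a : R), 0; c, d]
  inv := !![((a⁻¹ : ringUnits R) : R), 0; -((a⁻¹ : ringUnits R) * c * (d⁻¹ : ringUnits R)),
    ((d⁻¹ : ringUnits R) : R)]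
  val_inv := by
    ext i j
    fin_cases i <;> fin_cases j <;> simp [Matrix.mul_apply, Fin.sum_univ_two]
    linear_combination (-(a⁻¹ : ringUnits R) * c) * d.mul_inv
  inv_val := by
    ext i j
    fin_cases i <;> fin_cases j <;> simp [Matrix.mul_apply, Fin.sum_univ_two]
    linear_combination (-(d⁻¹ : ringUnits R) * c) * a.mul_inv

/-- The matrix `(a b; c d)` of determinant one. -/
def specialGL (a b c d : R) (h : a * d - b * c = 1) : GL (Fin 2) R where
  val := !![a, b; c, d]
  inv := !![d, -b; -c, a]
  val_inv := by
    ext i j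
    fin_cases i <;> fin_cases j <;> simp [Matrix.mul_apply, Fin.sum_univ_two]
    exacts [by linear_combination h, by ring, by ring, by linear_combination h]
  inv_val := by
    ext i j
    fin_cases i <;> fin_cases j <;> simp [Matrix.mul_apply, Fin.sum_univ_two]
    exacts [by linear_combination h, by ring, by ring, by linear_combination h]

theorem coe_lowerGL (a d : ringUnits R) (c : R) :
    (lowerGL a d c : Matrix (Fin 2) (Fin 2) R) = !![(a : R), 0; c, d] := rfl

theorem lowerGL_mul (a d a' d' : ringUnits R) (c c' : R) :
    lowerGL a d c * lowerGL a' d' c' = lowerGL (a * a') (d * d') (c * a' + d * c') := by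
  ext i j
  fin_cases i <;> fin_cases j <;> simp [Matrix.mul_apply, Fin.sum_univ_two, coe_lowerGL]

theorem det_lowerGL (a d : ringUnits R) (c : R) :
    Matrix.GeneralLinearGroup.det (lowerGL a d c) = a * d := by
  ext
  simp [coe_lowerGL, Matrix.det_fin_two]

theorem exists_lowerGL_eq (g : GL (Fin 2) R) (h : g.1 0 1 = 0) : ∃ a d c, g = lowerGL a d c := by
  have h1 : IsUnit (g.1 0 0 * g.1 1 1) := by
    have := (Matrix.isUnit_iff_isUnit_det _).1 g.isUnit
    rwa [Matrix.det_fin_two, h, zero_mul, sub_zero] at this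
  obtain ⟨ha, hd⟩ := IsUnit.mul_iff.1 h1
  refine ⟨ha.unit, hd.unit, g.1 1 0, ?_⟩
  ext i j
  fin_cases i <;> fin_cases j <;> simp [coe_lowerGL, h]

/-- Scalar matrices act as the squares of scalars do. -/
theorem rho_mul_lowerGL (t a d s : ringUnits R) (c : R) :
    rho R (t, lowerGL (a * s) (d * s) (c * s)) = rho R (t * s ^ 2, lowerGL a d c) := by
  ext i j
  change rhoMatrix _ i j = rhoMatrix _ i j
  fin_cases i <;> fin_cases j <;> simp [rhoMatrix, coe_lowerGL] <;> ring

end LowerTriangular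

/-! ### Integral adelic matrices and the Iwasawa decomposition -/

section Integral

variable {k : Type*} [Field k]

variable (k) in
/-- The ring of integral adeles. -/
def integralAdeles : Subring (Adele k) where
  carrier := {x | ∀ v : Place k, (Valued.v (x v) : ℤᵐ⁰) ≤ 1}
  add_mem' hx hy v := (Valuation.map_add _ _ _).trans (max_le (hx v) (hy v))
  zero_mem' v := by simp
  neg_mem' {x} hx v := by
    have : (-x) v = -(x v) := rfl
    rw [this, Valuation.map_neg]; exact hx v
  mul_mem' {x y} hx hy v := by
    have : (x * y) v = x v * y v := rfl
    rw [this, map_mul]; exact mul_le_one' (hx v) (hy v)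
  one_mem' v := by
    have : (1 : Adele k) v = 1 := rfl
    rw [this, map_one]

/-- Families of local integers are integral adeles. -/
theorem exists_integral_adele (f : ∀ v : Place k, v.Kv) (hf : ∀ v, (Valued.v (f v) : ℤᵐ⁰) ≤ 1) :
    ∃ x ∈ integralAdeles k, ∀ v, x v = f v :=
  ⟨⟨f, .of_forall fun v ↦ hf v⟩, hf, fun _ ↦ rfl⟩

theorem adele_ext {x y : Adele k} (h : ∀ v, x v = y v) : x = y := Subtype.ext (funext h)

theorem mul_mem_ideleLattice {a : Idele k} {x y : Adele k} (hx : x ∈ integralAdeles k)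
    (hy : y ∈ ideleLattice a) : x * y ∈ ideleLattice a := fun v ↦ by
  have : (x * y) v = x v * y v := rfl
  rw [this, map_mul]
  exact mul_le_of_le_one_of_le (hx v) (hy v)

variable (k) in
/-- The group of invertible integral adelic matrices. -/
def integralGL (n : Type*) [Fintype n] [DecidableEq n] : Subgroup (GL n (Adele k)) where
  carrier := {g | (∀ i j, g.1 i j ∈ integralAdeles k) ∧ ∀ i j, g⁻¹.1 i j ∈ integralAdeles k}
  mul_mem' {g h} hg hh := by
    refine ⟨fun i j ↦ ?_, fun i j ↦ ?_⟩
    · exact Subring.sum_mem _ fun l _ ↦ Subring.mul_mem _ (hg.1 i l) (hh.1 l j)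
    · rw [mul_inv_rev]
      exact Subring.sum_mem _ fun l _ ↦ Subring.mul_mem _ (hh.2 i l) (hg.2 l j)
  one_mem' := by
    have : ∀ i j, (1 : GL n (Adele k)).1 i j ∈ integralAdeles k := fun i j ↦ by
      rw [Units.val_one, Matrix.one_apply]
      split_ifs
      exacts [Subring.one_mem _, Subring.zero_mem _]
    exact ⟨this, by rwa [inv_one]⟩
  inv_mem' {g} hg := ⟨hg.2, by rw [inv_inv]; exact hg.1⟩

variable (k) in
/-- The group of units of the ring of integral adeles. -/
def integralUnits : Subgroup (Idele k) where
  carrier := {a | ∀ v : Place k, (Valued.v ((a : Adele k) v) : ℤᵐ⁰) = 1}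
  mul_mem' {a b} ha hb v := by rw [valued_ideleMul, ha v, hb v, one_mul]
  one_mem' v := by
    change Valued.v (1 : v.Kv) = 1
    rw [map_one]
  inv_mem' {a} ha v := by rw [valued_ideleInv, ha v, inv_one]

theorem coe_mem_integralAdeles {a : Idele k} (ha : a ∈ integralUnits k) :
    (a : Adele k) ∈ integralAdeles k := fun v ↦ (ha v).le

theorem ideleLattice_eq_iff {a b : Idele k} :
    ideleLattice a = ideleLattice b ↔ ∃ o ∈ integralUnits k, a = o * b := by
  constructor
  · intro h
    refine ⟨a * b⁻¹, fun v ↦ ?_, by rw [inv_mul_cancel_right]⟩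
    rw [valued_ideleMul, valued_ideleInv, le_antisymm (ideleLattice_le.1 h.le v)
      (ideleLattice_le.1 h.ge v), mul_inv_cancel₀ (valued_idele_ne_zero b v)]
  · rintro ⟨o, ho, rfl⟩
    have h : ∀ v : Place k, (Valued.v (((o * b : Idele k) : Adele k) v) : ℤᵐ⁰) =
        Valued.v ((b : Adele k) v) := fun v ↦ by rw [valued_ideleMul, ho v, one_mul]
    exact le_antisymm (ideleLattice_le.2 fun v ↦ (h v).le) (ideleLattice_le.2 fun v ↦ (h v).ge)

theorem lowerGL_mem_integralGL {a d : Idele k} {c : Adele k} (ha : a ∈ integralUnits k)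
    (hd : d ∈ integralUnits k) (hc : c ∈ integralAdeles k) :
    lowerGL a d c ∈ integralGL k (Fin 2) := by
  have h := coe_mem_integralAdeles ha
  have h' := coe_mem_integralAdeles hd
  have hi := coe_mem_integralAdeles (inv_mem ha)
  have hi' := coe_mem_integralAdeles (inv_mem hd)
  refine ⟨fun i j ↦ ?_, fun i j ↦ ?_⟩
  · fin_cases i <;> fin_cases j
    exacts [h, Subring.zero_mem _, hc, h']
  · fin_cases i <;> fin_cases j
    exacts [hi, Subring.zero_mem _, Subring.neg_mem _ (Subring.mul_mem _
      (Subring.mul_mem _ hi hc) hi'), hi']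

/-- An element of `SL₂(𝒪)` annihilating the first coordinate of a given vector. -/
theorem exists_integralGL_mul_eq_zero (p r : Adele k) :
    ∃ κ ∈ integralGL k (Fin 2), κ.1 0 0 * p + κ.1 0 1 * r = 0 := by
  have hloc : ∀ v : Place k, ∃ α β γ δ : v.Kv, (Valued.v α : ℤᵐ⁰) ≤ 1 ∧ (Valued.v β : ℤᵐ⁰) ≤ 1 ∧
      (Valued.v γ : ℤᵐ⁰) ≤ 1 ∧ (Valued.v δ : ℤᵐ⁰) ≤ 1 ∧ α * δ - β * γ = 1 ∧
      α * p v + β * r v = 0 := by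
    intro v
    -- At each place the larger of the two entries serves as pivot, so that the multiplier is
    -- integral.
    by_cases hr : r v = 0
    · exact ⟨0, -1, 1, 0, by simp, by simp, by simp, by simp, by simp, by simp [hr]⟩
    · by_cases h : (Valued.v (p v) : ℤᵐ⁰) ≤ Valued.v (r v)
      · refine ⟨1, -(p v / r v), 0, 1, by simp, ?_, by simp, by simp, by simp, by field_simp; simp⟩
        rw [Valuation.map_neg, map_div₀]
        exact div_le_one_of_le₀ h zero_le
      · have hp : p v ≠ 0 := by
          intro hp
          rw [hp, map_zero] at h
          exact h zero_le
        refine ⟨r v / p v, -1, 1, 0, ?_, by simp, by simp, by simp, by simp, by field_simp; simp⟩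
        rw [map_div₀]
        exact div_le_one_of_le₀ (not_le.1 h).le zero_le
  choose α β γ δ hα hβ hγ hδ h1 h2 using hloc
  obtain ⟨α', hα', hα''⟩ := exists_integral_adele α hα
  obtain ⟨β', hβ', hβ''⟩ := exists_integral_adele β hβ
  obtain ⟨γ', hγ', hγ''⟩ := exists_integral_adele γ hγ
  obtain ⟨δ', hδ', hδ''⟩ := exists_integral_adele δ hδ
  have hdet : α' * δ' - β' * γ' = 1 := adele_ext fun v ↦ by
    change α' v * δ' v - β' v * γ' v = 1
    rw [hα'', hβ'', hγ'', hδ'', h1]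
  refine ⟨specialGL α' β' γ' δ' hdet, ⟨fun i j ↦ ?_, fun i j ↦ ?_⟩, ?_⟩
  · fin_cases i <;> fin_cases j
    exacts [hα', hβ', hγ', hδ']
  · fin_cases i <;> fin_cases j
    exacts [hδ', Subring.neg_mem _ hβ', Subring.neg_mem _ hγ', hα']
  · exact adele_ext fun v ↦ by
      change α' v * p v + β' v * r v = 0
      rw [hα'', hβ'', h2]

/-- The Iwasawa decomposition. -/
theorem exists_integralGL_mul_eq_lowerGL (g : GL (Fin 2) (Adele k)) :
    ∃ κ ∈ integralGL k (Fin 2), ∃ a d c, κ * g = lowerGL a d c := by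
  obtain ⟨κ, hκ, h⟩ := exists_integralGL_mul_eq_zero (g.1 0 1) (g.1 1 1)
  refine ⟨κ, hκ, exists_lowerGL_eq _ ?_⟩
  rw [Units.val_mul, Matrix.mul_apply, Fin.sum_univ_two]
  exact h

end Integral

/-! ### Reduction theory for GL(2) -/

section Reduction

variable {k : Type*} [Field k]

theorem mem_integralUnits_of_mem {a : Idele k} (h : (a : Adele k) ∈ integralAdeles k)
    (h' : ((a⁻¹ : Idele k) : Adele k) ∈ integralAdeles k) : a ∈ integralUnits k := fun v ↦ by
  refine le_antisymm (h v) ?_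
  have := h' v
  rw [valued_ideleInv] at this
  exact (inv_le_one₀ (zero_lt_iff.2 (valued_idele_ne_zero a v))).1 this

theorem det_mem_integralAdeles {n : Type*} [Fintype n] [DecidableEq n]
    {M : Matrix n n (Adele k)} (h : ∀ i j, M i j ∈ integralAdeles k) :
    M.det ∈ integralAdeles k := by
  rw [Matrix.det_apply]
  refine Subring.sum_mem _ fun σ _ ↦ ?_
  rw [Units.smul_def]
  exact Subring.zsmul_mem _ (Subring.prod_mem _ fun i _ ↦ h _ _) _

theorem det_mem_integralUnits {n : Type*} [Fintype n] [DecidableEq n] {κ : GL n (Adele k)}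
    (h : κ ∈ integralGL k n) : Matrix.GeneralLinearGroup.det κ ∈ integralUnits k := by
  refine mem_integralUnits_of_mem (det_mem_integralAdeles h.1) ?_
  have h1 := det_mem_integralAdeles h.2
  have h2 : (Matrix.GeneralLinearGroup.det κ)⁻¹ = Matrix.GeneralLinearGroup.det κ⁻¹ :=
    (map_inv _ _).symm
  exact h2 ▸ h1

theorem ideleNorm_eq_one {a : Idele k} (h : a ∈ integralUnits k) : ideleNorm a = 1 := by
  rw [← ideleNorm_one (k := k)]
  refine ideleNorm_congr fun v ↦ ?_
  rw [h v]
  change _ = Valued.v (1 : v.Kv)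
  rw [map_one]

variable (Fq : Type*) [Field Fq] [Finite Fq] [Algebra (RatFunc Fq) k] [FunctionField Fq k]

/-- Pigeonhole principle for vectors of `k²` in an adelic lattice. -/
theorem exists_short_vector {b : Idele k} {C : ℝ}
    (hb : ∀ α : Adele k, ∃ r : k, α - diag Fq k r ∈ ideleLattice b)
    (hC : ∀ a : Idele k, (diagLattice Fq a).index ≠ 0 ∧
      ((diagLattice Fq a).index : ℝ) ≤ max 1 (C / ideleNorm a))
    (a d z : Idele k) (c : Adele k) (h1 : ideleNorm a * ideleNorm b < ideleNorm z)
    (h2 : C * ideleNorm b * (ideleNorm a * ideleNorm d) < ideleNorm z ^ 2) :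
    ∃ w u : k, w ≠ 0 ∧ (a : Adele k) * diag Fq k w ∈ ideleLattice z ∧
      c * diag Fq k w + d * diag Fq k u ∈ ideleLattice z := by
  have ha0 := ideleNorm_pos Fq a
  have hb0 := ideleNorm_pos Fq b
  have hd0 := ideleNorm_pos Fq d
  have hz0 := ideleNorm_pos Fq z
  have hcard := ideleNorm_le_card_mul Fq hb (a⁻¹ * z)
  obtain ⟨hi0, hi⟩ := hC (d⁻¹ * z)
  rw [ideleNorm_mul Fq, ideleNorm_inv Fq] at hcard hi
  have hlt : ((diagLattice Fq (d⁻¹ * z)).index : ℝ) <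
      Nat.card (globalSections Fq (a⁻¹ * z)) := by
    have h3 : (ideleNorm a)⁻¹ * ideleNorm z / ideleNorm b ≤
        Nat.card (globalSections Fq (a⁻¹ * z)) := (div_le_iff₀ hb0).2 hcard
    refine hi.trans_lt (lt_of_lt_of_le ?_ h3)
    rw [lt_div_iff₀ hb0, max_mul_of_nonneg _ _ hb0.le, max_lt_iff]
    constructor
    · rw [one_mul, lt_inv_mul_iff₀ ha0]; exact h1
    · rw [lt_inv_mul_iff₀ ha0, div_mul_eq_mul_div, mul_div_assoc', div_lt_iff₀ (by positivity)]
      field_simp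
      nlinarith
  have hlt' : (diagLattice Fq (d⁻¹ * z)).index < Nat.card (globalSections Fq (a⁻¹ * z)) := by
    exact_mod_cast hlt
  -- There are more admissible first coordinates w than classes of d⁻¹ c w modulo k + d⁻¹z𝒪. The
  -- difference of two that collide is the desired nonzero w, and the rational part of the collision
  -- gives u.
  let f : globalSections Fq (a⁻¹ * z) → Adele k ⧸ diagLattice Fq (d⁻¹ * z) := fun w ↦
    QuotientAddGroup.mk (((d⁻¹ : Idele k) : Adele k) * (c * diag Fq k (w : k)))
  have : Finite (Adele k ⧸ diagLattice Fq (d⁻¹ * z)) :=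
    Nat.finite_of_card_ne_zero hi0
  have hninj : ¬ Function.Injective f := fun hf ↦
    (Nat.card_le_card_of_injective f hf).not_gt hlt'
  rw [Function.not_injective_iff] at hninj
  obtain ⟨w₁, w₂, hw, hne⟩ := hninj
  rw [QuotientAddGroup.eq, mem_diagLattice] at hw
  obtain ⟨r, hr⟩ := hw
  refine ⟨w₂ - w₁, -r, sub_ne_zero.2 fun h ↦ hne (Subtype.ext h.symm), ?_, ?_⟩
  · have h3 : ((w₂ : k) - w₁) ∈ globalSections Fq (a⁻¹ * z) := sub_mem w₂.2 w₁.2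
    rw [mem_globalSections] at h3
    rw [← mul_mem_ideleLattice_mul (a := a), mul_inv_cancel_left] at h3
    exact h3
  · rw [← mul_mem_ideleLattice_mul (a := d), mul_inv_cancel_left] at hr
    convert hr using 1
    rw [map_neg, map_sub]
    have hd := d.mul_inv
    linear_combination (-(c * diag Fq k (w₂ : k) - c * diag Fq k (w₁ : k))) * hd

/-- An invertible matrix over a field with prescribed second column. -/
theorem exists_GL_secondColumn {w : k} (hw : w ≠ 0) (u : k) :
    ∃ γ : GL (Fin 2) k, γ.1 0 1 = w ∧ γ.1 1 1 = u := by
  refine ⟨Matrix.GeneralLinearGroup.mkOfDetNeZero !![0, w; 1, u] ?_, rfl, rfl⟩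
  simpa [Matrix.det_fin_two] using hw

variable (k) in
/-- Reduction theory for `GL(2)`. -/
theorem exists_reduction : ∃ c₀ : ℝ, 0 < c₀ ∧ ∀ g : GL (Fin 2) (Adele k),
    ∃ κ ∈ integralGL k (Fin 2), ∃ γ : GL (Fin 2) k, ∃ (a d : Idele k) (c : Adele k),
      κ * g * Matrix.GeneralLinearGroup.map (diag Fq k) γ = lowerGL a d c ∧
        c₀ * ideleNorm d ≤ ideleNorm a := by
  obtain ⟨b, hb⟩ := exists_forall_sub_diag_mem k Fq
  obtain ⟨C, hC0, hC⟩ := exists_index_diagLattice_le k Fq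
  obtain ⟨ϖ, hϖ1, -⟩ := exists_uniformizer_idele k Fq
  have hϖ0 := ideleNorm_pos Fq ϖ
  have hb0 := ideleNorm_pos Fq b
  set q := ideleNorm ϖ with hq
  set B := max (C * ideleNorm b) (ideleNorm b ^ 2) with hB
  have hB0 : 0 < B := lt_max_of_lt_right (by positivity)
  have hq1 : 1 < (q ^ 2)⁻¹ := (one_lt_inv₀ (by positivity)).2 (by nlinarith)
  refine ⟨min 1 (q ^ 2 / B), by positivity, fun g ↦ ?_⟩
  obtain ⟨κ, hκ, a, d, c, h⟩ := exists_integralGL_mul_eq_lowerGL g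
  have ha0 := ideleNorm_pos Fq a
  have hd0 := ideleNorm_pos Fq d
  by_cases had : ideleNorm d ≤ ideleNorm a
  · refine ⟨κ, hκ, 1, a, d, c, by rw [map_one, mul_one, h], ?_⟩
    exact (mul_le_of_le_one_left hd0.le (min_le_left _ _)).trans had
  push Not at had
  -- `z` is a power of `ϖ` with B|a||d| < |z|² ≤ q⁻² B|a||d|: large enough for a short vector to
  -- exist, yet comparable with the determinant.
  obtain ⟨m, hm1, hm2⟩ := exists_mem_Ico_zpow
    (mul_pos hB0 (mul_pos ha0 hd0)) hq1
  let z := ϖ ^ (-(m + 1))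
  have hz : ideleNorm z ^ 2 = (q ^ 2)⁻¹ ^ (m + 1) := by
    rw [ideleNorm_zpow Fq, ← hq, ← zpow_natCast, ← zpow_mul, inv_zpow', ← zpow_natCast q 2,
      ← zpow_mul]
    congr 1; push_cast; ring
  have hz0 := ideleNorm_pos Fq z
  have hzlow : B * (ideleNorm a * ideleNorm d) < ideleNorm z ^ 2 := hz ▸ hm2
  have hzup : ideleNorm z ^ 2 * q ^ 2 ≤ B * (ideleNorm a * ideleNorm d) := by
    rw [hz, zpow_add_one₀ (by positivity), inv_mul_cancel_right₀ (by positivity)]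
    exact hm1
  obtain ⟨w, u, hw, hw1, hw2⟩ := exists_short_vector Fq hb hC a d z c (by
    refine lt_of_pow_lt_pow_left₀ 2 hz0.le (lt_of_le_of_lt ?_ hzlow)
    rw [mul_pow]
    calc ideleNorm a ^ 2 * ideleNorm b ^ 2 ≤ (ideleNorm a * ideleNorm d) * B := by
          gcongr
          · nlinarith
          · exact le_max_right _ _
      _ = _ := mul_comm _ _) (by
    refine lt_of_le_of_lt ?_ hzlow
    gcongr
    exact le_max_left _ _)
  obtain ⟨γ, hγ1, hγ2⟩ := exists_GL_secondColumn hw u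
  obtain ⟨κ', hκ', a', d', c', h'⟩ := exists_integralGL_mul_eq_lowerGL
    (κ * g * Matrix.GeneralLinearGroup.map (diag Fq k) γ)
  refine ⟨κ' * κ, mul_mem hκ' hκ, γ, a', d', c', by rw [← h', mul_assoc, mul_assoc, mul_assoc], ?_⟩
  -- `γ` has the short vector as second column and `κ'` is integral, so d' ∈ z𝒪. As |a'||d'| =
  -- |a||d|, the upper bound for |z|² turns into one for |d'| / |a'|.
  have hdle : ideleLattice d' ≤ ideleLattice z := by
    refine ideleLattice_le.2 (mem_ideleLattice.1 ?_)
    have h3 : (d' : Adele k) = κ'.1 1 0 * (a * diag Fq k w) +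
        κ'.1 1 1 * (c * diag Fq k w + d * diag Fq k u) := by
      have h4 := congrArg (fun M : GL (Fin 2) (Adele k) ↦ M.1 1 1) h'
      rw [h] at h4
      simp only [Units.val_mul, Matrix.mul_apply, Fin.sum_univ_two, coe_lowerGL] at h4
      simp [hγ1, hγ2] at h4
      exact h4.symm
    rw [h3]
    exact add_mem (mul_mem_ideleLattice (hκ'.1 1 0) hw1) (mul_mem_ideleLattice (hκ'.1 1 1) hw2)
  have hdet : ideleNorm a' * ideleNorm d' = ideleNorm a * ideleNorm d := by
    have h3 := congrArg Matrix.GeneralLinearGroup.det h'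
    rw [h, det_lowerGL, map_mul, map_mul, det_lowerGL] at h3
    have h4 : Matrix.GeneralLinearGroup.det (Matrix.GeneralLinearGroup.map (diag Fq k) γ) =
        principalIdele Fq (Matrix.GeneralLinearGroup.det γ) := by
      ext1
      exact (RingHom.map_det _ _).symm
    rw [h4] at h3
    have h5 := congrArg ideleNorm h3
    simp only [ideleNorm_mul Fq, ideleNorm_principalIdele, ideleNorm_eq_one
      (det_mem_integralUnits hκ'), one_mul, mul_one] at h5
    exact h5.symm
  have hd'0 := ideleNorm_pos Fq d'
  have hle := ideleNorm_le_of_le Fq hdle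
  have h6 : ideleNorm d' ^ 2 * q ^ 2 ≤ B * (ideleNorm a' * ideleNorm d') := by
    rw [hdet]
    refine le_trans ?_ hzup
    gcongr
  refine (mul_le_mul_of_nonneg_right (min_le_right _ _) hd'0.le).trans ?_
  rw [div_mul_eq_mul_div, div_le_iff₀ hB0]
  nlinarith

end Reduction

/-! ### Representatives of the double cosets K \ H_𝔸 / H_k -/

section DoubleCosets

theorem map_rho {R S : Type*} [CommRing R] [CommRing S] (f : R →+* S) (g : G R) :
    Matrix.GeneralLinearGroup.map f (rho R g) =
      rho S (Units.map f g.1, Matrix.GeneralLinearGroup.map f g.2) := by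
  ext i j
  change f (rhoMatrix _ i j) = rhoMatrix _ i j
  fin_cases i <;> fin_cases j <;> simp [rhoMatrix, map_ofNat]

theorem inv_rho {R : Type*} [CommRing R] (g : G R) : (rho R g)⁻¹ = rho R g⁻¹ :=
  (map_inv _ _).symm

theorem map_lowerGL {R S : Type*} [CommRing R] [CommRing S] (f : R →+* S) (a d : ringUnits R)
    (c : R) : Matrix.GeneralLinearGroup.map f (lowerGL a d c) =
      lowerGL (Units.map (f : R →* S) a) (Units.map (f : R →* S) d) (f c) := by
  ext i j
  fin_cases i <;> fin_cases j <;> simp [coe_lowerGL]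

theorem lowerGL_diagonal_mul_mul {R : Type*} [CommRing R] (o a r : ringUnits R) (c : R) :
    lowerGL o 1 0 * lowerGL a 1 (c * (r⁻¹ : ringUnits R)) * lowerGL r 1 0 =
      lowerGL (o * (r * a)) 1 c := by
  rw [lowerGL_mul, lowerGL_mul]
  congr 1
  · rw [mul_assoc, mul_comm a]
  · simp
  · simp

theorem lowerGL_unipotent_mul_mul {R : Type*} [CommRing R] (a : ringUnits R) (o c r : R) :
    lowerGL 1 1 o * lowerGL a 1 c * lowerGL 1 1 r = lowerGL a 1 (o * a + c + r) := by
  rw [lowerGL_mul, lowerGL_mul]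
  congr 1 <;> simp

theorem mul_mul_inv_rearrange {A : Type*} [CommGroup A] (o o' r r' l a : A) :
    o' * o⁻¹ * (l * a⁻¹) * (r' * r⁻¹) = o' * (r' * l) * (o * (r * a))⁻¹ := by
  simp only [mul_inv, mul_assoc, mul_comm, mul_left_comm]

/-- The quotient map `G → H` on `R`-points. -/
abbrev rhoH (R : Type*) [CommRing R] : G R →* H R := (rho R).rangeRestrict

theorem chi_rhoH {R : Type*} [CommRing R] (g : G R) : chi R (rhoH R g) = chiG R g := chi_rho g

variable {k : Type*} [Field k]

variable (k) in
/-- The group `H_𝔸 ∩ GL(3, 𝒪)`. -/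
def integralH : Subgroup (HA k) := (integralGL k (Fin 3)).subgroupOf (H (Adele k))

theorem rhoMatrix_mem_integralAdeles {g : G (Adele k)} (h1 : (g.1 : Adele k) ∈ integralAdeles k)
    (h2 : ∀ i j, g.2.1 i j ∈ integralAdeles k) (i j : Fin 3) :
    rhoMatrix g i j ∈ integralAdeles k := by
  have h2' : (2 : Adele k) ∈ integralAdeles k := ofNat_mem _ 2
  fin_cases i <;> fin_cases j <;> simp only [rhoMatrix, Matrix.smul_apply, smul_eq_mul] <;>
    refine Subring.mul_mem _ h1 ?_
  exacts [Subring.pow_mem _ (h2 _ _) 2, Subring.mul_mem _ (h2 _ _) (h2 _ _),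
    Subring.pow_mem _ (h2 _ _) 2, Subring.mul_mem _ (Subring.mul_mem _ h2' (h2 _ _)) (h2 _ _),
    Subring.add_mem _ (Subring.mul_mem _ (h2 _ _) (h2 _ _)) (Subring.mul_mem _ (h2 _ _) (h2 _ _)),
    Subring.mul_mem _ (Subring.mul_mem _ h2' (h2 _ _)) (h2 _ _), Subring.pow_mem _ (h2 _ _) 2,
    Subring.mul_mem _ (h2 _ _) (h2 _ _), Subring.pow_mem _ (h2 _ _) 2]

theorem rhoH_mem_integralH {t : Idele k} {κ : GL (Fin 2) (Adele k)} (ht : t ∈ integralUnits k)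
    (hκ : κ ∈ integralGL k (Fin 2)) : rhoH (Adele k) (t, κ) ∈ integralH k := by
  refine ⟨rhoMatrix_mem_integralAdeles (coe_mem_integralAdeles ht) hκ.1, ?_⟩
  have h1 := coe_mem_integralAdeles (inv_mem ht)
  intro i j
  change ((rho (Adele k)) (t, κ))⁻¹.1 i j ∈ _
  rw [inv_rho]
  exact rhoMatrix_mem_integralAdeles (g := (t⁻¹, κ⁻¹)) h1 hκ.2 i j

variable (Fq : Type*) [Field Fq] [Finite Fq] [Algebra (RatFunc Fq) k] [FunctionField Fq k]

theorem rhoH_mem_Hk (t : kˣ) (γ : GL (Fin 2) k) :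
    rhoH (Adele k) (principalIdele Fq t, Matrix.GeneralLinearGroup.map (diag Fq k) γ) ∈
      Hk k Fq :=
  ⟨rho k (t, γ), ⟨_, rfl⟩, map_rho (diag Fq k) (t, γ)⟩

/-- The element of `H_𝔸` acting by
`x ↦ λ (a x₀, 2 c x₀ + x₁, a⁻¹ (c² x₀ + c x₁ + x₂))`. -/
def siegelElement (l a : Idele k) (c : Adele k) : HA k :=
  rhoH (Adele k) (l * a⁻¹, lowerGL a 1 c)

theorem chi_siegelElement (l a : Idele k) (c : Adele k) :
    chi (Adele k) (siegelElement l a c) = l := by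
  rw [siegelElement, chi_rhoH, chiG, MonoidHom.mul_apply]
  change l * a⁻¹ * Matrix.GeneralLinearGroup.det (lowerGL a 1 c) = l
  rw [det_lowerGL, mul_one, inv_mul_cancel_right]

/-- Membership in the double coset `K h' Γ`, for `K = H_𝔸 ∩ GL(3, 𝒪)` and `Γ = H_k`. -/
def DoubleCosetRel (h h' : HA k) : Prop := ∃ κ ∈ integralH k, ∃ γ ∈ Hk k Fq, h = κ * h' * γ

variable {Fq} in
theorem DoubleCosetRel.trans {h h' h'' : HA k} (h1 : DoubleCosetRel Fq h h')
    (h2 : DoubleCosetRel Fq h' h'') : DoubleCosetRel Fq h h'' := by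
  obtain ⟨κ, hκ, γ, hγ, rfl⟩ := h1
  obtain ⟨κ', hκ', γ', hγ', rfl⟩ := h2
  exact ⟨κ * κ', mul_mem hκ hκ', γ' * γ, mul_mem hγ' hγ, by simp only [mul_assoc]⟩

variable (k) in
-- The reduced matrix is divided by its entry d; as scalars act through their squares, d² goes into
-- the GL(1) component, and |a| ≥ c₀|d| becomes a lower bound for the new diagonal entry.
theorem exists_rel_siegelElement : ∃ c₀ : ℝ, 0 < c₀ ∧ ∀ h : HA k, ∃ (l a : Idele k) (c : Adele k),
    DoubleCosetRel Fq h (siegelElement l a c) ∧ c₀ ≤ ideleNorm a := by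
  obtain ⟨c₀, hc₀, H⟩ := exists_reduction k Fq
  refine ⟨c₀, hc₀, ?_⟩
  rintro ⟨_, ⟨t, g⟩, rfl⟩
  obtain ⟨κ, hκ, γ, a, d, c, h1, h2⟩ := H g
  have hd0 := ideleNorm_pos Fq d
  refine ⟨t * d ^ 2 * (a * d⁻¹), a * d⁻¹, c * (d⁻¹ : Idele k), ?_, ?_⟩
  · refine ⟨rhoH (Adele k) (1, κ⁻¹), rhoH_mem_integralH (one_mem _) (inv_mem hκ),
      rhoH (Adele k) (1, Matrix.GeneralLinearGroup.map (diag Fq k) γ⁻¹), ?_, ?_⟩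
    · have := rhoH_mem_Hk Fq 1 γ⁻¹
      rwa [map_one] at this
    · have h3 : siegelElement (t * d ^ 2 * (a * d⁻¹)) (a * d⁻¹) (c * (d⁻¹ : Idele k)) =
          rhoH (Adele k) (t, lowerGL a d c) := by
        apply Subtype.ext
        change rho (Adele k) _ = rho (Adele k) _
        rw [mul_inv_cancel_right, ← rho_mul_lowerGL, one_mul, inv_mul_cancel_right, mul_assoc,
          Units.inv_mul, mul_one]
      rw [h3, ← map_mul, ← map_mul]
      change rhoH (Adele k) (t, g) = _
      congr 1
      rw [Prod.mk_mul_mk, Prod.mk_mul_mk, one_mul, mul_one, ← h1, map_inv]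
      congr 1
      group
  · rw [ideleNorm_mul Fq, ideleNorm_inv Fq, ← div_eq_mul_inv, le_div_iff₀ hd0]
    exact h2

/-- Diagonal matrices diag(o, 1) on the left and diag(r, 1) on the right absorb the factors of `a`,
at the cost of rescaling `c`; the factors of `l` go into the GL(1) component. -/
theorem siegelElement_rel_mul (o o' : Idele k) (ho : o ∈ integralUnits k)
    (ho' : o' ∈ integralUnits k) (r r' : kˣ) (l a : Idele k) (c : Adele k) :
    DoubleCosetRel Fq (siegelElement (o' * (principalIdele Fq r' * l))
      (o * (principalIdele Fq r * a)) c)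
      (siegelElement l a (c * (principalIdele Fq r⁻¹ : Idele k))) := by
  refine ⟨rhoH (Adele k) (o' * o⁻¹, lowerGL o 1 0), rhoH_mem_integralH
    (mul_mem ho' (inv_mem ho)) (lowerGL_mem_integralGL ho (one_mem _) (Subring.zero_mem _)),
    _, rhoH_mem_Hk Fq (r' * r⁻¹) (lowerGL r 1 0), ?_⟩
  rw [siegelElement, siegelElement, ← map_mul, ← map_mul]
  congr 1
  have h : Matrix.GeneralLinearGroup.map (diag Fq k) (lowerGL r 1 0) =
      lowerGL (principalIdele Fq r) 1 0 := by
    rw [map_lowerGL, map_zero, map_one]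
    rfl
  rw [Prod.mk_mul_mk, Prod.mk_mul_mk, h, map_inv, lowerGL_diagonal_mul_mul, map_mul, map_inv,
    mul_mul_inv_rearrange]

/-- Unipotent matrices in K change `c` by a𝒪, rational ones by k. -/
theorem siegelElement_rel_add (l a : Idele k) (c c' : Adele k) (r : k)
    (h : c - c' - diag Fq k r ∈ ideleLattice a) :
    DoubleCosetRel Fq (siegelElement l a c) (siegelElement l a c') := by
  let o : Adele k := (c - c' - diag Fq k r) * (a⁻¹ : Idele k)
  have ho : o ∈ integralAdeles k := by
    intro v
    change Valued.v ((c - c' - diag Fq k r) v * ((a⁻¹ : Idele k) : Adele k) v) ≤ _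
    rw [map_mul, valued_ideleInv]
    exact mul_inv_le_one_of_le₀ (h v) zero_le
  have hoa : o * a = c - c' - diag Fq k r := by
    rw [mul_assoc, Units.inv_mul, mul_one]
  refine ⟨rhoH (Adele k) (1, lowerGL 1 1 o), rhoH_mem_integralH
    (one_mem _) (lowerGL_mem_integralGL (one_mem _) (one_mem _) ho),
    _, rhoH_mem_Hk Fq 1 (lowerGL 1 1 r), ?_⟩
  rw [siegelElement, siegelElement, ← map_mul, ← map_mul]
  congr 1
  have h : Matrix.GeneralLinearGroup.map (diag Fq k) (lowerGL 1 1 r) =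
      lowerGL 1 1 (diag Fq k r) := by
    rw [map_lowerGL, map_one]
  rw [Prod.mk_mul_mk, Prod.mk_mul_mk, h, lowerGL_unipotent_mul_mul, map_one, one_mul, mul_one, hoa,
    show c - c' - diag Fq k r + c' + diag Fq k r = c by ring]

variable (k) in
/-- Representatives for `K \ H_𝔸 / H_k`. -/
theorem exists_double_coset_representatives : ∃ (c₀ : ℝ) (ϖ : Idele k) (E : Finset (Idele k))
    (N : ℕ) (rep : Idele k → Fin N → Adele k), 0 < c₀ ∧ ideleNorm ϖ < 1 ∧
    ∀ h : HA k, ∃ (m m' : ℤ) (e e' : E) (i : Fin N),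
      c₀ ≤ ideleNorm (ϖ ^ m' * e'.1) ∧ DoubleCosetRel Fq h
        (siegelElement (ϖ ^ m * e.1) (ϖ ^ m' * e'.1) (rep (ϖ ^ m' * e'.1) i)) := by
  obtain ⟨c₀, hc₀, H⟩ := exists_rel_siegelElement k Fq
  obtain ⟨ϖ, hϖ1, -⟩ := exists_uniformizer_idele k Fq
  obtain ⟨E, hE, hE'⟩ := exists_class_representatives Fq hϖ1
  obtain ⟨C, hC0, hC⟩ := exists_index_diagLattice_le k Fq
  -- The lower bound for |a| makes the number of classes modulo k + a𝒪 bounded uniformly in `a`.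
  obtain ⟨N, hN⟩ := exists_nat_ge (max 1 (C / c₀))
  have hrep : ∀ a : Idele k, ∃ rep : Fin N → Adele k, c₀ ≤ ideleNorm a →
      ∀ c, ∃ i, ∃ r : k, c - rep i - diag Fq k r ∈ ideleLattice a := by
    intro a
    by_cases ha : c₀ ≤ ideleNorm a
    · obtain ⟨h0, h1⟩ := hC a
      have : Finite (Adele k ⧸ diagLattice Fq a) := Nat.finite_of_card_ne_zero h0
      have hle : Nat.card (Adele k ⧸ diagLattice Fq a) ≤ N := by
        have h2 : ((diagLattice Fq a).index : ℝ) ≤ N := by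
          refine h1.trans (le_trans ?_ hN)
          gcongr
        exact_mod_cast h2
      let e := Finite.equivFin (Adele k ⧸ diagLattice Fq a)
      have hpos : 0 < Nat.card (Adele k ⧸ diagLattice Fq a) := Nat.card_pos
      refine ⟨fun i ↦ if h : i.1 < Nat.card (Adele k ⧸ diagLattice Fq a) then
        (e.symm ⟨i.1, h⟩).out else 0, fun _ c ↦ ⟨⟨e c, (e c).2.trans_le hle⟩, ?_⟩⟩
      beta_reduce
      rw [dif_pos (e c).2]
      simp only [Fin.eta, Equiv.symm_apply_apply]
      rw [← mem_diagLattice, sub_eq_neg_add, ← QuotientAddGroup.eq]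
      exact Quotient.out_eq' _
    · exact ⟨fun _ ↦ 0, fun h ↦ absurd h ha⟩
  choose rep hrep using hrep
  refine ⟨c₀, ϖ, hE.toFinset, N, rep, hc₀, hϖ1, fun h ↦ ?_⟩
  obtain ⟨l, a, c, h1, h2⟩ := H h
  obtain ⟨r, m, e, he, hl⟩ := hE' l
  obtain ⟨r', m', e', he', ha⟩ := hE' a
  obtain ⟨o, ho, rfl⟩ := ideleLattice_eq_iff.1 hl
  obtain ⟨o', ho', rfl⟩ := ideleLattice_eq_iff.1 ha
  have h3 := h1.trans (siegelElement_rel_mul Fq o' o ho' ho r' r _ _ c)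
  rw [ideleNorm_mul Fq, ideleNorm_eq_one ho', one_mul, ideleNorm_mul Fq,
    ideleNorm_principalIdele, one_mul] at h2
  obtain ⟨i, u, hi⟩ := hrep (ϖ ^ m' * e') h2 (c * (principalIdele Fq r'⁻¹ : Idele k))
  exact ⟨m, m', ⟨e, by simpa using he⟩, ⟨e', by simpa using he'⟩, i, h2,
    h3.trans (siegelElement_rel_add Fq _ _ _ _ u hi)⟩

end DoubleCosets

/-! ### Counting rational points in adelic lattices -/

section Counting

variable {k : Type*} [Field k]

/-- Once the earlier coordinates are fixed, the next one lies in a single coset of `A₁` or `A₂`; a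
base point in each nonempty fibre gives an injection into the product. -/
theorem finite_and_card_le_of_fibers {A₀ A₁ A₂ : AddSubgroup k} [Finite A₀] [Finite A₁] [Finite A₂]
    {S : Set (Fin 3 → k)} (h₀ : ∀ x ∈ S, x 0 ∈ A₀)
    (h₁ : ∀ x ∈ S, ∀ y ∈ S, x 0 = y 0 → x 1 - y 1 ∈ A₁)
    (h₂ : ∀ x ∈ S, ∀ y ∈ S, x 0 = y 0 → x 1 = y 1 → x 2 - y 2 ∈ A₂) :
    S.Finite ∧ S.ncard ≤ Nat.card A₀ * (Nat.card A₁ * Nat.card A₂) := by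
  have hb₁ : ∀ t : k, ∃ b : k, ∀ x ∈ S, x 0 = t → x 1 - b ∈ A₁ := by
    intro t
    by_cases h : ∃ y ∈ S, y 0 = t
    · obtain ⟨y, hy, rfl⟩ := h
      exact ⟨y 1, fun x hx hxy ↦ h₁ x hx y hy hxy⟩
    · exact ⟨0, fun x hx hxt ↦ absurd ⟨x, hx, hxt⟩ h⟩
  have hb₂ : ∀ t u : k, ∃ b : k, ∀ x ∈ S, x 0 = t → x 1 = u → x 2 - b ∈ A₂ := by
    intro t u
    by_cases h : ∃ y ∈ S, y 0 = t ∧ y 1 = u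
    · obtain ⟨y, hy, rfl, rfl⟩ := h
      exact ⟨y 2, fun x hx hxy hxy' ↦ h₂ x hx y hy hxy hxy'⟩
    · exact ⟨0, fun x hx hxt hxu ↦ absurd ⟨x, hx, hxt, hxu⟩ h⟩
  choose b₁ hb₁ using hb₁
  choose b₂ hb₂ using hb₂
  let f : S → A₀ × A₁ × A₂ := fun x ↦ (⟨x.1 0, h₀ x x.2⟩, ⟨x.1 1 - b₁ (x.1 0), hb₁ _ x x.2 rfl⟩,
    ⟨x.1 2 - b₂ (x.1 0) (x.1 1), hb₂ _ _ x x.2 rfl rfl⟩)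
  have hf : Function.Injective f := by
    intro x y hxy
    simp only [f, Prod.mk.injEq, Subtype.mk.injEq] at hxy
    obtain ⟨e0, e1, e2⟩ := hxy
    rw [e0, sub_left_inj] at e1
    rw [e0, e1, sub_left_inj] at e2
    ext i
    fin_cases i
    exacts [e0, e1, e2]
  refine ⟨Set.finite_coe_iff.1 (Finite.of_injective f hf), ?_⟩
  have := Nat.card_le_card_of_injective f hf
  rwa [Nat.card_prod, Nat.card_prod] at this

theorem mul_mem_ideleLattice_iff {a d : Idele k} {x : Adele k} :
    (a : Adele k) * x ∈ ideleLattice d ↔ x ∈ ideleLattice (a⁻¹ * d) := by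
  rw [← mul_mem_ideleLattice_mul (a := a) (b := a⁻¹ * d), mul_inv_cancel_left]

variable (Fq : Type*) [Field Fq] [Finite Fq] [Algebra (RatFunc Fq) k] [FunctionField Fq k]

theorem act_siegelElement_zero (l a : Idele k) (c : Adele k) (x : Fin 3 → k) :
    act Fq (siegelElement l a c) x 0 = ((l * a : Idele k) : Adele k) * diag Fq k (x 0) := by
  change (rhoMatrix (l * a⁻¹, lowerGL a 1 c) *ᵥ fun i ↦ diag Fq k (x i)) 0 = _
  simp only [Matrix.mulVec, dotProduct, Fin.sum_univ_three, rhoMatrix, coe_lowerGL]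
  simp
  linear_combination (l : Adele k) * a * diag Fq k (x 0) * a.inv_mul

theorem act_siegelElement_one (l a : Idele k) (c : Adele k) (x : Fin 3 → k) :
    act Fq (siegelElement l a c) x 1 = (l : Adele k) * (2 * c * diag Fq k (x 0) + diag Fq k (x 1)) := by
  change (rhoMatrix (l * a⁻¹, lowerGL a 1 c) *ᵥ fun i ↦ diag Fq k (x i)) 1 = _
  simp only [Matrix.mulVec, dotProduct, Fin.sum_univ_three, rhoMatrix, coe_lowerGL]
  simp
  linear_combination (l : Adele k) * (2 * c * diag Fq k (x 0)) * a.inv_mul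

theorem act_siegelElement_two (l a : Idele k) (c : Adele k) (x : Fin 3 → k) :
    act Fq (siegelElement l a c) x 2 = ((l * a⁻¹ : Idele k) : Adele k) *
      (c ^ 2 * diag Fq k (x 0) + c * diag Fq k (x 1) + diag Fq k (x 2)) := by
  change (rhoMatrix (l * a⁻¹, lowerGL a 1 c) *ᵥ fun i ↦ diag Fq k (x i)) 2 = _
  simp only [Matrix.mulVec, dotProduct, Fin.sum_univ_three, rhoMatrix, coe_lowerGL]
  simp
  ring

/-- The rational points with nonzero first coordinate which `h` moves into the lattice
`(d 𝒪)³`. -/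
def latticePoints (d : Idele k) (h : HA k) : Set (Fin 3 → k) :=
  {x | x 0 ≠ 0 ∧ ∀ i, act Fq h x i ∈ ideleLattice d}

/-- The action is triangular: for points with the same earlier coordinates the terms in `c` cancel
in the difference, so the bound does not depend on `c`. -/
theorem latticePoints_siegelElement (d l a : Idele k) (c : Adele k) :
    (latticePoints Fq d (siegelElement l a c)).Finite ∧
    (latticePoints Fq d (siegelElement l a c)).ncard ≤
      Nat.card (globalSections Fq ((l * a)⁻¹ * d)) * (Nat.card (globalSections Fq (l⁻¹ * d)) *
        Nat.card (globalSections Fq ((l * a⁻¹)⁻¹ * d))) := by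
  refine finite_and_card_le_of_fibers ?_ ?_ ?_
  · rintro x ⟨-, hx⟩
    have h := hx 0
    rw [act_siegelElement_zero, mul_mem_ideleLattice_iff] at h
    exact h
  · rintro x ⟨-, hx⟩ y ⟨-, hy⟩ h0
    have h := sub_mem (hx 1) (hy 1)
    rw [act_siegelElement_one, act_siegelElement_one, ← mul_sub, mul_mem_ideleLattice_iff, h0,
      add_sub_add_left_eq_sub, ← map_sub] at h
    exact h
  · rintro x ⟨-, hx⟩ y ⟨-, hy⟩ h0 h1
    have h := sub_mem (hx 2) (hy 2)
    rw [act_siegelElement_two, act_siegelElement_two, ← mul_sub, mul_mem_ideleLattice_iff, h0, h1,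
      add_sub_add_left_eq_sub, ← map_sub] at h
    exact h

/-- The first coordinate is only multiplied by la, so a nonzero x₀ is a section of (la)⁻¹d. -/
theorem mul_le_of_latticePoints_nonempty {d l a : Idele k} {c : Adele k}
    (h : (latticePoints Fq d (siegelElement l a c)).Nonempty) :
    ideleNorm l * ideleNorm a ≤ ideleNorm d := by
  obtain ⟨x, hx0, hx⟩ := h
  have h1 := hx 0
  rw [act_siegelElement_zero, mul_mem_ideleLattice_iff] at h1
  have h2 := one_le_ideleNorm_of_mem Fq hx0 h1
  have hl := ideleNorm_pos Fq l
  have ha := ideleNorm_pos Fq a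
  rw [ideleNorm_mul Fq, ideleNorm_inv Fq, ideleNorm_mul Fq, ← div_eq_inv_mul,
    one_le_div (by positivity)] at h2
  exact h2

theorem max_one_le_mul {c y : ℝ} (hc : 0 < c) (h : c ≤ y) : max 1 y ≤ (1 + c⁻¹) * y := by
  have hy : 0 < y := hc.trans_le h
  have h1 : 1 ≤ c⁻¹ * y := by rwa [inv_mul_eq_div, one_le_div hc]
  refine max_le ?_ ?_ <;> nlinarith

/-- The three coordinate counts are proportional to |la|⁻¹, |l|⁻¹ and |la⁻¹|⁻¹, in whose product |a|
cancels. -/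
theorem exists_ncard_latticePoints_le (d : Idele k) {c₀ : ℝ} (hc₀ : 0 < c₀) :
    ∃ C : ℝ, 0 < C ∧ ∀ (l a : Idele k) (c : Adele k), c₀ ≤ ideleNorm a →
      ((latticePoints Fq d (siegelElement l a c)).ncard : ℝ) ≤ C * (ideleNorm l ^ 3)⁻¹ := by
  obtain ⟨C, hC, hCa⟩ := exists_card_globalSections_le k Fq
  have hd := ideleNorm_pos Fq d
  set D := ideleNorm d with hD
  refine ⟨C ^ 3 * D ^ 3 * ((1 + 1⁻¹) * (1 + c₀⁻¹) * (1 + (c₀ ^ 2)⁻¹)), by positivity,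
    fun l a c hca ↦ ?_⟩
  have hl := ideleNorm_pos Fq l
  have ha := ideleNorm_pos Fq a
  by_cases hne : (latticePoints Fq d (siegelElement l a c)).Nonempty
  · have hla := mul_le_of_latticePoints_nonempty Fq hne
    have h1 := (latticePoints_siegelElement Fq d l a c).2
    have h2 := hCa ((l * a)⁻¹ * d)
    have h3 := hCa (l⁻¹ * d)
    have h4 := hCa ((l * a⁻¹)⁻¹ * d)
    simp only [ideleNorm_mul Fq, ideleNorm_inv Fq, ← hD] at h2 h3 h4
    set L := ideleNorm l with hL
    set A := ideleNorm a with hA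
    -- From LA ≤ D and A ≥ c₀ the three norms are at least 1, c₀ and c₀², so that max(1, y) may be
    -- replaced by a multiple of y.
    have m2 := max_one_le_mul one_pos (y := (L * A)⁻¹ * D) (by
      rwa [inv_mul_eq_div, one_le_div (by positivity)])
    have m3 := max_one_le_mul hc₀ (y := L⁻¹ * D) (by
      refine hca.trans ?_
      rw [inv_mul_eq_div, le_div_iff₀ hl]
      linarith)
    have m4 := max_one_le_mul (c := c₀ ^ 2) (by positivity) (y := (L * A⁻¹)⁻¹ * D) (by
      refine (pow_le_pow_left₀ hc₀.le hca 2).trans ?_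
      rw [mul_inv, inv_inv]
      have : A ≤ L⁻¹ * D := by
        rw [inv_mul_eq_div, le_div_iff₀ hl]
        linarith
      nlinarith)
    calc _ ≤ (Nat.card (globalSections Fq ((l * a)⁻¹ * d)) : ℝ) *
          (Nat.card (globalSections Fq (l⁻¹ * d)) *
          Nat.card (globalSections Fq ((l * a⁻¹)⁻¹ * d))) := by exact_mod_cast h1
      _ ≤ (C * ((1 + 1⁻¹) * ((L * A)⁻¹ * D))) * ((C * ((1 + c₀⁻¹) * (L⁻¹ * D))) *
          (C * ((1 + (c₀ ^ 2)⁻¹) * ((L * A⁻¹)⁻¹ * D)))) := by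
        gcongr
        · exact h2.trans (by gcongr)
        · exact h3.trans (by gcongr)
        · exact h4.trans (by gcongr)
      _ = _ := by field_simp
  · rw [Set.not_nonempty_iff_eq_empty.1 hne, Set.ncard_empty, Nat.cast_zero]
    positivity

end Counting

/-! ### Convergence of the series of weights -/

section Series

/-- A two-sided geometric series with a cutoff. -/
theorem summable_zpow_rpow_cutoff {q B δ : ℝ} (hq0 : 0 < q) (hq1 : q < 1) (hδ : 0 < δ) :
    Summable fun m : ℤ ↦ if q ^ m ≤ B then (q ^ m) ^ δ else 0 := by
  have hqδ : q ^ δ < 1 := Real.rpow_lt_one hq0.le hq1 hδ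
  have hqδ0 : 0 < q ^ δ := Real.rpow_pos_of_pos hq0 δ
  have key : ∀ m : ℤ, (q ^ m) ^ δ = (q ^ δ) ^ m := fun m ↦ by
    rw [← Real.rpow_intCast, ← Real.rpow_mul hq0.le, mul_comm, Real.rpow_mul hq0.le,
      Real.rpow_intCast]
  apply Summable.of_nat_of_neg
  · refine Summable.of_nonneg_of_le (fun n ↦ ?_) (fun n ↦ ?_)
      (summable_geometric_of_lt_one hqδ0.le hqδ)
    · split_ifs <;> positivity
    · rw [key, zpow_natCast]
      split_ifs
      exacts [le_rfl, by positivity]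
  -- For very negative exponents the cutoff makes the terms zero.
  · obtain ⟨N, hN⟩ := pow_unbounded_of_one_lt B ((one_lt_inv₀ hq0).2 hq1)
    refine summable_of_hasFiniteSupport ((Set.finite_lt_nat N).subset fun n hn ↦ ?_)
    simp only [Function.mem_support, ne_eq, ite_eq_right_iff, Classical.not_imp] at hn
    by_contra h
    simp only [Set.mem_ofPred_eq, not_lt] at h
    have h1 := hn.1
    rw [zpow_neg, zpow_natCast, ← inv_pow] at h1
    exact absurd (hN.trans_le (pow_le_pow_right₀ ((one_lt_inv₀ hq0).2 hq1).le h)) (not_lt.2 h1)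

end Series

section WeightedSeries

theorem summable_prod_of_finite {α β : Type*} [Finite β] {f : α × β → ℝ} (hf0 : ∀ x, 0 ≤ f x)
    (hf : ∀ b, Summable fun a ↦ f (a, b)) : Summable f := by
  rw [← (Equiv.prodComm β α).summable_iff]
  exact (summable_prod_of_nonneg fun x ↦ hf0 _).2 ⟨hf, summable_of_hasFiniteSupport (Set.toFinite _)⟩

variable {E : Type*} [Finite E] {w : E → ℝ} {q δ : ℝ}

theorem summable_cutoff_le (hw : ∀ e, 0 < w e) (hq0 : 0 < q) (hq1 : q < 1) (hδ : 0 < δ) (B : ℝ) :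
    Summable fun p : ℤ × E ↦ if q ^ p.1 * w p.2 ≤ B then (q ^ p.1 * w p.2) ^ δ else 0 := by
  refine summable_prod_of_finite (fun p ↦ ?_) fun e ↦ ?_
  · have := hw p.2
    split_ifs <;> positivity
  · have h := (summable_zpow_rpow_cutoff (B := B / w e) hq0 hq1 hδ).mul_right (w e ^ δ)
    refine h.congr fun m ↦ ?_
    simp only [le_div_iff₀ (hw e), ite_mul, zero_mul]
    rw [Real.mul_rpow (by positivity) (hw e).le]

theorem summable_cutoff_ge (hw : ∀ e, 0 < w e) (hq0 : 0 < q) (hq1 : q < 1) (hδ : 0 < δ) {c : ℝ}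
    (hc : 0 < c) :
    Summable fun p : ℤ × E ↦ if c ≤ q ^ p.1 * w p.2 then ((q ^ p.1 * w p.2)⁻¹) ^ δ else 0 := by
  have h := summable_cutoff_le (w := fun e ↦ (w e)⁻¹) (fun e ↦ inv_pos.2 (hw e)) hq0 hq1 hδ c⁻¹
  rw [← ((Equiv.neg ℤ).prodCongr (Equiv.refl E)).summable_iff] at h
  refine h.congr fun p ↦ ?_
  have := hw p.2
  simp only [Function.comp_apply, Equiv.prodCongr_apply, Prod.map_fst, Prod.map_snd,
    Equiv.neg_apply, Equiv.refl_apply, zpow_neg, ← mul_inv]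
  simp only [inv_le_inv₀ (show 0 < q ^ p.1 * w p.2 by positivity) hc]

/-- The series of weights of the double cosets. -/
theorem summable_double_coset_weights (hw : ∀ e, 0 < w e) (hq0 : 0 < q) (hq1 : q < 1) {c D σ : ℝ}
    (hc : 0 < c) (hD : 0 < D) (hσ : 0 < σ) (N : ℕ) :
    Summable fun p : ((ℤ × E) × (ℤ × E)) × Fin N ↦
      if c ≤ q ^ p.1.2.1 * w p.1.2.2 ∧
        (q ^ p.1.1.1 * w p.1.1.2) * (q ^ p.1.2.1 * w p.1.2.2) ≤ D
      then (q ^ p.1.1.1 * w p.1.1.2) ^ σ else 0 := by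
  have hpos : ∀ p : ℤ × E, 0 < q ^ p.1 * w p.2 := fun p ↦ mul_pos (zpow_pos hq0 _) (hw _)
  refine summable_prod_of_finite (fun p ↦ ?_) fun i ↦ ?_
  · have := hpos p.1.1
    split_ifs <;> positivity
  have h1 := summable_cutoff_le hw hq0 hq1 (half_pos hσ) (D / c)
  have h2 := summable_cutoff_ge hw hq0 hq1 (half_pos hσ) hc
  have h3 := (h1.mul_of_nonneg h2 (fun p ↦ by
    have := hpos p
    simp only [Pi.zero_apply]
    split_ifs <;> positivity) (fun p ↦ by
    have := hpos p
    simp only [Pi.zero_apply]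
    split_ifs <;> positivity)).mul_left (D ^ (σ / 2))
  refine Summable.of_nonneg_of_le (fun p ↦ ?_) (fun p ↦ ?_) h3
  · have := hpos p.1
    split_ifs <;> positivity
  have hl := hpos p.1
  have ha := hpos p.2
  dsimp only
  set l := q ^ p.1.1 * w p.1.2
  set a := q ^ p.2.1 * w p.2.2
  split_ifs with h h4 h5 h5
  -- Half of the exponent is kept on l and half is traded for D / a. This separates the variables, l
  -- being bounded above by D / c and a below by c.
  · have h6 : l ≤ D * a⁻¹ := by
      rw [← div_eq_mul_inv, le_div_iff₀ ha]; exact h.2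
    calc l ^ σ = l ^ (σ / 2) * l ^ (σ / 2) := by rw [← Real.rpow_add hl, add_halves]
      _ ≤ l ^ (σ / 2) * (D * a⁻¹) ^ (σ / 2) := by gcongr
      _ = _ := by rw [Real.mul_rpow hD.le (by positivity)]; ring
  · exact absurd h.1 h5
  · exact absurd (by
      rw [le_div_iff₀ hc]
      exact (mul_le_mul_of_nonneg_left h.1 hl.le).trans h.2) h4
  · exact absurd h.1 h5
  all_goals positivity

end WeightedSeries

/-! ### The compact open subgroup K of H_𝔸 -/

section CompactOpen

variable {k : Type*} [Field k]
variable (Fq : Type*) [Field Fq] [Finite Fq] [Algebra (RatFunc Fq) k] [FunctionField Fq k]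

theorem Place.compactSpace_Ov (Fq : Type*) [Field Fq] [Finite Fq] [Algebra (RatFunc Fq) k]
    [FunctionField Fq k] (v : Place k) : CompactSpace v.Ov := by
  have hn : (Valued.v : Valuation v.Kv ℤᵐ⁰).IsNontrivial := by
    obtain ⟨r, hr0, hr⟩ := v.valued_surjective (-1)
    refine ⟨v.emb r, ?_, ?_⟩
    · rw [hr]; exact WithZero.exp_ne_zero
    · rw [hr, ← WithZero.exp_zero, Ne, WithZero.exp_inj]; norm_num
  have : (Valued.v : Valuation v.Kv ℤᵐ⁰).RankOne :=
    Classical.choice (Valuation.nonempty_rankOne_iff_mulArchimedean.2 inferInstance)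
  have h1 : IsClosed (v.Ov : Set v.Kv) := Valued.isClosed_valuationSubring _
  have h2 : CompleteSpace v.Ov := h1.completeSpace_coe
  exact Valued.integer.compactSpace_iff_completeSpace_and_isDiscreteValuationRing_and_finite_residueField.2
    ⟨h2, v.isDiscreteValuationRing, v.finite_residueField Fq⟩

theorem isOpen_integralAdeles : IsOpen (integralAdeles k : Set (Adele k)) := by
  have h := (RestrictedProduct.isOpenEmbedding_structureMap (R := fun v : Place k ↦ v.Kv)
    (A := fun v ↦ (v.Ov : Set v.Kv)) (fun v ↦ Valued.isOpen_valuationSubring _)).isOpen_range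
  rw [RestrictedProduct.range_structureMap] at h
  exact h

theorem isCompact_integralAdeles (Fq : Type*) [Field Fq] [Finite Fq] [Algebra (RatFunc Fq) k]
    [FunctionField Fq k] : IsCompact (integralAdeles k : Set (Adele k)) := by
  have : ∀ v : Place k, CompactSpace v.Ov := fun v ↦ v.compactSpace_Ov Fq
  have h := isCompact_range (RestrictedProduct.isEmbedding_structureMap (R := fun v : Place k ↦ v.Kv)
    (A := fun v ↦ (v.Ov : Set v.Kv)) (𝓕 := Filter.cofinite)).continuous
  rw [RestrictedProduct.range_structureMap] at h
  exact h

theorem isOpen_integralGL (n : Type*) [Fintype n] [DecidableEq n] :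
    IsOpen (integralGL k n : Set (GL n (Adele k))) := by
  have h1 : ∀ i j, Continuous fun g : GL n (Adele k) ↦ g.1 i j := fun i j ↦
    Units.continuous_val.matrix_elem i j
  have h2 : ∀ i j, Continuous fun g : GL n (Adele k) ↦ g⁻¹.1 i j := fun i j ↦
    (h1 i j).comp continuous_inv
  have : (integralGL k n : Set (GL n (Adele k))) =
      (⋂ i, ⋂ j, (fun g : GL n (Adele k) ↦ g.1 i j) ⁻¹' (integralAdeles k : Set (Adele k))) ∩
      ⋂ i, ⋂ j, (fun g : GL n (Adele k) ↦ g⁻¹.1 i j) ⁻¹' (integralAdeles k : Set (Adele k)) := by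
    ext g
    simp only [Set.mem_inter_iff, Set.mem_iInter, Set.mem_preimage]
    rfl
  rw [this]
  exact (isOpen_iInter_of_finite fun i ↦ isOpen_iInter_of_finite fun j ↦
      isOpen_integralAdeles.preimage (h1 i j)).inter
    (isOpen_iInter_of_finite fun i ↦ isOpen_iInter_of_finite fun j ↦
      isOpen_integralAdeles.preimage (h2 i j))

/-- The units form a closed subspace of the product of the monoid and its opposite. -/
theorem isCompact_units {M : Type*} [Monoid M] [TopologicalSpace M] [T1Space M] [ContinuousMul M]
    {S : Set M} (hS : IsCompact S) : IsCompact {u : Mˣ | u.1 ∈ S ∧ u⁻¹.1 ∈ S} := by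
  have h : IsCompact (S ×ˢ (MulOpposite.unop ⁻¹' S)) :=
    hS.prod (MulOpposite.opHomeomorph.isCompact_preimage.mp hS)
  exact Units.isClosedEmbedding_embedProduct.isCompact_preimage h

theorem isCompact_ringUnits {R : Type*} [CommRing R] [TopologicalSpace R] [T1Space R]
    [IsTopologicalRing R] {S : Set R} (hS : IsCompact S) :
    IsCompact {u : ringUnits R | u.1 ∈ S ∧ (u⁻¹ : ringUnits R).1 ∈ S} := isCompact_units hS

theorem isCompact_integralGL (Fq : Type*) [Field Fq] [Finite Fq] [Algebra (RatFunc Fq) k]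
    [FunctionField Fq k] (n : Type*) [Fintype n] [DecidableEq n] :
    IsCompact (integralGL k n : Set (GL n (Adele k))) := by
  have h : IsCompact {M : Matrix n n (Adele k) | ∀ i j, M i j ∈ integralAdeles k} := by
    have h1 : IsCompact (Set.pi Set.univ fun _ : n ↦ Set.pi Set.univ fun _ : n ↦
        (integralAdeles k : Set (Adele k))) :=
      isCompact_univ_pi fun _ : n ↦ isCompact_univ_pi fun _ : n ↦ isCompact_integralAdeles (k := k) Fq
    have h2 : Set.pi Set.univ (fun _ : n ↦ Set.pi Set.univ fun _ : n ↦
        (integralAdeles k : Set (Adele k))) = {M | ∀ i j, M i j ∈ integralAdeles k} := by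
      ext M
      simp [Set.mem_pi]
    rw [h2] at h1
    exact h1
  exact isCompact_units h

theorem isCompact_integralUnits (Fq : Type*) [Field Fq] [Finite Fq] [Algebra (RatFunc Fq) k]
    [FunctionField Fq k] : IsCompact (integralUnits k : Set (Idele k)) := by
  have h := isCompact_ringUnits (isCompact_integralAdeles (k := k) Fq)
  have h1 : (integralUnits k : Set (Idele k)) = {u : Idele k | u.1 ∈ (integralAdeles k : Set (Adele k))
      ∧ (u⁻¹ : Idele k).1 ∈ (integralAdeles k : Set (Adele k))} := by
    ext a
    exact ⟨fun ha ↦ ⟨coe_mem_integralAdeles ha, coe_mem_integralAdeles (inv_mem ha)⟩,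
      fun ha ↦ mem_integralUnits_of_mem ha.1 ha.2⟩
  rw [h1]
  exact h

theorem mem_integralGL_of_det {n : Type*} [Fintype n] [DecidableEq n] {g : GL n (Adele k)}
    (h : ∀ i j, g.1 i j ∈ integralAdeles k)
    (hdet : Matrix.GeneralLinearGroup.det g ∈ integralUnits k) : g ∈ integralGL k n := by
  refine ⟨h, fun i j ↦ ?_⟩
  have h1 : (g⁻¹ : GL n (Adele k)).1 =
      (((Matrix.GeneralLinearGroup.det g)⁻¹ : Idele k) : Adele k) • g.1.adjugate := by
    rw [Matrix.coe_units_inv, Matrix.inv_def]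
    congr 1
    exact Ring.inverse_unit (Matrix.GeneralLinearGroup.det g)
  rw [h1, Matrix.smul_apply, smul_eq_mul, Matrix.adjugate_apply]
  refine Subring.mul_mem _ (coe_mem_integralAdeles (inv_mem hdet)) (det_mem_integralAdeles ?_)
  intro a b
  rw [Matrix.updateRow_apply]
  split_ifs
  · rw [Pi.single_apply]
    split_ifs
    exacts [Subring.one_mem _, Subring.zero_mem _]
  · exact h a b

theorem det_rho {R : Type*} [CommRing R] (g : G R) :
    Matrix.GeneralLinearGroup.det (rho R g) = chiG R g ^ 3 := by
  ext
  change (rhoMatrix g).det = ((g.1 : R) * g.2.1.det) ^ 3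
  rw [Matrix.det_fin_three, Matrix.det_fin_two]
  simp [rhoMatrix]
  ring

theorem mem_integralUnits_of_pow {a : Idele k} (h : a ^ 3 ∈ integralUnits k) :
    a ∈ integralUnits k := fun v ↦ by
  have h1 := h v
  rw [pow_succ, pow_two, valued_ideleMul, valued_ideleMul, ← pow_two, ← pow_succ] at h1
  rcases lt_trichotomy (Valued.v ((a : Adele k) v) : ℤᵐ⁰) 1 with h2 | h2 | h2
  · exact absurd h1 (pow_lt_one₀ zero_le h2 (by norm_num)).ne
  · exact h2
  · exact absurd h1 (one_lt_pow₀ h2 (by norm_num)).ne'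

theorem chi_mem_integralUnits {h : HA k} (hh : h ∈ integralH k) :
    (chi (Adele k) h : Idele k) ∈ integralUnits k := by
  obtain ⟨_, g, rfl⟩ := h
  rw [chi_rho]
  refine mem_integralUnits_of_pow ?_
  rw [← det_rho]
  exact det_mem_integralUnits hh

/-- At each place `s` is a largest entry of `g`. Where `g` and its inverse are both integral that
entry is a unit, so `s` is an idele. -/
theorem exists_max_entry (g : GL (Fin 2) (Adele k)) : ∃ (s : Idele k) (m n : Place k → Fin 2),
    (∀ v, (s : Adele k) v = g.1 (m v) (n v) v) ∧
    ∀ v i j, (Valued.v (g.1 i j v) : ℤᵐ⁰) ≤ Valued.v ((s : Adele k) v) := by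
  have hmax : ∀ v : Place k, ∃ p : Fin 2 × Fin 2, ∀ p' : Fin 2 × Fin 2,
      (Valued.v (g.1 p'.1 p'.2 v) : ℤᵐ⁰) ≤ Valued.v (g.1 p.1 p.2 v) := fun v ↦ by
    obtain ⟨p, -, hp⟩ := Finset.exists_max_image Finset.univ
      (fun p : Fin 2 × Fin 2 ↦ (Valued.v (g.1 p.1 p.2 v) : ℤᵐ⁰)) Finset.univ_nonempty
    exact ⟨p, fun p' ↦ hp p' (Finset.mem_univ _)⟩
  choose p hp using hmax
  have hone : ∀ v : Place k, (Valued.v (∑ j, g.1 0 j v * g⁻¹.1 j 0 v) : ℤᵐ⁰) = 1 := by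
    intro v
    have h1 : (g * g⁻¹).1 0 0 v = 1 := by rw [mul_inv_cancel]; rfl
    rw [Units.val_mul, Matrix.mul_apply, Fin.sum_univ_two] at h1
    rw [Fin.sum_univ_two]
    change Valued.v ((g.1 0 0 * g⁻¹.1 0 0 + g.1 0 1 * g⁻¹.1 1 0) v) = 1
    rw [h1, map_one]
  have h0 : ∀ v, g.1 (p v).1 (p v).2 v ≠ 0 := by
    intro v hv
    have h2 : ∀ j, g.1 0 j v = 0 := fun j ↦ by
      have := hp v (0, j)
      rw [hv, map_zero] at this
      simpa using this
    have h3 := hone v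
    simp [h2] at h3
  refine ⟨ideleMk (fun v ↦ g.1 (p v).1 (p v).2 v) h0 ?_, fun v ↦ (p v).1, fun v ↦ (p v).2,
    fun v ↦ rfl, fun v i j ↦ hp v (i, j)⟩
  refine ((Set.finite_iUnion fun i ↦ Set.finite_iUnion fun j ↦
    finite_not_integral (g.1 i j)).union (Set.finite_iUnion fun i ↦ Set.finite_iUnion fun j ↦
    finite_not_integral (g⁻¹.1 i j))).subset fun v hv ↦ ?_
  by_contra hcon
  simp only [Set.mem_union, Set.mem_iUnion, Set.mem_ofPred_eq, not_or, not_exists, not_not] at hcon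
  refine hv (le_antisymm (hcon.1 _ _) ?_)
  rw [← hone v]
  refine Valuation.map_sum_le _ fun j _ ↦ ?_
  rw [map_mul]
  exact (mul_le_of_le_one_right' (hcon.2 j 0)).trans (hp v (0, j))

theorem rho_scalar_mul {R : Type*} [CommRing R] (t s : ringUnits R) (g : GL (Fin 2) R) :
    rho R (t * s ^ 2, lowerGL s⁻¹ s⁻¹ 0 * g) = rho R (t, g) := by
  have h := rho_mul_lowerGL (R := R) (t * s ^ 2) 1 1 s⁻¹ 0
  have h1 : ((t * s ^ 2, lowerGL s⁻¹ s⁻¹ 0 * g) : G R) =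
      ((t * s ^ 2, lowerGL (1 * s⁻¹) (1 * s⁻¹) (0 * (s⁻¹ : ringUnits R))) : G R) *
        ((1, g) : G R) := by
    rw [Prod.mk_mul_mk, mul_one, one_mul, zero_mul]
  have h2 : ((t, g) : G R) = ((t, lowerGL 1 1 0) : G R) * ((1, g) : G R) := by
    rw [Prod.mk_mul_mk, mul_one]
    congr 1
    ext i j
    fin_cases i <;> fin_cases j <;> simp [coe_lowerGL, Matrix.mul_apply]
  rw [h1, map_mul, h, h2, map_mul, inv_pow, mul_inv_cancel_right]

/-- Dividing g by its largest entry s does not change h if t becomes ts². Both ts² and det(s⁻¹g) are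
then integral, and their product χ(h) is a unit, so both are units. This presents K as an image of a
compact group. -/
theorem exists_rhoH_eq_of_mem_integralH {h : HA k} (hh : h ∈ integralH k) :
    ∃ t ∈ integralUnits k, ∃ κ ∈ integralGL k (Fin 2), h = rhoH (Adele k) (t, κ) := by
  have hchi := chi_mem_integralUnits hh
  obtain ⟨_, ⟨t, g⟩, rfl⟩ := h
  obtain ⟨s, m, n, hs, hmax⟩ := exists_max_entry g
  rw [chi_rho] at hchi
  let g' := lowerGL s⁻¹ s⁻¹ 0 * g
  have hg' : ∀ i j, g'.1 i j ∈ integralAdeles k := by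
    intro i j v
    have h1 : g'.1 i j = ((s⁻¹ : Idele k) : Adele k) * g.1 i j := by
      simp only [g', Units.val_mul, Matrix.mul_apply, Fin.sum_univ_two, coe_lowerGL]
      fin_cases i <;> simp
    rw [h1]
    change Valued.v (((s⁻¹ : Idele k) : Adele k) v * g.1 i j v) ≤ 1
    rw [map_mul, valued_ideleInv, ← div_eq_inv_mul]
    exact div_le_one_of_le₀ (hmax v i j) zero_le
  have ht : ((t * s ^ 2 : Idele k) : Adele k) ∈ integralAdeles k := by
    intro v
    -- The four corner entries of the 3 × 3 matrix are t times the squares of the entries of `g`; so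
    -- ts² is locally one of its entries.
    let e : Fin 2 → Fin 3 := ![0, 2]
    have h1 : (rhoMatrix (t, g) (e (m v)) (e (n v))) = (t : Adele k) * g.1 (m v) (n v) ^ 2 := by
      generalize m v = i
      generalize n v = j
      fin_cases i <;> fin_cases j <;> simp [e, rhoMatrix]
    have h2 : ((t * s ^ 2 : Idele k) : Adele k) v = rhoMatrix (t, g) (e (m v)) (e (n v)) v := by
      rw [h1]
      change (t : Adele k) v * (s : Adele k) v ^ 2 = (t : Adele k) v * (g.1 (m v) (n v) v) ^ 2
      rw [hs]
    rw [h2]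
    exact hh.1 _ _ v
  have hprod : ∀ v : Place k, (Valued.v (((t * s ^ 2 : Idele k) : Adele k) v) : ℤᵐ⁰) *
      Valued.v ((Matrix.GeneralLinearGroup.det g' : Adele k) v) = 1 := by
    intro v
    have h1 : t * s ^ 2 * Matrix.GeneralLinearGroup.det g' = chiG (Adele k) (t, g) := by
      have h2 := chi_rho (R := Adele k) (t * s ^ 2, g')
      have h3 := chi_rho (R := Adele k) (t, g)
      have h4 : (⟨rho (Adele k) (t * s ^ 2, g'), _, rfl⟩ : H (Adele k)) =
        ⟨rho (Adele k) (t, g), _, rfl⟩ := Subtype.ext (rho_scalar_mul t s g)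
      rw [h4, h3] at h2
      exact h2.symm
    have h2 := hchi v
    rw [← h1] at h2
    rw [← map_mul]
    exact h2
  have hdet := det_mem_integralAdeles hg'
  have h1 : t * s ^ 2 ∈ integralUnits k := fun v ↦ by
    refine le_antisymm (ht v) ?_
    rw [← hprod v]
    exact mul_le_of_le_one_right' (hdet v)
  have h2 : Matrix.GeneralLinearGroup.det g' ∈ integralUnits k := fun v ↦ by
    refine le_antisymm (hdet v) ?_
    rw [← hprod v]
    exact mul_le_of_le_one_left' (ht v)
  exact ⟨t * s ^ 2, h1, g', mem_integralGL_of_det hg' h2, Subtype.ext (rho_scalar_mul t s g).symm⟩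

theorem continuous_rhoH : Continuous (rhoH (Adele k)) := by
  have key : Continuous fun g : G (Adele k) ↦ rhoMatrix g := by
    have h1 : Continuous fun g : G (Adele k) ↦ (g.1 : Adele k) :=
      Units.continuous_val.comp continuous_fst
    have h2 : ∀ i j, Continuous fun g : G (Adele k) ↦ g.2.1 i j := fun i j ↦
      (Units.continuous_val.comp continuous_snd).matrix_elem i j
    refine continuous_matrix fun i j ↦ ?_
    fin_cases i <;> fin_cases j <;> simp [rhoMatrix] <;> fun_prop
  refine Continuous.subtype_mk ?_ _
  refine Units.continuous_iff.2 ⟨key, ?_⟩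
  have h : (fun g : G (Adele k) ↦ ((rho (Adele k) g)⁻¹).1) = fun g ↦ rhoMatrix g⁻¹ := by
    ext1 g
    rw [inv_rho]
    rfl
  exact h ▸ key.comp continuous_inv

theorem isOpen_integralH : IsOpen (integralH k : Set (HA k)) :=
  (isOpen_integralGL (k := k) (Fin 3)).preimage continuous_subtype_val

theorem isCompact_integralH (Fq : Type*) [Field Fq] [Finite Fq] [Algebra (RatFunc Fq) k]
    [FunctionField Fq k] : IsCompact (integralH k : Set (HA k)) := by
  have h := ((isCompact_integralUnits (k := k) Fq).prod
    (isCompact_integralGL (k := k) Fq (Fin 2))).image continuous_rhoH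
  convert h using 1
  ext x
  constructor
  · intro hx
    obtain ⟨t, ht, κ, hκ, rfl⟩ := exists_rhoH_eq_of_mem_integralH hx
    exact ⟨(t, κ), ⟨ht, hκ⟩, rfl⟩
  · rintro ⟨⟨t, κ⟩, ⟨ht, hκ⟩, rfl⟩
    exact rhoH_mem_integralH ht hκ

theorem locallyCompactSpace_HA (Fq : Type*) [Field Fq] [Finite Fq] [Algebra (RatFunc Fq) k]
    [FunctionField Fq k] : LocallyCompactSpace (HA k) :=
  (isCompact_integralH Fq).locallyCompactSpace_of_mem_nhds_of_group
    (isOpen_integralH.mem_nhds (one_mem (integralH k)))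

end CompactOpen

/-! ### The modular character of H_𝔸 on the representatives -/

section Unimodular

section General

variable {A : Type*} [Group A] [TopologicalSpace A] [IsTopologicalGroup A] [LocallyCompactSpace A]

theorem modularCharacter_eq_one_of_commute {z : A} (hz : ∀ x, x * z = z * x) :
    Measure.modularCharacter z = 1 := by
  borelize A
  change Measure.modularCharacterFun z = 1
  rw [Measure.modularCharacterFun_eq_haarScalarFactor Measure.haar z]
  have h : Measure.map (fun x ↦ x * z) (Measure.haar : Measure A) = Measure.haar := by
    simp_rw [hz]
    exact map_mul_left_eq_self _ z
  simp_rw [h]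
  exact Measure.haarScalarFactor_self _

/-- Right translation scales Haar measure by the modular character. On compact sets this needs no
regularity of `μ`. -/
theorem measure_mul_right_eq [MeasurableSpace A] [BorelSpace A] (μ : Measure A) [μ.IsHaarMeasure]
    {h : A} (hh : Measure.modularCharacter h = 1) {s : Set A} (hs : IsCompact s) :
    μ ((fun x ↦ x * h⁻¹) ⁻¹' s) = μ s := by
  have h1 : Measure.modularCharacterFun h⁻¹ = 1 := by
    change Measure.modularCharacter h⁻¹ = 1
    rw [← mul_left_inj' (c := Measure.modularCharacter h) (by rw [hh]; exact one_ne_zero),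
      ← map_mul, inv_mul_cancel, map_one, hh, one_mul]
  rw [Measure.modularCharacterFun_eq_haarScalarFactor μ] at h1
  have h2 := Measure.measure_isMulInvariant_eq_smul_of_isCompact_closure
    (Measure.map (fun x ↦ x * h⁻¹) μ) μ hs.closure
  rw [h1, one_smul] at h2
  rw [← h2]
  exact ((Homeomorph.mulRight h⁻¹).toMeasurableEquiv.map_apply s).symm

end General

variable {k : Type*} [Field k]

theorem NNReal_eq_one_of_mul_self {x : ℝ≥0} (h : x * x = 1) : x = 1 := by
  rw [← pow_two] at h
  exact (pow_eq_one_iff_of_nonneg zero_le two_ne_zero).1 h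

/-- A character is invariant under conjugation, so f(x) = f(x)⁻¹; and 1 is the only nonnegative real
of square 1. -/
theorem map_eq_one_of_conj_inv {A : Type*} [Group A] (f : A →* ℝ≥0) {x y z : A} (hz : f z = 1)
    (h : y * x * y⁻¹ = z * x⁻¹) : f x = 1 := by
  have hy : f y * f y⁻¹ = 1 := by rw [← map_mul, mul_inv_cancel, map_one]
  have hx : f x * f x⁻¹ = 1 := by rw [← map_mul, mul_inv_cancel, map_one]
  refine NNReal_eq_one_of_mul_self ?_
  have h2 : f x = f x⁻¹ := by
    calc f x = (f y * f y⁻¹) * f x := by rw [hy, one_mul]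
      _ = f (y * x * y⁻¹) := by rw [map_mul, map_mul]; ring
      _ = f x⁻¹ := by rw [h, map_mul, hz, one_mul]
  calc f x * f x = f x * f x⁻¹ := by rw [← h2]
    _ = 1 := hx

theorem lowerGL_one (R : Type*) [CommRing R] : lowerGL (1 : ringUnits R) 1 0 = 1 := by
  ext i j
  fin_cases i <;> fin_cases j <;> simp [coe_lowerGL]

theorem lowerGL_unipotent_inv {R : Type*} [CommRing R] (c : R) :
    (lowerGL 1 1 c)⁻¹ = lowerGL 1 1 (-c) := by
  rw [inv_eq_iff_mul_eq_one, lowerGL_mul, ← lowerGL_one]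
  congr 1 <;> simp

theorem lowerGL_diagonal_inv {R : Type*} [CommRing R] (a : ringUnits R) :
    (lowerGL a 1 0)⁻¹ = lowerGL a⁻¹ 1 0 := by
  rw [inv_eq_iff_mul_eq_one, lowerGL_mul, ← lowerGL_one]
  congr 1 <;> simp

theorem unipotent_conj {R : Type*} [CommRing R] (c : R) :
    lowerGL (-1) 1 0 * lowerGL 1 1 c * (lowerGL (-1) 1 0)⁻¹ = (lowerGL 1 1 c)⁻¹ := by
  rw [lowerGL_diagonal_inv, lowerGL_unipotent_inv, lowerGL_mul, lowerGL_mul]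
  congr 1 <;> simp

theorem diagonal_conj {R : Type*} [CommRing R] (a : ringUnits R) :
    specialGL 0 1 (-1) 0 (by ring) * lowerGL a 1 0 * (specialGL 0 1 (-1) 0 (by ring))⁻¹ =
      lowerGL 1 a 0 := by
  rw [mul_inv_eq_iff_eq_mul]
  ext i j
  fin_cases i <;> fin_cases j <;> simp [coe_lowerGL, specialGL, Matrix.mul_apply, Fin.sum_univ_two]

/-- The element is a product of a central, a unipotent and a diagonal one. The last two are
conjugate to their inverses up to central elements. -/
theorem modularCharacter_siegelElement [LocallyCompactSpace (HA k)] (l a : Idele k) (c : Adele k) :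
    Measure.modularCharacter (siegelElement l a c) = 1 := by
  let Δ : G (Adele k) →* ℝ≥0 := Measure.modularCharacter.comp (rhoH (Adele k))
  have hcentral : ∀ t : Idele k, Δ (t, 1) = 1 := by
    intro t
    refine modularCharacter_eq_one_of_commute ?_
    rintro ⟨_, ⟨t', g⟩, rfl⟩
    change rhoH (Adele k) (t', g) * rhoH (Adele k) (t, 1) =
      rhoH (Adele k) (t, 1) * rhoH (Adele k) (t', g)
    rw [← map_mul, ← map_mul, Prod.mk_mul_mk, Prod.mk_mul_mk, mul_one, one_mul, mul_comm]
  have hdiag : Δ (1, lowerGL a 1 0) = 1 := by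
    -- The Weyl element turns diag(a, 1) into diag(1, a) = a · diag(a⁻¹, 1), and the scalar a acts
    -- as the central element a² of GL(1).
    have h1 : rhoH (Adele k) (1, lowerGL 1 a 0) =
        rhoH (Adele k) (a ^ 2, 1) * (rhoH (Adele k) (1, lowerGL a 1 0))⁻¹ := by
      rw [← map_inv, ← map_mul]
      apply Subtype.ext
      change rho _ _ = rho _ _
      have h2 := rho_mul_lowerGL (R := Adele k) 1 a⁻¹ 1 a 0
      rw [inv_mul_cancel, one_mul, zero_mul, one_mul] at h2
      rw [h2, ← lowerGL_diagonal_inv]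
      congr 1
      change _ = (a ^ 2 * 1⁻¹, 1 * _)
      rw [inv_one, mul_one, one_mul]
      rfl
    refine map_eq_one_of_conj_inv Measure.modularCharacter (x := rhoH (Adele k) (1, lowerGL a 1 0))
      (y := rhoH (Adele k) (1, specialGL 0 1 (-1) 0 (by ring))) (hcentral (a ^ 2)) ?_
    rw [← h1, ← map_inv, ← map_mul, ← map_mul]
    congr 1
    refine Prod.ext ?_ ?_
    · change (1 * 1 * 1⁻¹ : Idele k) = 1
      rw [inv_one, mul_one, mul_one]
    · exact diagonal_conj a
  have hunip : ∀ c, Δ (1, lowerGL 1 1 c) = 1 := by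
    intro c
    refine map_eq_one_of_conj_inv Δ (y := (1, lowerGL (-1) 1 0)) (z := 1) (map_one _) ?_
    rw [one_mul]
    refine Prod.ext ?_ ?_
    · change (1 * 1 * 1⁻¹ : Idele k) = 1⁻¹
      rw [mul_one, one_mul]
    · exact unipotent_conj c
  have h1 : ((l * a⁻¹, lowerGL a 1 c) : G (Adele k)) =
      ((l * a⁻¹, 1) : G (Adele k)) * (((1, lowerGL 1 1 (c * (a⁻¹ : Idele k))) : G (Adele k)) *
        ((1, lowerGL a 1 0) : G (Adele k))) := by
    rw [Prod.mk_mul_mk, Prod.mk_mul_mk, mul_one, mul_one, one_mul, lowerGL_mul, one_mul, one_mul,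
      mul_zero, add_zero, mul_assoc, Units.inv_mul, mul_one]
  change Δ (l * a⁻¹, lowerGL a 1 c) = 1
  rw [h1, map_mul, map_mul, hcentral, hunip, hdiag, one_mul, one_mul]

end Unimodular

/-! ### V_k'' and the discriminant -/

section QuadraticForms

variable {k : Type*} [Field k]

theorem splits_of_isSquare_disc (h2 : (2 : k) ≠ 0) {x : Fin 3 → k} (h : IsSquare (disc x)) :
    (Polynomial.C (x 0) * Polynomial.X ^ 2 + Polynomial.C (x 1) * Polynomial.X +
      Polynomial.C (x 2)).Splits := by
  obtain ⟨s, hs⟩ := h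
  by_cases h0 : x 0 = 0
  · rw [h0, map_zero, zero_mul, zero_add]
    exact Polynomial.Splits.of_natDegree_le_one Polynomial.natDegree_linear_le
  · have h1 : Polynomial.C (x 0) * Polynomial.X ^ 2 + Polynomial.C (x 1) * Polynomial.X +
        Polynomial.C (x 2) = Polynomial.C (x 0) *
        ((Polynomial.X - Polynomial.C ((-x 1 + s) / (2 * x 0))) *
          (Polynomial.X - Polynomial.C ((-x 1 - s) / (2 * x 0)))) := by
      have e1 : x 1 = -(x 0 * ((-x 1 + s) / (2 * x 0) + (-x 1 - s) / (2 * x 0))) := by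
        field_simp; ring
      have e2 : x 2 = x 0 * (((-x 1 + s) / (2 * x 0)) * ((-x 1 - s) / (2 * x 0))) := by
        have h4 : (4 : k) ≠ 0 := by
          rw [show (4 : k) = 2 * 2 by norm_num]; exact mul_ne_zero h2 h2
        rw [disc] at hs
        field_simp
        linear_combination -hs
      conv_lhs => rw [e1, e2]
      simp only [map_neg, map_mul, map_add]
      ring
    rw [h1]
    exact (Polynomial.Splits.C _).mul
      ((Polynomial.Splits.X_sub_C _).mul (Polynomial.Splits.X_sub_C _))

theorem finrank_splittingField_eq_two {x : Fin 3 → k} (h : ¬ IsSquare (disc x)) :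
    Module.finrank k (Polynomial.SplittingField
    (Polynomial.C (x 0) * Polynomial.X ^ 2 + Polynomial.C (x 1) * Polynomial.X +
      Polynomial.C (x 2))) = 2 := by
  have h0 : x 0 ≠ 0 := by
    intro h0
    exact h ⟨x 1, by rw [disc, h0]; ring⟩
  set P := Polynomial.C (x 0) * Polynomial.X ^ 2 + Polynomial.C (x 1) * Polynomial.X +
      Polynomial.C (x 2) with hP
  have hdeg : P.natDegree = 2 := Polynomial.natDegree_quadratic h0
  have hirr : Irreducible P := by
    refine Polynomial.irreducible_of_degree_le_three_of_not_isRoot ?_ fun r hr ↦ h ?_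
    · rw [hdeg]; decide
    · rw [Polynomial.IsRoot.def, hP] at hr
      simp only [Polynomial.eval_add, Polynomial.eval_mul, Polynomial.eval_C, Polynomial.eval_pow,
        Polynomial.eval_X] at hr
      exact ⟨2 * x 0 * r + x 1, by rw [disc]; linear_combination (-4 * x 0) * hr⟩
  have hP0 : P ≠ 0 := hirr.ne_zero
  let L := P.SplittingField
  let ι := algebraMap k L
  have hroot : ∀ β : L, Polynomial.aeval β P = ι (x 0) * β ^ 2 + ι (x 1) * β + ι (x 2) := by
    intro β
    simp [hP, ι]
  obtain ⟨α, hα⟩ := (Polynomial.IsSplittingField.splits L P).exists_eval_eq_zero (by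
    rw [Polynomial.degree_map]
    exact Polynomial.degree_ne_of_natDegree_ne (by rw [hdeg]; norm_num))
  have hα' : Polynomial.aeval α P = 0 := by rwa [Polynomial.eval_map_algebraMap] at hα
  have hι0 : ι (x 0) ≠ 0 := by simpa using h0
  -- The other root is -x₁/x₀ - α, so a single root generates the splitting field.
  have htop : IntermediateField.adjoin k {α} = ⊤ := by
    have hαmem : α ∈ IntermediateField.adjoin k {α} := IntermediateField.mem_adjoin_simple_self k α
    have hle : Algebra.adjoin k (P.rootSet L) ≤ (IntermediateField.adjoin k {α}).toSubalgebra := by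
      refine Algebra.adjoin_le fun β hβ ↦ ?_
      have hβ' := (Polynomial.mem_rootSet.1 hβ).2
      rw [hroot] at hβ' hα'
      have h3 : (β - α) * (ι (x 0) * (β + α) + ι (x 1)) = 0 := by
        linear_combination hβ' - hα'
      rcases mul_eq_zero.1 h3 with h3 | h3
      · rw [sub_eq_zero.1 h3]; exact hαmem
      · have h4 : β + α = -ι (x 1) / ι (x 0) :=
          eq_div_of_mul_eq hι0 (by linear_combination h3)
        rw [eq_sub_of_add_eq h4]
        exact (IntermediateField.adjoin k {α}).sub_mem ((IntermediateField.adjoin k {α}).div_mem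
          (neg_mem (algebraMap_mem _ _)) (algebraMap_mem _ _)) hαmem
    rw [Polynomial.IsSplittingField.adjoin_rootSet] at hle
    exact eq_top_iff.2 fun y _ ↦ hle Algebra.mem_top
  have hint : IsIntegral k α := (isAlgebraic_iff_isIntegral).1 ⟨P, hP0, hα'⟩
  have h5 := IntermediateField.adjoin.finrank hint
  rw [htop, IntermediateField.finrank_top', ← minpoly.eq_of_irreducible hirr hα',
    Polynomial.natDegree_mul_C (inv_ne_zero (Polynomial.leadingCoeff_ne_zero.2 hP0)), hdeg] at h5
  exact h5

theorem mem_Vpp_iff (h2 : (2 : k) ≠ 0) {x : Fin 3 → k} : x ∈ Vpp k ↔ ¬ IsSquare (disc x) := by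
  constructor
  · rintro ⟨-, hx⟩ h
    have h1 := (Polynomial.IsSplittingField.splits_iff
      (Polynomial.C (x 0) * Polynomial.X ^ 2 + Polynomial.C (x 1) * Polynomial.X +
        Polynomial.C (x 2)).SplittingField _).1 (splits_of_isSquare_disc h2 h)
    have h3 := Subalgebra.bot_eq_top_iff_finrank_eq_one.1 h1.symm
    omega
  · intro h
    refine ⟨fun h0 ↦ h (h0 ▸ IsSquare.zero), finrank_splittingField_eq_two h⟩

/-- With x₀ = 0 the discriminant would be x₁². This is what restricting the sum to V_k'' provides
for convergence. -/
theorem ne_zero_of_mem_Vpp (h2 : (2 : k) ≠ 0) {x : Fin 3 → k} (hx : x ∈ Vpp k) : x 0 ≠ 0 := by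
  intro h0
  exact (mem_Vpp_iff h2).1 hx ⟨x 1, by rw [disc, h0]; ring⟩

theorem disc_rhoMatrix {R : Type*} [CommRing R] (g : G R) (x : Fin 3 → R) :
    disc (rhoMatrix g *ᵥ x) = (chiG R g : R) ^ 2 * disc x := by
  have h : (chiG R g : R) = g.1 * g.2.1.det := rfl
  rw [h, Matrix.det_fin_two]
  simp [disc, rhoMatrix, Matrix.mulVec, dotProduct, Fin.sum_univ_three]
  ring

theorem mulVec_mem_Vpp (h2 : (2 : k) ≠ 0) (g : G k) {x : Fin 3 → k} :
    (rho k g).1 *ᵥ x ∈ Vpp k ↔ x ∈ Vpp k := by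
  rw [mem_Vpp_iff h2, mem_Vpp_iff h2]
  have h := disc_rhoMatrix g x
  change disc ((rho k g).1 *ᵥ x) = _ at h
  rw [h, not_iff_not]
  have h0 : (chiG k g : k) ≠ 0 := (chiG k g).ne_zero
  constructor
  · rintro ⟨s, hs⟩
    exact ⟨s / chiG k g, by field_simp; linear_combination hs⟩
  · rintro ⟨s, hs⟩
    exact ⟨chiG k g * s, by rw [hs]; ring⟩

/-- The permutation of `V_k''` induced by an element of `H_k`. -/
def vppEquiv (h2 : (2 : k) ≠ 0) (g : G k) : Vpp k ≃ Vpp k where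
  toFun x := ⟨(rho k g).1 *ᵥ x.1, (mulVec_mem_Vpp h2 g).2 x.2⟩
  invFun x := ⟨(rho k g⁻¹).1 *ᵥ x.1, (mulVec_mem_Vpp h2 g⁻¹).2 x.2⟩
  left_inv x := Subtype.ext (by
    change (rho k g⁻¹).1 *ᵥ ((rho k g).1 *ᵥ x.1) = x.1
    rw [Matrix.mulVec_mulVec, ← Units.val_mul, ← map_mul, inv_mul_cancel, map_one, Units.val_one,
      Matrix.one_mulVec])
  right_inv x := Subtype.ext (by
    change (rho k g).1 *ᵥ ((rho k g⁻¹).1 *ᵥ x.1) = x.1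
    rw [Matrix.mulVec_mulVec, ← Units.val_mul, ← map_mul, mul_inv_cancel, map_one, Units.val_one,
      Matrix.one_mulVec])

end QuadraticForms

/-! ### Invariance under H_k -/

section Invariance

variable {k : Type*} [Field k]
variable (Fq : Type*) [Field Fq] [Finite Fq] [Algebra (RatFunc Fq) k] [FunctionField Fq k]

theorem exists_rho_of_mem_Hk {γ : HA k} (hγ : γ ∈ Hk k Fq) : ∃ g : G k,
    γ = rhoH (Adele k) (principalIdele Fq g.1, Matrix.GeneralLinearGroup.map (diag Fq k) g.2) ∧
    (γ : GL (Fin 3) (Adele k)) = Matrix.GeneralLinearGroup.map (diag Fq k) (rho k g) := by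
  obtain ⟨_, ⟨g, rfl⟩, h⟩ := hγ
  refine ⟨g, Subtype.ext ?_, h.symm⟩
  change (γ : GL (Fin 3) (Adele k)) = rho (Adele k) _
  have h' : Matrix.GeneralLinearGroup.map (diag Fq k) (rho k g) = (γ : GL (Fin 3) (Adele k)) := h
  rw [← h', map_rho]
  rfl

theorem act_mul (h γ : HA k) {g : G k}
    (hg : (γ : GL (Fin 3) (Adele k)) = Matrix.GeneralLinearGroup.map (diag Fq k) (rho k g))
    (x : Fin 3 → k) : act Fq (h * γ) x = act Fq h ((rho k g).1 *ᵥ x) := by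
  rw [act, act, Subgroup.coe_mul, Units.val_mul, ← Matrix.mulVec_mulVec, hg]
  congr 1
  ext1 i
  exact (RingHom.map_mulVec (diag Fq k) (rho k g).1 x i).symm

theorem ideleNorm_chi_eq_one {γ : HA k} (hγ : γ ∈ Hk k Fq) :
    ideleNorm (chi (Adele k) γ) = 1 := by
  obtain ⟨g, rfl, -⟩ := exists_rho_of_mem_Hk Fq hγ
  rw [chi_rhoH]
  have h : chiG (Adele k) (principalIdele Fq g.1, Matrix.GeneralLinearGroup.map (diag Fq k) g.2) =
      principalIdele Fq (chiG k g) := by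
    ext1
    change diag Fq k (g.1 : k) * ((diag Fq k).mapMatrix g.2.1).det = diag Fq k (g.1 * g.2.1.det)
    rw [map_mul, RingHom.map_det]
  rw [h]
  exact ideleNorm_principalIdele Fq _

theorem ideleNorm_chi_mul (Fq : Type*) [Field Fq] [Finite Fq] [Algebra (RatFunc Fq) k]
    [FunctionField Fq k] (h γ : HA k) : ideleNorm (chi (Adele k) (h * γ)) =
    ideleNorm (chi (Adele k) h) * ideleNorm (chi (Adele k) γ) := by
  rw [map_mul]
  exact ideleNorm_mul Fq _ _

/-- The factor |χ(γ)| is 1 by the product formula, and `γ` permutes V_k''. -/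
theorem zetaIntegrand_mul (h2 : (2 : k) ≠ 0) (Φ : (Fin 3 → Adele k) → ℂ) (s : ℂ) (h : HA k)
    {γ : HA k} (hγ : γ ∈ Hk k Fq) : zetaIntegrand Fq Φ s (h * γ) = zetaIntegrand Fq Φ s h := by
  obtain ⟨g, -, hg⟩ := exists_rho_of_mem_Hk Fq hγ
  rw [zetaIntegrand, zetaIntegrand, ideleNorm_chi_mul Fq, ideleNorm_chi_eq_one Fq hγ, mul_one]
  congr 1
  rw [← (vppEquiv h2 g).tsum_eq fun x ↦ Φ (act Fq h x)]
  exact tsum_congr fun x ↦ by rw [act_mul Fq h γ hg]; rfl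

theorem absZetaIntegrand_mul (h2 : (2 : k) ≠ 0) (Φ : (Fin 3 → Adele k) → ℂ) (s : ℂ) (h : HA k)
    {γ : HA k} (hγ : γ ∈ Hk k Fq) :
    absZetaIntegrand Fq Φ s (h * γ) = absZetaIntegrand Fq Φ s h := by
  obtain ⟨g, -, hg⟩ := exists_rho_of_mem_Hk Fq hγ
  rw [absZetaIntegrand, absZetaIntegrand, ideleNorm_chi_mul Fq, ideleNorm_chi_eq_one Fq hγ, mul_one]
  congr 1
  rw [← (vppEquiv h2 g).tsum_eq fun x ↦ ‖Φ (act Fq h x)‖ₑ]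
  exact tsum_congr fun x ↦ by rw [act_mul Fq h γ hg]; rfl

end Invariance

/-! ### Bounds for the inner sum -/

section ThetaBound

variable {k : Type*} [Field k]

theorem isOpen_ideleLattice (d : Idele k) : IsOpen (ideleLattice d : Set (Adele k)) := by
  have h : (ideleLattice d : Set (Adele k)) =
      (fun x ↦ ((d⁻¹ : Idele k) : Adele k) * x) ⁻¹' (integralAdeles k : Set (Adele k)) := by
    ext x
    refine forall_congr' fun v ↦ ?_
    change _ ↔ Valued.v (((d⁻¹ : Idele k) : Adele k) v * x v) ≤ 1
    rw [map_mul, valued_ideleInv, ← div_eq_inv_mul,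
      div_le_one₀ (zero_lt_iff.2 (valued_idele_ne_zero d v))]
  rw [h]
  exact isOpen_integralAdeles.preimage (continuous_const.mul continuous_id)

theorem exists_mem_ideleLattice (x : Adele k) : ∃ d : Idele k, x ∈ ideleLattice d := by
  classical
  refine ⟨ideleMk (fun v ↦ if (Valued.v (x v) : ℤᵐ⁰) ≤ 1 then 1 else x v) (fun v ↦ ?_)
    ((finite_not_integral x).subset fun v hv h ↦ hv ?_), fun v ↦ ?_⟩
  · split_ifs with h
    · exact one_ne_zero
    · intro h0
      rw [h0, map_zero] at h
      exact h zero_le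
  · rw [if_pos h, map_one]
  · rw [ideleMk_apply]
    split_ifs with h
    · rwa [map_one]
    · exact le_rfl

/-- The idele lattices form a directed open covering of the adeles. -/
theorem exists_subset_ideleLattice {S : Set (Adele k)} (hS : IsCompact S) :
    ∃ d : Idele k, S ⊆ ideleLattice d := by
  refine hS.elim_directed_cover (fun d : Idele k ↦ (ideleLattice d : Set (Adele k)))
    isOpen_ideleLattice (fun x _ ↦ Set.mem_iUnion.2 (exists_mem_ideleLattice x)) ?_
  intro a b
  -- Inversion reverses inclusions of idele lattices, so a common lower bound of the inverses gives
  -- a common upper bound.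
  obtain ⟨e, h1, h2⟩ := exists_ideleLattice_le_le a⁻¹ b⁻¹
  have key : ∀ c : Idele k, ideleLattice e ≤ ideleLattice c⁻¹ →
      ideleLattice c ≤ ideleLattice e⁻¹ := fun c hc ↦ ideleLattice_le.2 fun v ↦ by
    have h3 := ideleLattice_le.1 hc v
    rw [valued_ideleInv] at h3 ⊢
    exact (le_inv_comm₀ (zero_lt_iff.2 (valued_idele_ne_zero e v))
      (zero_lt_iff.2 (valued_idele_ne_zero c v))).1 h3
  exact ⟨e⁻¹, key a h1, key b h2⟩

theorem mulVec_mem_ideleLattice {n : Type*} [Fintype n] {M : Matrix n n (Adele k)}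
    (hM : ∀ i j, M i j ∈ integralAdeles k) {d : Idele k} {y : n → Adele k}
    (hy : ∀ i, y i ∈ ideleLattice d) (i : n) : (M *ᵥ y) i ∈ ideleLattice d := by
  rw [Matrix.mulVec, dotProduct]
  exact AddSubgroup.sum_mem _ fun j _ ↦ mul_mem_ideleLattice (hM i j) (hy j)

theorem exists_support_subset {Φ : (Fin 3 → Adele k) → ℂ} (hΦ : IsSchwartzBruhat Φ) :
    ∃ (d : Idele k), ∀ y, Φ y ≠ 0 → ∀ i, y i ∈ ideleLattice d := by
  have hu := exists_subset_ideleLattice (isCompact_iUnion fun i : Fin 3 ↦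
    hΦ.2.image (continuous_apply i))
  obtain ⟨d, hd⟩ := hu
  exact ⟨d, fun y hy i ↦ hd (Set.mem_iUnion.2 ⟨i, y, subset_tsupport Φ hy, rfl⟩)⟩

theorem exists_norm_le {Φ : (Fin 3 → Adele k) → ℂ} (hΦ : IsSchwartzBruhat Φ) :
    ∃ M : ℝ, 0 < M ∧ ∀ y, ‖Φ y‖ ≤ M := by
  obtain ⟨M, hM⟩ := hΦ.2.exists_bound_of_continuous hΦ.1.continuous
  exact ⟨max M 1, by positivity, fun y ↦ (hM y).trans (le_max_left _ _)⟩

variable (Fq : Type*) [Field Fq] [Finite Fq] [Algebra (RatFunc Fq) k] [FunctionField Fq k]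

/-- The sum `∑_{x ∈ V_k''} |Φ(h · x)|`. -/
def absTheta (Φ : (Fin 3 → Adele k) → ℂ) (h : HA k) : ℝ≥0∞ := ∑' x : Vpp k, ‖Φ (act Fq h x)‖ₑ

theorem absTheta_mul (h2 : (2 : k) ≠ 0) (Φ : (Fin 3 → Adele k) → ℂ) (h : HA k)
    {γ : HA k} (hγ : γ ∈ Hk k Fq) : absTheta Fq Φ (h * γ) = absTheta Fq Φ h := by
  obtain ⟨g, -, hg⟩ := exists_rho_of_mem_Hk Fq hγ
  rw [absTheta, absTheta, ← (vppEquiv h2 g).tsum_eq fun x ↦ ‖Φ (act Fq h x)‖ₑ]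
  exact tsum_congr fun x ↦ by rw [act_mul Fq h γ hg]; rfl

theorem act_mem_ideleLattice {κ : HA k} (hκ : κ ∈ integralH k) {h : HA k} {x : Fin 3 → k}
    {d : Idele k} (hx : ∀ i, act Fq (κ * h) x i ∈ ideleLattice d) (i : Fin 3) :
    act Fq h x i ∈ ideleLattice d := by
  have h1 : act Fq h x = (κ⁻¹ : HA k).1.1 *ᵥ act Fq (κ * h) x := by
    rw [act, act, Matrix.mulVec_mulVec, ← Units.val_mul, ← Subgroup.coe_mul, inv_mul_cancel_left]
  have h2 : κ⁻¹ ∈ integralH k := inv_mem hκ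
  rw [h1]
  exact mulVec_mem_ideleLattice h2.1 hx i

/-- Γ permutes V_k'' and K preserves (d𝒪)³, so the terms that do not vanish come from the lattice
points of the representative. -/
theorem absTheta_le {Φ : (Fin 3 → Adele k) → ℂ} {d : Idele k} (h2 : (2 : k) ≠ 0)
    (hd : ∀ y, Φ y ≠ 0 → ∀ i, y i ∈ ideleLattice d) {M : ℝ} (hM : ∀ y, ‖Φ y‖ ≤ M) {h h' : HA k}
    (hrel : DoubleCosetRel Fq h h') (hfin : (latticePoints Fq d h').Finite) :
    absTheta Fq Φ h ≤ (latticePoints Fq d h').ncard * ENNReal.ofReal M := by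
  obtain ⟨κ, hκ, γ, hγ, rfl⟩ := hrel
  rw [absTheta_mul Fq h2 Φ _ hγ, absTheta]
  let S : Set (Vpp k) := (↑) ⁻¹' latticePoints Fq d h'
  have hS : S.Finite := hfin.preimage Subtype.val_injective.injOn
  have hcard : S.ncard ≤ (latticePoints Fq d h').ncard := by
    rw [← Set.ncard_image_of_injective S Subtype.val_injective]
    exact Set.ncard_le_ncard (Set.image_preimage_subset _ _) hfin
  have h0 : ∀ x : Vpp k, x ∉ hS.toFinset → ‖Φ (act Fq (κ * h') x)‖ₑ = 0 := by
    intro x hx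
    by_contra hne
    refine hx (hS.mem_toFinset.2 ⟨ne_zero_of_mem_Vpp h2 x.2, ?_⟩)
    exact act_mem_ideleLattice Fq hκ (hd _ (by simpa using hne))
  rw [tsum_eq_sum h0]
  calc ∑ x ∈ hS.toFinset, ‖Φ (act Fq (κ * h') x)‖ₑ
      ≤ ∑ x ∈ hS.toFinset, ENNReal.ofReal M := by
        refine Finset.sum_le_sum fun x _ ↦ ?_
        rw [← ofReal_norm]
        exact ENNReal.ofReal_le_ofReal (hM _)
    _ = (hS.toFinset.card : ℝ≥0∞) * ENNReal.ofReal M := by rw [Finset.sum_const, nsmul_eq_mul]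
    _ ≤ _ := by
      rw [← Set.ncard_eq_toFinset_card S hS]
      gcongr

theorem exists_absTheta_le {Φ : (Fin 3 → Adele k) → ℂ} (hΦ : IsSchwartzBruhat Φ)
    (h2 : (2 : k) ≠ 0) {c₀ : ℝ} (hc₀ : 0 < c₀) : ∃ B D : ℝ, 0 < B ∧ 0 < D ∧
    ∀ (l a : Idele k) (c : Adele k), c₀ ≤ ideleNorm a → ∀ h : HA k,
      DoubleCosetRel Fq h (siegelElement l a c) → absTheta Fq Φ h ≤
        if ideleNorm l * ideleNorm a ≤ D then ENNReal.ofReal (B * (ideleNorm l ^ 3)⁻¹) else 0 := by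
  obtain ⟨d, hd⟩ := exists_support_subset hΦ
  obtain ⟨M, hM0, hM⟩ := exists_norm_le hΦ
  obtain ⟨C, hC0, hC⟩ := exists_ncard_latticePoints_le Fq d hc₀
  refine ⟨C * M, ideleNorm d, by positivity, ideleNorm_pos Fq d, fun l a c ha h hrel ↦ ?_⟩
  have h1 := absTheta_le Fq h2 hd hM hrel (latticePoints_siegelElement Fq d l a c).1
  refine h1.trans ?_
  split_ifs with hle
  · rw [← ENNReal.ofReal_natCast, ← ENNReal.ofReal_mul (Nat.cast_nonneg _)]
    refine ENNReal.ofReal_le_ofReal ?_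
    have := mul_le_mul_of_nonneg_right (hC l a c ha) hM0.le
    linarith
  · have h3 : ¬ (latticePoints Fq d (siegelElement l a c)).Nonempty := fun hne ↦
      hle (mul_le_of_latticePoints_nonempty Fq hne)
    rw [Set.not_nonempty_iff_eq_empty.1 h3]
    simp

theorem ideleNorm_chi_eq_of_rel {h h' : HA k} (hrel : DoubleCosetRel Fq h h') :
    ideleNorm (chi (Adele k) h) = ideleNorm (chi (Adele k) h') := by
  obtain ⟨κ, hκ, γ, hγ, rfl⟩ := hrel
  rw [ideleNorm_chi_mul Fq, ideleNorm_chi_mul Fq, ideleNorm_chi_eq_one Fq hγ,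
    ideleNorm_eq_one (chi_mem_integralUnits hκ), one_mul, mul_one]

theorem enorm_cpow_ideleNorm (Fq : Type*) [Field Fq] [Finite Fq] [Algebra (RatFunc Fq) k]
    [FunctionField Fq k] (a : Idele k) (s : ℂ) :
    ‖(ideleNorm a : ℂ) ^ s‖ₑ = ENNReal.ofReal (ideleNorm a ^ s.re) := by
  rw [← ofReal_norm, Complex.norm_cpow_eq_rpow_re_of_pos (ideleNorm_pos Fq a)]

end ThetaBound

/-! ### Countability of `k` -/

section Countability

theorem countable_polynomial (R : Type*) [CommRing R] [Countable R] : Countable R[X] := by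
  rw [← Cardinal.mk_le_aleph0_iff]
  exact Polynomial.cardinalMk_le_max.trans (max_le (Cardinal.mk_le_aleph0_iff.2 ‹_›) le_rfl)

theorem countable_functionField (Fq k : Type*) [Field Fq] [Finite Fq] [Field k]
    [Algebra (RatFunc Fq) k] [FunctionField Fq k] : Countable k := by
  have : Countable Fq[X] := countable_polynomial Fq
  have : Countable (RatFunc Fq) := by
    refine Function.Surjective.countable (f := fun p : Fq[X] × Fq[X] ↦
      algebraMap Fq[X] (RatFunc Fq) p.1 / algebraMap Fq[X] (RatFunc Fq) p.2) fun x ↦ ?_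
    obtain ⟨a, b, -, h⟩ := IsFractionRing.div_surjective (A := Fq[X]) x
    exact ⟨(a, b), h⟩
  have e := (Module.finBasis (RatFunc Fq) k).equivFun
  exact e.injective.countable

end Countability

/-! ### Measures of images in the quotient -/

section QuotientMeasureBounds

theorem exists_out_mk_eq {A : Type*} [Group A] {Γ : Subgroup A} (h : A) :
    ∃ γ ∈ Γ, (QuotientGroup.mk h : A ⧸ Γ).out = h * γ := by
  obtain ⟨γ, hγ⟩ := QuotientGroup.mk_out_eq_mul Γ h
  exact ⟨γ, γ.2, hγ⟩

variable {A : Type*} [Group A] [MeasurableSpace A] [TopologicalSpace A] [IsTopologicalGroup A]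
  [BorelSpace A] {Γ : Subgroup A}

theorem measurableSet_image_mk {U : Set A} (hU : IsOpen U) :
    MeasurableSet ((QuotientGroup.mk : A → A ⧸ Γ) '' U) := by
  have h : IsOpen ((QuotientGroup.mk : A → A ⧸ Γ) ⁻¹' (QuotientGroup.mk '' U)) :=
    (QuotientGroup.isOpenMap_coe U hU).preimage QuotientGroup.continuous_mk
  exact h.measurableSet

/-- The indicator function of U, summed over Γ, is at least 1 on every coset meeting U. -/
theorem IsQuotientMeasure.image_le {μ : Measure A} {ν : Measure (A ⧸ Γ)}
    (hν : IsQuotientMeasure Γ μ ν) {U : Set A} (hU : IsOpen U) :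
    ν ((QuotientGroup.mk : A → A ⧸ Γ) '' U) ≤ μ U := by
  have h := hν (U.indicator 1) (measurable_one.indicator hU.measurableSet)
  rw [lintegral_indicator_one hU.measurableSet] at h
  rw [h, ← lintegral_indicator_one (measurableSet_image_mk hU)]
  refine lintegral_mono fun y ↦ ?_
  by_cases hy : y ∈ (QuotientGroup.mk : A → A ⧸ Γ) '' U
  swap
  · rw [Set.indicator_of_notMem hy]
    exact zero_le
  rw [Set.indicator_of_mem hy]
  obtain ⟨u, hu, rfl⟩ := hy
  obtain ⟨γ, hγ, h1⟩ := exists_out_mk_eq (Γ := Γ) u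
  refine le_trans ?_ (ENNReal.le_tsum (⟨γ⁻¹, inv_mem hγ⟩ : Γ))
  rw [h1, mul_inv_cancel_right, Set.indicator_of_mem hu]
  exact le_rfl

end QuotientMeasureBounds

/-! ### Measurability and comparison of integrands -/

section Measurability

variable {k : Type*} [Field k]
variable (Fq : Type*) [Field Fq] [Finite Fq] [Algebra (RatFunc Fq) k] [FunctionField Fq k]

/-- χ takes unit values on K, so |χ| is constant on the open cosets K h. -/
theorem isLocallyConstant_ideleNorm_chi (Fq : Type*) [Field Fq] [Finite Fq] [Algebra (RatFunc Fq) k]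
    [FunctionField Fq k] :
    IsLocallyConstant fun h : HA k ↦ ideleNorm (chi (Adele k) h) := by
  rw [IsLocallyConstant.iff_exists_open]
  intro h
  refine ⟨(fun x ↦ x * h⁻¹) ⁻¹' (integralH k : Set (HA k)),
    isOpen_integralH.preimage (continuous_mul_const _), ?_, fun x hx ↦ ?_⟩
  · rw [Set.mem_preimage, mul_inv_cancel]
    exact one_mem (integralH k)
  · have h1 : x = (x * h⁻¹) * h := (inv_mul_cancel_right x h).symm
    rw [h1, ideleNorm_chi_mul Fq, ideleNorm_eq_one (chi_mem_integralUnits hx), one_mul]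

theorem continuous_act (x : Fin 3 → k) : Continuous fun h : HA k ↦ act Fq h x := by
  unfold act
  exact (Units.continuous_val.comp continuous_subtype_val).matrix_mulVec continuous_const

theorem absTheta_lt_top {Φ : (Fin 3 → Adele k) → ℂ} (hΦ : IsSchwartzBruhat Φ) (h2 : (2 : k) ≠ 0)
    (h : HA k) : absTheta Fq Φ h < ⊤ := by
  obtain ⟨c₀, hc₀, H⟩ := exists_rel_siegelElement k Fq
  obtain ⟨B, D, -, -, hB⟩ := exists_absTheta_le Fq hΦ h2 hc₀
  obtain ⟨l, a, c, hrel, ha⟩ := H h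
  refine (hB l a c ha h hrel).trans_lt ?_
  split_ifs
  exacts [ENNReal.ofReal_lt_top, ENNReal.zero_lt_top]

theorem summable_norm_act {Φ : (Fin 3 → Adele k) → ℂ} (hΦ : IsSchwartzBruhat Φ) (h2 : (2 : k) ≠ 0)
    (h : HA k) : Summable fun x : Vpp k ↦ ‖Φ (act Fq h x)‖ := by
  have h1 := ENNReal.summable_toReal (absTheta_lt_top Fq hΦ h2 h).ne
  simpa using h1

/-- The sum is the limit of its finite partial sums, which are continuous; countability of `k` makes
this limit measurable. -/
theorem measurable_zetaIntegrand {Φ : (Fin 3 → Adele k) → ℂ} (hΦ : IsSchwartzBruhat Φ)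
    (h2 : (2 : k) ≠ 0) (s : ℂ) : Measurable (zetaIntegrand Fq Φ s) := by
  have : Countable k := countable_functionField Fq k
  refine Measurable.mul ?_ ?_
  · have h1 := (isLocallyConstant_ideleNorm_chi (k := k) Fq).comp fun x : ℝ ↦ (x : ℂ) ^ s
    exact h1.continuous.measurable
  · refine measurable_of_tendsto_metrizable' (f := fun (S : Finset (Vpp k)) (h : HA k) ↦
      ∑ x ∈ S, Φ (act Fq h x)) Filter.atTop (fun S ↦ ?_) (tendsto_pi_nhds.2 fun h ↦ ?_)
    · exact Finset.measurable_fun_sum _ fun x _ ↦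
        (hΦ.1.continuous.comp (continuous_act Fq x.1)).measurable
    · exact (summable_norm_act Fq hΦ h2 h).of_norm.hasSum

theorem measurable_out {β : Type*} [MeasurableSpace β] {f : HA k → β} (hf : Measurable f)
    (hinv : ∀ h, ∀ γ ∈ Hk k Fq, f (h * γ) = f h) :
    Measurable fun y : HA k ⧸ Hk k Fq ↦ f y.out := by
  refine measurable_from_quotient.2 ?_
  convert hf using 1
  ext1 h
  obtain ⟨γ, hγ, h1⟩ := exists_out_mk_eq (Γ := Hk k Fq) h
  change f (QuotientGroup.mk h : HA k ⧸ Hk k Fq).out = f h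
  rw [h1, hinv h γ hγ]

theorem absZetaIntegrand_eq (Φ : (Fin 3 → Adele k) → ℂ) (s : ℂ) (h : HA k) :
    absZetaIntegrand Fq Φ s h =
      ENNReal.ofReal (ideleNorm (chi (Adele k) h) ^ s.re) * absTheta Fq Φ h := by
  rw [absZetaIntegrand, ← enorm_cpow_ideleNorm Fq]
  rfl

theorem enorm_zetaIntegrand_le (Φ : (Fin 3 → Adele k) → ℂ) (s : ℂ) (h : HA k) :
    ‖zetaIntegrand Fq Φ s h‖ₑ ≤ absZetaIntegrand Fq Φ s h := by
  rw [zetaIntegrand, absZetaIntegrand, enorm_mul]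
  gcongr
  exact enorm_tsum_le_tsum_enorm

/-- One extreme exponent suffices for x ≤ 1 and the other for x ≥ 1. This reduces uniformity in `s`
to two exponents. -/
theorem rpow_le_add_rpow {x a b c : ℝ} (hx : 0 < x) (hab : a ≤ b) (hbc : b ≤ c) :
    x ^ b ≤ x ^ a + x ^ c := by
  have h1 := Real.rpow_pos_of_pos hx a
  have h2 := Real.rpow_pos_of_pos hx c
  rcases le_total x 1 with h | h
  · linarith [Real.rpow_le_rpow_of_exponent_ge hx h hab]
  · linarith [Real.rpow_le_rpow_of_exponent_le h hbc]

theorem absZetaIntegrand_le_add (Φ : (Fin 3 → Adele k) → ℂ) {s : ℂ} {a b : ℝ} (ha : a ≤ s.re)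
    (hb : s.re ≤ b) (h : HA k) : absZetaIntegrand Fq Φ s h ≤
      absZetaIntegrand Fq Φ a h + absZetaIntegrand Fq Φ b h := by
  have h0 : 0 < ideleNorm (chi (Adele k) h) := ideleNorm_pos Fq _
  have h1 := Real.rpow_pos_of_pos h0 a
  have h2 := Real.rpow_pos_of_pos h0 b
  rw [absZetaIntegrand_eq, absZetaIntegrand_eq, absZetaIntegrand_eq, ← add_mul,
    ← ENNReal.ofReal_add (by simpa using h1.le) (by simpa using h2.le)]
  gcongr
  exact rpow_le_add_rpow h0 (by simpa using ha) (by simpa using hb)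

end Measurability

/-! ### Convergence, local uniformity and holomorphy -/

section Convergence

variable {k : Type*} [Field k]
variable (Fq : Type*) [Field Fq] [Finite Fq] [Algebra (RatFunc Fq) k] [FunctionField Fq k]

/-- A countable covering of `H_𝔸` by double cosets, on each of which the integrand is bounded by a
term of a convergent series. -/
theorem exists_dominating_covering {Φ : (Fin 3 → Adele k) → ℂ} (hΦ : IsSchwartzBruhat Φ)
    (h2 : (2 : k) ≠ 0) [LocallyCompactSpace (HA k)] :
    ∃ (E : Finset (Idele k)) (N : ℕ) (J : Set (((ℤ × E) × (ℤ × E)) × Fin N)) (g : J → HA k)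
      (W : ℝ → J → ℝ≥0∞), (∀ h, ∃ j, DoubleCosetRel Fq h (g j)) ∧
      (∀ j, Measure.modularCharacter (g j) = 1) ∧
      (∀ j h, DoubleCosetRel Fq h (g j) → ∀ s : ℂ, absZetaIntegrand Fq Φ s h ≤ W s.re j) ∧
      ∀ σ : ℝ, 3 < σ → ∑' j, W σ j ≠ ⊤ := by
  obtain ⟨c₀, ϖ, E, N, rep, hc₀, hϖ1, hcov⟩ := exists_double_coset_representatives k Fq
  obtain ⟨B, D, hB0, hD0, hB⟩ := exists_absTheta_le Fq hΦ h2 hc₀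
  let l : ((ℤ × E) × (ℤ × E)) × Fin N → Idele k := fun p ↦ ϖ ^ p.1.1.1 * p.1.1.2.1
  let a : ((ℤ × E) × (ℤ × E)) × Fin N → Idele k := fun p ↦ ϖ ^ p.1.2.1 * p.1.2.2.1
  have hl0 : ∀ p, 0 < ideleNorm (l p) := fun p ↦ ideleNorm_pos Fq _
  refine ⟨E, N, {p | c₀ ≤ ideleNorm (a p)}, fun p ↦ siegelElement (l p) (a p) (rep (a p) p.1.2),
    fun σ p ↦ if ideleNorm (l p) * ideleNorm (a p) ≤ D then
      ENNReal.ofReal (B * ideleNorm (l p) ^ (σ - 3)) else 0, fun h ↦ ?_, fun p ↦ ?_,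
    fun p h hrel s ↦ ?_, fun σ hσ ↦ ?_⟩
  · obtain ⟨m, m', e, e', i, h1, hrel⟩ := hcov h
    exact ⟨⟨(((m, e), (m', e')), i), h1⟩, hrel⟩
  · exact modularCharacter_siegelElement _ _ _
  · have h1 := hB _ _ _ p.2 h hrel
    rw [absZetaIntegrand_eq, ideleNorm_chi_eq_of_rel Fq hrel, chi_siegelElement]
    refine (mul_le_mul_right h1 _).trans ?_
    beta_reduce
    split_ifs with hle
    · rw [← ENNReal.ofReal_mul (Real.rpow_nonneg (hl0 p).le _)]
      refine ENNReal.ofReal_le_ofReal (le_of_eq ?_)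
      rw [Real.rpow_sub (hl0 p), ← Real.rpow_natCast _ 3]
      push_cast
      ring
    · rw [mul_zero]
  · have hsum := ((summable_double_coset_weights (w := fun e : E ↦ ideleNorm e.1)
      (fun e ↦ ideleNorm_pos Fq _) (ideleNorm_pos Fq ϖ) hϖ1 hc₀ hD0 (sub_pos.2 hσ) N).mul_left
      B).tsum_ofReal_ne_top
    refine ne_top_of_le_ne_top hsum ?_
    refine le_trans (ENNReal.tsum_le_tsum fun p ↦ ?_)
      (ENNReal.tsum_comp_le_tsum_of_injective Subtype.val_injective _)
    have hl : ideleNorm (l p) = ideleNorm ϖ ^ p.1.1.1.1 * ideleNorm p.1.1.1.2.1 := by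
      rw [ideleNorm_mul Fq, ideleNorm_zpow Fq]
    have ha : ideleNorm (a p) = ideleNorm ϖ ^ p.1.1.2.1 * ideleNorm p.1.1.2.2.1 := by
      rw [ideleNorm_mul Fq, ideleNorm_zpow Fq]
    have hp : c₀ ≤ ideleNorm (a p) := p.2
    beta_reduce
    by_cases hle : ideleNorm (l p) * ideleNorm (a p) ≤ D
    · rw [if_pos hle, if_pos ⟨by rw [← ha]; exact hp, by rw [← ha, ← hl]; exact hle⟩, hl]
    · rw [if_neg hle]
      exact zero_le

variable {Fq}

/-- The image of the coset `K h` in `H_𝔸 / H_k`. -/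
def cosetImage (h : HA k) : Set (HA k ⧸ Hk k Fq) :=
  QuotientGroup.mk '' ((fun x ↦ x * h⁻¹) ⁻¹' (integralH k : Set (HA k)))

theorem isOpen_coset (h : HA k) : IsOpen ((fun x ↦ x * h⁻¹) ⁻¹' (integralH k : Set (HA k))) :=
  isOpen_integralH.preimage (continuous_mul_const _)

theorem isCompact_cosetImage (h : HA k) : IsCompact (cosetImage (Fq := Fq) h) := by
  have h1 : IsCompact ((fun x ↦ x * h⁻¹) ⁻¹' (integralH k : Set (HA k))) :=
    (Homeomorph.mulRight h⁻¹).isCompact_preimage.2 (isCompact_integralH Fq)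
  exact h1.image QuotientGroup.continuous_mk

theorem doubleCosetRel_of_mem_cosetImage {h : HA k} {y : HA k ⧸ Hk k Fq} (hy : y ∈ cosetImage h) :
    DoubleCosetRel Fq y.out h := by
  obtain ⟨x, hx, rfl⟩ := hy
  obtain ⟨γ, hγ, h1⟩ := exists_out_mk_eq (Γ := Hk k Fq) x
  exact ⟨x * h⁻¹, hx, γ, hγ, by rw [h1, inv_mul_cancel_right]⟩

theorem mem_cosetImage_of_doubleCosetRel {h : HA k} {y : HA k ⧸ Hk k Fq}
    (hy : DoubleCosetRel Fq y.out h) : y ∈ cosetImage h := by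
  obtain ⟨κ, hκ, γ, hγ, h1⟩ := hy
  refine ⟨κ * h, ?_, ?_⟩
  · rw [Set.mem_preimage, mul_inv_cancel_right]
    exact hκ
  · have h3 : (QuotientGroup.mk (κ * h * γ) : HA k ⧸ Hk k Fq) = QuotientGroup.mk (κ * h) :=
      QuotientGroup.mk_mul_of_mem _ hγ
    rw [← h3, ← h1]
    exact Quotient.out_eq' y

variable {μ : Measure (HA k)} [μ.IsHaarMeasure] {ν : Measure (HA k ⧸ Hk k Fq)}

/-- The map to the quotient does not increase the measure of K h, which equals that of K because the
modular character is 1 at `h`. -/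
theorem measure_cosetImage_le [LocallyCompactSpace (HA k)] (hν : IsQuotientMeasure (Hk k Fq) μ ν)
    {h : HA k} (hh : Measure.modularCharacter h = 1) :
    ν (cosetImage h) ≤ μ (integralH k : Set (HA k)) :=
  (hν.image_le (isOpen_coset h)).trans_eq (measure_mul_right_eq μ hh (isCompact_integralH Fq))

/-- The main estimate: tails of the integral are bounded by tails of a convergent series. -/
theorem lintegral_compl_le [LocallyCompactSpace (HA k)] (hν : IsQuotientMeasure (Hk k Fq) μ ν)
    {J : Type*} [Countable J] {g : J → HA k} (hcov : ∀ h, ∃ j, DoubleCosetRel Fq h (g j))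
    (hmod : ∀ j, Measure.modularCharacter (g j) = 1) {F : HA k → ℝ≥0∞} {W : J → ℝ≥0∞}
    (hW : ∀ j h, DoubleCosetRel Fq h (g j) → F h ≤ W j) (S : Finset J) :
    ∫⁻ y in (⋃ j ∈ S, cosetImage (g j))ᶜ, F y.out ∂ν ≤
      ∑' j : {j // j ∉ S}, W j * μ (integralH k : Set (HA k)) := by
  have hsub : (⋃ j ∈ S, cosetImage (Fq := Fq) (g j))ᶜ ⊆
      ⋃ j : {j // j ∉ S}, cosetImage (Fq := Fq) (g j) := by
    intro y hy
    obtain ⟨j, hj⟩ := hcov y.out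
    have hyj := mem_cosetImage_of_doubleCosetRel hj
    refine Set.mem_iUnion.2 ⟨⟨j, fun hjS ↦ hy ?_⟩, hyj⟩
    exact Set.mem_biUnion hjS hyj
  refine (lintegral_mono_set hsub).trans ((lintegral_iUnion_le _ _).trans
    (ENNReal.tsum_le_tsum fun j ↦ ?_))
  calc ∫⁻ y in cosetImage (g j), F y.out ∂ν ≤ ∫⁻ _ in cosetImage (g j), W j ∂ν :=
        setLIntegral_mono' (measurableSet_image_mk (isOpen_coset _)) fun y hy ↦
          hW j _ (doubleCosetRel_of_mem_cosetImage hy)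
    _ = W j * ν (cosetImage (g j)) := setLIntegral_const _ _
    _ ≤ _ := by
      gcongr
      exact measure_cosetImage_le hν (hmod j)

variable {Φ : (Fin 3 → Adele k) → ℂ}

theorem lintegral_absZetaIntegrand_lt_top (hν : IsQuotientMeasure (Hk k Fq) μ ν)
    (hΦ : IsSchwartzBruhat Φ) (h2 : (2 : k) ≠ 0) {s : ℂ} (hs : 3 < s.re) :
    ∫⁻ y : HA k ⧸ Hk k Fq, absZetaIntegrand Fq Φ s y.out ∂ν < ⊤ := by
  have : LocallyCompactSpace (HA k) := locallyCompactSpace_HA Fq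
  obtain ⟨E, N, J, g, W, hcov, hmod, hW, hsum⟩ := exists_dominating_covering Fq hΦ h2
  -- With no coset removed the tail is the whole integral.
  have h := lintegral_compl_le hν hcov hmod (F := absZetaIntegrand Fq Φ s) (W := W s.re)
    (fun j h hj ↦ hW j h hj s) ∅
  simp only [Finset.notMem_empty, Set.iUnion_of_empty, Set.iUnion_empty, Set.compl_empty,
    Measure.restrict_univ] at h
  refine h.trans_lt ?_
  rw [ENNReal.tsum_mul_right]
  refine ENNReal.mul_lt_top ?_ (isCompact_integralH Fq).measure_lt_top
  exact (ENNReal.tsum_comp_le_tsum_of_injective Subtype.val_injective _).trans_lt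
    (hsum s.re hs).lt_top

theorem exists_isCompact_lintegral_compl_lt (hν : IsQuotientMeasure (Hk k Fq) μ ν)
    (hΦ : IsSchwartzBruhat Φ) (h2 : (2 : k) ≠ 0) {C : Set ℂ} (hC : IsCompact C)
    (hC3 : C ⊆ {s : ℂ | 3 < s.re}) {ε : ℝ≥0∞} (hε : 0 < ε) :
    ∃ E : Set (HA k ⧸ Hk k Fq), IsCompact E ∧ ∀ s ∈ C,
      ∫⁻ y in Eᶜ, absZetaIntegrand Fq Φ s y.out ∂ν < ε := by
  have : LocallyCompactSpace (HA k) := locallyCompactSpace_HA Fq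
  rcases C.eq_empty_or_nonempty with rfl | hne
  · exact ⟨∅, isCompact_empty, by simp⟩
  obtain ⟨E, N, J, g, W, hcov, hmod, hW, hsum⟩ := exists_dominating_covering Fq hΦ h2
  obtain ⟨s₀, hs₀, hmin⟩ := hC.exists_isMinOn hne Complex.continuous_re.continuousOn
  obtain ⟨s₁, hs₁, hmax⟩ := hC.exists_isMaxOn hne Complex.continuous_re.continuousOn
  -- The least and the greatest real part on `C` give one convergent series dominating the
  -- integrands for all `s` in `C`.
  let V : J → ℝ≥0∞ := fun j ↦ W s₀.re j + W s₁.re j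
  have hV : ∑' j, V j * μ (integralH k : Set (HA k)) ≠ ⊤ := by
    rw [ENNReal.tsum_mul_right, ENNReal.tsum_add]
    exact ENNReal.mul_ne_top (ENNReal.add_ne_top.2 ⟨hsum _ (hC3 hs₀), hsum _ (hC3 hs₁)⟩)
      (isCompact_integralH Fq).measure_lt_top.ne
  obtain ⟨S, hS⟩ := ((ENNReal.tendsto_tsum_compl_atTop_zero hV).eventually_lt_const hε).exists
  refine ⟨⋃ j ∈ S, cosetImage (g j), S.isCompact_biUnion fun j _ ↦ isCompact_cosetImage _,
    fun s hs ↦ (lintegral_compl_le hν hcov hmod (W := V) (fun j h hj ↦ ?_) S).trans_lt hS⟩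
  refine (absZetaIntegrand_le_add Fq Φ (hmin hs) (hmax hs) h).trans ?_
  exact add_le_add (by simpa using hW j h hj s₀.re) (by simpa using hW j h hj s₁.re)

theorem aestronglyMeasurable_zetaIntegrand (hΦ : IsSchwartzBruhat Φ) (h2 : (2 : k) ≠ 0) (s : ℂ) :
    AEStronglyMeasurable (fun y : HA k ⧸ Hk k Fq ↦ zetaIntegrand Fq Φ s y.out) ν :=
  (measurable_out Fq (measurable_zetaIntegrand Fq hΦ h2 s)
    fun h _ hγ ↦ zetaIntegrand_mul Fq h2 Φ s h hγ).aestronglyMeasurable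

theorem integrable_zetaIntegrand (hν : IsQuotientMeasure (Hk k Fq) μ ν)
    (hΦ : IsSchwartzBruhat Φ) (h2 : (2 : k) ≠ 0) {s : ℂ} (hs : 3 < s.re) :
    Integrable (fun y : HA k ⧸ Hk k Fq ↦ zetaIntegrand Fq Φ s y.out) ν :=
  ⟨aestronglyMeasurable_zetaIntegrand hΦ h2 s,
    (lintegral_mono fun _ ↦ enorm_zetaIntegrand_le Fq Φ s _).trans_lt
      (lintegral_absZetaIntegrand_lt_top hν hΦ h2 hs)⟩

theorem abs_log_le {x δ : ℝ} (hx : 0 < x) (hδ : 0 < δ) :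
    |Real.log x| ≤ δ⁻¹ * (x ^ (-δ) + x ^ δ) := by
  have h1 := Real.log_le_rpow_div hx.le hδ
  have h2 := Real.log_le_rpow_div (inv_pos.2 hx).le hδ
  rw [Real.log_inv, Real.inv_rpow hx.le, ← Real.rpow_neg hx.le] at h2
  have h3 : 0 < x ^ δ / δ := by positivity
  have h4 : 0 < x ^ (-δ) / δ := by positivity
  rw [inv_mul_eq_div, add_div, abs_le]
  constructor <;> linarith

theorem norm_zetaIntegrand (s : ℂ) (h : HA k) : ‖zetaIntegrand Fq Φ s h‖ =
    ideleNorm (chi (Adele k) h) ^ s.re * ‖∑' x : Vpp k, Φ (act Fq h x)‖ := by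
  rw [zetaIntegrand, norm_mul, Complex.norm_cpow_eq_rpow_re_of_pos (ideleNorm_pos Fq _)]

theorem hasDerivAt_zetaIntegrand (s : ℂ) (h : HA k) :
    HasDerivAt (fun s ↦ zetaIntegrand Fq Φ s h)
      ((Real.log (ideleNorm (chi (Adele k) h)) : ℂ) * zetaIntegrand Fq Φ s h) s := by
  have h0 : 0 < ideleNorm (chi (Adele k) h) := ideleNorm_pos Fq _
  have h1 := ((hasDerivAt_id s).const_cpow (c := (ideleNorm (chi (Adele k) h) : ℂ))
    (Or.inl (by exact_mod_cast h0.ne'))).mul_const (∑' x : Vpp k, Φ (act Fq h x))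
  refine h1.congr_deriv ?_
  rw [zetaIntegrand, Complex.ofReal_log h0.le]
  simp only [id]
  ring

/-- The logarithm costs at most powers of exponent ±δ. Expanding the product leaves the exponents σ
- 2δ, σ (twice) and σ + 2δ, a bound independent of `s`. -/
theorem norm_log_mul_zetaIntegrand_le {s : ℂ} {σ δ : ℝ} (hδ : 0 < δ) (h1 : σ - δ ≤ s.re)
    (h3 : s.re ≤ σ + δ) (h : HA k) :
    ‖(Real.log (ideleNorm (chi (Adele k) h)) : ℂ) * zetaIntegrand Fq Φ s h‖ ≤
      δ⁻¹ * (‖zetaIntegrand Fq Φ ((σ - 2 * δ : ℝ) : ℂ) h‖ + 2 * ‖zetaIntegrand Fq Φ (σ : ℂ) h‖ +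
        ‖zetaIntegrand Fq Φ ((σ + 2 * δ : ℝ) : ℂ) h‖) := by
  have h0 : 0 < ideleNorm (chi (Adele k) h) := ideleNorm_pos Fq _
  rw [norm_mul, norm_zetaIntegrand, norm_zetaIntegrand, norm_zetaIntegrand, norm_zetaIntegrand,
    Complex.norm_real, Real.norm_eq_abs, Complex.ofReal_re, Complex.ofReal_re, Complex.ofReal_re]
  set X := ideleNorm (chi (Adele k) h)
  set T := ‖∑' x : Vpp k, Φ (act Fq h x)‖
  have hT : 0 ≤ T := norm_nonneg _
  calc |Real.log X| * (X ^ s.re * T)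
      ≤ (δ⁻¹ * (X ^ (-δ) + X ^ δ)) * ((X ^ (σ - δ) + X ^ (σ + δ)) * T) := by
        gcongr
        · exact abs_log_le h0 hδ
        · exact rpow_le_add_rpow h0 h1 h3
    _ = δ⁻¹ * ((X ^ (-δ) * X ^ (σ - δ)) * T + (X ^ δ * X ^ (σ - δ)) * T +
          (X ^ (-δ) * X ^ (σ + δ)) * T + (X ^ δ * X ^ (σ + δ)) * T) := by ring
    _ = _ := by
      rw [← Real.rpow_add h0, ← Real.rpow_add h0, ← Real.rpow_add h0, ← Real.rpow_add h0,
        show -δ + (σ - δ) = σ - 2 * δ by ring, show δ + (σ - δ) = σ by ring,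
        show -δ + (σ + δ) = σ by ring, show δ + (σ + δ) = σ + 2 * δ by ring]
      ring

theorem differentiableOn_globalZeta (hν : IsQuotientMeasure (Hk k Fq) μ ν)
    (hΦ : IsSchwartzBruhat Φ) (h2 : (2 : k) ≠ 0) :
    DifferentiableOn ℂ (globalZeta Fq ν Φ) {s : ℂ | 3 < s.re} := by
  intro s₀ hs₀
  have hs₀' : 3 < s₀.re := hs₀
  -- With a third of the distance to 3, the exponent Re s₀ - 2δ of the dominating function is still
  -- greater than 3.
  let δ := (s₀.re - 3) / 3
  have hδ : 0 < δ := by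
    have := sub_pos.2 hs₀'
    positivity
  have hint : ∀ σ : ℝ, 3 < σ →
      Integrable (fun y : HA k ⧸ Hk k Fq ↦ ‖zetaIntegrand Fq Φ (σ : ℂ) y.out‖) ν := fun σ hσ ↦
    (integrable_zetaIntegrand hν hΦ h2 (by simpa using hσ)).norm
  have hlog : Measurable fun y : HA k ⧸ Hk k Fq ↦
      (Real.log (ideleNorm (chi (Adele k) y.out)) : ℂ) := by
    refine measurable_out Fq (f := fun h ↦ (Real.log (ideleNorm (chi (Adele k) h)) : ℂ)) ?_ ?_
    · exact ((isLocallyConstant_ideleNorm_chi (k := k) Fq).comp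
        fun x : ℝ ↦ (Real.log x : ℂ)).continuous.measurable
    · intro h γ hγ
      rw [ideleNorm_chi_mul Fq, ideleNorm_chi_eq_one Fq hγ, mul_one]
  have h := hasDerivAt_integral_of_dominated_loc_of_deriv_le (μ := ν)
    (F := fun s y ↦ zetaIntegrand Fq Φ s y.out) (s := Metric.ball s₀ δ)
    (F' := fun s y ↦ (Real.log (ideleNorm (chi (Adele k) y.out)) : ℂ) * zetaIntegrand Fq Φ s y.out)
    (bound := fun y ↦ δ⁻¹ * (‖zetaIntegrand Fq Φ ((s₀.re - 2 * δ : ℝ) : ℂ) y.out‖ +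
      2 * ‖zetaIntegrand Fq Φ (s₀.re : ℂ) y.out‖ +
        ‖zetaIntegrand Fq Φ ((s₀.re + 2 * δ : ℝ) : ℂ) y.out‖))
    (Metric.ball_mem_nhds s₀ hδ)
    (Filter.Eventually.of_forall fun s ↦ aestronglyMeasurable_zetaIntegrand hΦ h2 s)
    (integrable_zetaIntegrand hν hΦ h2 hs₀')
    (hlog.aestronglyMeasurable.mul (aestronglyMeasurable_zetaIntegrand hΦ h2 s₀))
    (Filter.Eventually.of_forall fun y s hs ↦ ?_)
    ((((hint _ ?_).add ((hint _ hs₀').const_mul 2)).add (hint _ ?_)).const_mul _)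
    (Filter.Eventually.of_forall fun y s _ ↦ hasDerivAt_zetaIntegrand s y.out)
  · exact h.2.differentiableAt.differentiableWithinAt
  · have h1 : |s.re - s₀.re| < δ := by
      rw [← Complex.sub_re]
      exact (Complex.abs_re_le_norm _).trans_lt (mem_ball_iff_norm.1 hs)
    rw [abs_lt] at h1
    exact norm_log_mul_zetaIntegrand_le hδ (by linarith) (by linarith) _
  · simp only [δ]; linarith
  · linarith

end Convergence

end

end BinaryQuadraticZeta

theorem mainTheorem9 {Fq k : Type*} [Field Fq] [Finite Fq] [Field k] [Algebra (RatFunc Fq) k]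
    [FunctionField Fq k] (hchar : ringChar k ≠ 2)
    (μ : Measure (HA k)) [μ.IsHaarMeasure]
    (ν : Measure (HA k ⧸ Hk k Fq)) (hν : IsQuotientMeasure (Hk k Fq) μ ν)
    (Φ : (Fin 3 → Adele k) → ℂ) (hΦ : IsSchwartzBruhat Φ) :
    -- the integrands are functions on `H_𝔸 / H_k`
    (∀ (s : ℂ) (h : HA k), ∀ γ ∈ Hk k Fq,
      zetaIntegrand Fq Φ s (h * γ) = zetaIntegrand Fq Φ s h ∧
      absZetaIntegrand Fq Φ s (h * γ) = absZetaIntegrand Fq Φ s h) ∧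
    -- absolute convergence of the inner sum and of the integral
    (∀ h : HA k, Summable fun x : Vpp k ↦ ‖Φ (act Fq h x)‖) ∧
    (∀ s : ℂ, 3 < s.re →
      ∫⁻ y : HA k ⧸ Hk k Fq, absZetaIntegrand Fq Φ s y.out ∂ν < ⊤ ∧
      Integrable (fun y : HA k ⧸ Hk k Fq ↦ zetaIntegrand Fq Φ s y.out) ν) ∧
    -- local uniformity: on compact sets of `s`, the tails of the integral are uniformly small
    (∀ C : Set ℂ, IsCompact C → C ⊆ {s : ℂ | 3 < s.re} → ∀ ε : ℝ≥0∞, 0 < ε →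
      ∃ E : Set (HA k ⧸ Hk k Fq), IsCompact E ∧ ∀ s ∈ C,
        ∫⁻ y in Eᶜ, absZetaIntegrand Fq Φ s y.out ∂ν < ε) ∧
    -- holomorphy
    DifferentiableOn ℂ (globalZeta Fq ν Φ) {s : ℂ | 3 < s.re} := by
  have h2 : (2 : k) ≠ 0 := Ring.two_ne_zero hchar
  exact ⟨fun s h γ hγ ↦ ⟨zetaIntegrand_mul Fq h2 Φ s h hγ, absZetaIntegrand_mul Fq h2 Φ s h hγ⟩,
    summable_norm_act Fq hΦ h2,
    fun s hs ↦ ⟨lintegral_absZetaIntegrand_lt_top hν hΦ h2 hs, integrable_zetaIntegrand hν hΦ h2 hs⟩,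
    fun C hC hC3 ε hε ↦ exists_isCompact_lintegral_compl_lt hν hΦ h2 hC hC3 hε,
    differentiableOn_globalZeta hν hΦ h2⟩
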